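/- Let $n\ge 3$ and let $\overline{\mathcal M}$ be a smooth compact $n$-dimensional manifold with boundary, carrying a Riemannian metric $\mathring h$ smooth up to the boundary. Let $\rho\ge 0$ be a smooth function on $\overline{\mathcal M}$ whose zero set $\partial_\infty\mathcal M=\{\rho=0\}$ is a non-empty union of components of $\partial\overline{\mathcal M}$ (the remaining components, if any, form an inner boundary), and suppose that $|d\rho|_{\mathring h}=1$ on $\partial_\infty\mathcal M$. Thus $\mathcal M=\{\rho>0\}$ with the metric $\mathring g=\rho^{-2}\mathring h$ is an asymptotically hyperbolic manifold. Write $\mathring\nabla$ for the Levi-Civita connection and $d\mu(\mathring g)$ for the Riemannian measure of $\mathring g$. For a 1-form $X$ set $$\mathring S(X)_{ij}=\tfrac12\big(\mathring\nabla_iX_j+\mathring\nabla_jX_i\big),\qquad \mathring U_{kji}(X)=\mathring\nabla_k\mathring\nabla_jX_i-\mathring g_{jk}X_i+\mathring g_{ik}X_j .$$ For $R>0$ let $E_R=\{0<\rho\le e^{-2R}\}$, and for a tensor field $u$ and $s\in\mathbb R$ let $$\|u\|_{2,s;E_R}=\Big(\int_{E_R}|u|_{\mathring g}^2\,\rho^{2s}\,d\mu(\mathring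 g)\Big)^{1/2},\qquad \|X\|_{1,2,s;E_R}=\|X\|_{2,s;E_R}+\|\mathring\nabla X\|_{2,s;E_R}.$$ Then for every $\delta\in(-2,-1)$ there exist $R_0>0$ and $c>0$, depending only on $\delta$ and on $(\overline{\mathcal M},\mathring h,\rho)$, such that for every $R>R_0$ and every 1-form $X$ that is smooth on $E_R$, up to its inner boundary $\{\rho=e^{-2R}\}$, and has compact support in $E_R$ (so $X$ vanishes near $\partial_\infty\mathcal M$, but need not vanish on $\{\rho=e^{-2R}\}$), $$\|X\|_{1,2,-\delta;E_R}\le c\,\big(\|\mathring U(X)\|_{2,-\delta;E_R}+\|\mathring S(X)\|_{2,-\delta;E_R}\big).$$ -/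

import Mathlib

open Set MeasureTheory
open scoped Manifold ContDiff ENNReal NNReal

noncomputable section

/-! ## Tensor calculus in the charts of a manifold with boundary -/

section Calculus

variable {n : ℕ} [NeZero n] {M : Type*} [TopologicalSpace M]
  [ChartedSpace (EuclideanHalfSpace n) M]

/-- A field of bilinear forms on the tangent spaces (for instance a Riemannian metric). -/
abbrev BilinField (n : ℕ) [NeZero n] (M : Type*) [TopologicalSpace M]
    [ChartedSpace (EuclideanHalfSpace n) M] :=
  (x : M) → TangentSpace (𝓡∂ n) x →L[ℝ] TangentSpace (𝓡∂ n) x →L[ℝ] ℝ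

/-- A (not necessarily smooth) 1-form. -/
abbrev OneForm (n : ℕ) [NeZero n] (M : Type*) [TopologicalSpace M]
    [ChartedSpace (EuclideanHalfSpace n) M] :=
  (x : M) → TangentSpace (𝓡∂ n) x →L[ℝ] ℝ

/-- The coordinate vector `∂ᵢ` of the chart around `p`, at the point with coordinates `y`. -/
def coordVec (p : M) (y : EuclideanSpace ℝ (Fin n)) (i : Fin n) :
    TangentSpace (𝓡∂ n) ((extChartAt (𝓡∂ n) p).symm y) :=
  mfderivWithin 𝓘(ℝ, EuclideanSpace ℝ (Fin n)) (𝓡∂ n) (extChartAt (𝓡∂ n) p).symm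
    (range (𝓡∂ n)) y (EuclideanSpace.single i (1 : ℝ))

/-- The matrix `(g_ij)` of a field of bilinear forms in the chart around `p`. -/
def metricCoord (g : BilinField n M) (p : M) (y : EuclideanSpace ℝ (Fin n)) :
    Matrix (Fin n) (Fin n) ℝ :=
  Matrix.of fun i j => g ((extChartAt (𝓡∂ n) p).symm y) (coordVec p y i) (coordVec p y j)

/-- The components `X_i` of a 1-form in the chart around `p`. -/
def formCoord (X : OneForm n M) (p : M) (y : EuclideanSpace ℝ (Fin n)) (i : Fin n) : ℝ :=
  X ((extChartAt (𝓡∂ n) p).symm y) (coordVec p y i)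

/-- The partial derivative `∂ₖ f` in the closed half space, which is the range of all charts. -/
def partialDeriv (k : Fin n) (f : EuclideanSpace ℝ (Fin n) → ℝ)
    (y : EuclideanSpace ℝ (Fin n)) : ℝ :=
  fderivWithin ℝ f (range (𝓡∂ n)) y (EuclideanSpace.single k (1 : ℝ))

/-- The Christoffel symbol `Γᵏ_ij` of `g`. -/
def christoffel (g : BilinField n M) (p : M) (y : EuclideanSpace ℝ (Fin n))
    (k i j : Fin n) : ℝ :=
  (1 / 2 : ℝ) * ∑ l, (metricCoord g p y)⁻¹ k l *
    (partialDeriv i (fun z => metricCoord g p z j l) y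
      + partialDeriv j (fun z => metricCoord g p z i l) y
      - partialDeriv l (fun z => metricCoord g p z i j) y)

/-- The components `∇_i X_j` of the covariant derivative of a 1-form. -/
def covDeriv (g : BilinField n M) (X : OneForm n M) (p : M) (y : EuclideanSpace ℝ (Fin n))
    (i j : Fin n) : ℝ :=
  partialDeriv i (fun z => formCoord X p z j) y
    - ∑ l, christoffel g p y l i j * formCoord X p y l

/-- The components `∇²_kj X_i = ∇_k ∇_j X_i` of the second covariant derivative of a 1-form. -/
def covDeriv₂ (g : BilinField n M) (X : OneForm n M) (p : M) (y : EuclideanSpace ℝ (Fin n))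
    (k j i : Fin n) : ℝ :=
  partialDeriv k (fun z => covDeriv g X p z j i) y
    - ∑ l, christoffel g p y l k j * covDeriv g X p y l i
    - ∑ l, christoffel g p y l k i * covDeriv g X p y j l

/-- The Killing operator `S(X)_ij = (∇_i X_j + ∇_j X_i) / 2`. -/
def killingOp (g : BilinField n M) (X : OneForm n M) (p : M) (y : EuclideanSpace ℝ (Fin n))
    (i j : Fin n) : ℝ :=
  (1 / 2 : ℝ) * (covDeriv g X p y i j + covDeriv g X p y j i)

/-- The operator `U(X)_kji = ∇²_kj X_i - g_jk X_i + g_ik X_j`. -/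
def opU (g : BilinField n M) (X : OneForm n M) (p : M) (y : EuclideanSpace ℝ (Fin n))
    (k j i : Fin n) : ℝ :=
  covDeriv₂ g X p y k j i - metricCoord g p y j k * formCoord X p y i
    + metricCoord g p y i k * formCoord X p y j

/-- `|T|²` for a covariant 1-tensor, `G` being the matrix of the metric. -/
def normSq₁ (G : Matrix (Fin n) (Fin n) ℝ) (T : Fin n → ℝ) : ℝ :=
  ∑ i, ∑ i', G⁻¹ i i' * T i * T i'

/-- `|T|²` for a covariant 2-tensor. -/
def normSq₂ (G : Matrix (Fin n) (Fin n) ℝ) (T : Fin n → Fin n → ℝ) : ℝ :=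
  ∑ i, ∑ i', ∑ j, ∑ j', G⁻¹ i i' * G⁻¹ j j' * T i j * T i' j'

/-- `|T|²` for a covariant 3-tensor. -/
def normSq₃ (G : Matrix (Fin n) (Fin n) ℝ) (T : Fin n → Fin n → Fin n → ℝ) : ℝ :=
  ∑ i, ∑ i', ∑ j, ∑ j', ∑ k, ∑ k', G⁻¹ i i' * G⁻¹ j j' * G⁻¹ k k' * T i j k * T i' j' k'

/-- The function `|X|_g²` on `M`. (Here and below the tensor is evaluated at `x` in the chart
around `x`; the norm does not depend on the chart.) -/
def formNormSq (g : BilinField n M) (X : OneForm n M) (x : M) : ℝ :=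
  normSq₁ (metricCoord g x (extChartAt (𝓡∂ n) x x)) (formCoord X x (extChartAt (𝓡∂ n) x x))

/-- The function `|∇X|_g²` on `M`. -/
def covDerivNormSq (g : BilinField n M) (X : OneForm n M) (x : M) : ℝ :=
  normSq₂ (metricCoord g x (extChartAt (𝓡∂ n) x x)) (covDeriv g X x (extChartAt (𝓡∂ n) x x))

/-- The function `|S(X)|_g²` on `M`. -/
def killingNormSq (g : BilinField n M) (X : OneForm n M) (x : M) : ℝ :=
  normSq₂ (metricCoord g x (extChartAt (𝓡∂ n) x x)) (killingOp g X x (extChartAt (𝓡∂ n) x x))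

/-- The function `|U(X)|_g²` on `M`. -/
def opUNormSq (g : BilinField n M) (X : OneForm n M) (x : M) : ℝ :=
  normSq₃ (metricCoord g x (extChartAt (𝓡∂ n) x x)) (opU g X x (extChartAt (𝓡∂ n) x x))

/-- The 1-form `X` is smooth on the set `A`, as a section of the cotangent bundle. -/
def SmoothFormOn [IsManifold (𝓡∂ n) ∞ M] (X : OneForm n M) (A : Set M) : Prop :=
  ContMDiffOn (𝓡∂ n) ((𝓡∂ n).prod 𝓘(ℝ, EuclideanSpace ℝ (Fin n) →L[ℝ] ℝ)) ∞
    (fun x => Bundle.TotalSpace.mk' (EuclideanSpace ℝ (Fin n) →L[ℝ] ℝ)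
      (E := fun x : M => TangentSpace (𝓡∂ n) x →L[ℝ] Bundle.Trivial M ℝ x) x (X x)) A

/-- The measure `√(det g) dy` of the chart around `p`, as a measure on `M` carried by the domain of
that chart. -/
def chartVolume [MeasurableSpace M] (g : BilinField n M) (p : M) : Measure M :=
  Measure.map (extChartAt (𝓡∂ n) p).symm
    ((volume.restrict (extChartAt (𝓡∂ n) p).target).withDensity
      fun y => ENNReal.ofReal (Real.sqrt (metricCoord g p y).det))

/-- The Riemannian measure of `g`: the least measure that dominates `√(det g) dy` in every chart.
(The measures of the charts agree on overlaps, so it is equal to `√(det g) dy` in every chart.) -/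
def riemannianMeasure [MeasurableSpace M] (g : BilinField n M) : Measure M :=
  ⨆ p : M, chartVolume g p

end Calculus

/-! ## Asymptotically hyperbolic manifolds -/

/-- An asymptotically hyperbolic structure on the interior-at-infinity `{ρ > 0}` of the compact
manifold with boundary `Mbar`: a metric `h` smooth up to the boundary and a defining function `ρ` of
the boundary at infinity `{ρ = 0}`, which is a nonempty union of boundary components, with
`|dρ|_h = 1` there. The other boundary components, if any, form the inner boundary. -/
structure AsymptoticallyHyperbolic (n : ℕ) [NeZero n] (Mbar : Type*) [TopologicalSpace Mbar]
    [ChartedSpace (EuclideanHalfSpace n) Mbar] [IsManifold (𝓡∂ n) ∞ Mbar] where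
  /-- the metric on the compactification -/
  h : Bundle.ContMDiffRiemannianMetric (𝓡∂ n) ∞ (EuclideanSpace ℝ (Fin n))
    (fun x : Mbar => TangentSpace (𝓡∂ n) x)
  /-- the defining function -/
  ρ : Mbar → ℝ
  smooth : ContMDiff (𝓡∂ n) 𝓘(ℝ, ℝ) ∞ ρ
  nonneg : ∀ x, 0 ≤ ρ x
  infinity_nonempty : ∃ x, ρ x = 0
  infinity_subset : {x | ρ x = 0} ⊆ (𝓡∂ n).boundary Mbar
  isClosed_inner : IsClosed ((𝓡∂ n).boundary Mbar ∩ {x | 0 < ρ x})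
  normSq_dρ : ∀ x, ρ x = 0 →
    formNormSq (fun z => h.inner z) (fun z => mfderiv (𝓡∂ n) 𝓘(ℝ, ℝ) ρ z) x = 1

namespace AsymptoticallyHyperbolic

variable {n : ℕ} [NeZero n] {Mbar : Type*} [TopologicalSpace Mbar]
  [ChartedSpace (EuclideanHalfSpace n) Mbar] [IsManifold (𝓡∂ n) ∞ Mbar]

/-- The metric `g = ρ⁻² h`, a Riemannian metric on `{ρ > 0}`. -/
def g (𝓐 : AsymptoticallyHyperbolic n Mbar) : BilinField n Mbar :=
  fun x => ((𝓐.ρ x) ^ 2)⁻¹ • 𝓐.h.inner x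

/-- The end `E_R = {0 < ρ ≤ e^{-2R}}`. -/
def endSet (𝓐 : AsymptoticallyHyperbolic n Mbar) (R : ℝ) : Set Mbar :=
  {x | 0 < 𝓐.ρ x ∧ 𝓐.ρ x ≤ Real.exp (-2 * R)}

/-- `X ∈ C_c^∞(E_R)`: smooth on `E_R` up to its inner boundary `{ρ = e^{-2R}}`, and vanishing outside
a compact subset of `E_R`; `X` need not vanish on `{ρ = e^{-2R}}`. -/
def IsTestForm (𝓐 : AsymptoticallyHyperbolic n Mbar) (R : ℝ) (X : OneForm n Mbar) : Prop :=
  SmoothFormOn X (𝓐.endSet R) ∧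
    ∃ K : Set Mbar, IsCompact K ∧ K ⊆ 𝓐.endSet R ∧ ∀ x ∈ 𝓐.endSet R \ K, X x = 0

variable [MeasurableSpace Mbar]

/-- The weighted norm `‖u‖_{2,δ;A} = (∫_A |u|_g² ρ^{2δ} dμ(g))^{1/2}`, in terms of `uSq = |u|_g²`. -/
def weightedL2 (𝓐 : AsymptoticallyHyperbolic n Mbar) (δ : ℝ) (A : Set Mbar) (uSq : Mbar → ℝ) :
    ℝ≥0∞ :=
  (∫⁻ x in A, ENNReal.ofReal (uSq x * 𝓐.ρ x ^ (2 * δ)) ∂(riemannianMeasure 𝓐.g)) ^ (1 / 2 : ℝ)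

/-- The weighted Sobolev norm `‖X‖_{1,2,δ;A} = ‖X‖_{2,δ;A} + ‖∇X‖_{2,δ;A}`. -/
def weightedW12 (𝓐 : AsymptoticallyHyperbolic n Mbar) (δ : ℝ) (A : Set Mbar)
    (X : OneForm n Mbar) : ℝ≥0∞ :=
  𝓐.weightedL2 δ A (formNormSq 𝓐.g X) + 𝓐.weightedL2 δ A (covDerivNormSq 𝓐.g X)

end AsymptoticallyHyperbolic

end

/-!
Near infinity the estimate is the energy estimate of a first order system with a regular singular
point at `ρ = 0`.

Since the antisymmetric part of `∇X` is `f = dX / 2` and its symmetric part is `S(X)`, it suffices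
to estimate `X` and `f`. In a chart of the compactification the rescaled pair `z = (ρ X, ρ² f)`
satisfies `ρ ∂ₖ z = Lₖ z + Eₖ`. Here `Lₖ` is algebraic in the metric `h` and in `dρ`, and is the
operator obtained for Killing forms of hyperbolic space (`modelDerivForm`, `modelDerivTwoForm`). The
error `Eₖ` is bounded by `S(X)`, `U(X)` and `ρ |z|`, because `∇f` is determined by the
antisymmetric part of `U(X)` in the last two indices (`scaled_form_equation`,
`scaled_curl_equation`, `abs_scaledPair_error_le`).

To the pair belongs a vector field `J`, the quadratic form `current` in `z`, with two properties.

* Its divergence, weighted with `ρ ^ (1 + 2 s - n)`, is bounded below by a multiple of `|z|²` in the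
  model if `|dρ| = 1` and `s < 2`: with `p = f(∇ρ, ·)` and `T` for the parts tangential to the level
  sets of `ρ`, it is
  `(n + 1 - 2 s) |x_T - p|² + |x_T + p|² + (n - 1) (n - 2) x_ν² + |f_T|²`.
  This is stable under small changes of `|dρ|` (`coercive_scalar`, `exists_model_coercive`), so that
  it holds near infinity, with the error `Eₖ` absorbed (`exists_local_estimate`). The norm with the
  weight exponent `-δ` corresponds to `s = -δ`.
* The component `dρ(J)` is nonpositive for every pair, by the Cauchy–Schwarz inequality
  (`dotProduct_current_nonpos`). The flux through the inner boundary of the end, where no boundary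
  condition is available, can therefore be dropped.

The second property is used in the following form: in the weight `ρ ^ (1 + 2 s - n) χ(ρ)` with a
decreasing cutoff function `χ` that vanishes before the inner boundary, the derivative of `χ`
contributes with the favourable sign (`mul_deriv_cutoffWeight_le`). Thus only vector fields with
compact support in the interior have to be integrated. A partition of unity reduces this to the
charts (`setIntegral_localizedIntegrand_nonpos`); the terms with the differentials of its members
cancel (`sum_chartPairing_eq_zero`), because the norms and the pairing of a covector with `J` do not
depend on the chart (`RegularOn.formNormSq_eq` and its analogues, `RegularOn.chartPairing_eq`), and
because the Riemannian measure has the expected density in every chart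
(`riemannianMeasure_restrict`). In `exists_weighted_inequality` the constants come from the compact
supports of the partition of unity and do not depend on the 1-form.

Finally the cutoff is moved to the inner boundary, by monotone convergence
(`lintegral_openEnd_le`). The level set `{ρ = exp (-2 R)}` itself is a null set, since `dρ` does not
vanish near infinity (`exists_level_set_null`).
-/

noncomputable section

/-! ### Change of frame for covariant tensors -/

section Frames

variable {n : ℕ}

/-- The components of a covariant 1-tensor in the frame whose vectors are the columns of `B`. -/
def pull₁ (B : Matrix (Fin n) (Fin n) ℝ) (T : Fin n → ℝ) (a : Fin n) : ℝ :=
  ∑ i, B i a * T i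

/-- The components of a covariant 2-tensor in the frame whose vectors are the columns of `B`. -/
def pull₂ (B : Matrix (Fin n) (Fin n) ℝ) (T : Fin n → Fin n → ℝ) (a b : Fin n) : ℝ :=
  pull₁ B (fun i => pull₁ B (T i) b) a

/-- The components of a covariant 3-tensor in the frame whose vectors are the columns of `B`. -/
def pull₃ (B : Matrix (Fin n) (Fin n) ℝ) (T : Fin n → Fin n → Fin n → ℝ) (a b c : Fin n) : ℝ :=
  pull₁ B (fun i => pull₂ B (T i) b c) a

lemma pull₁_pull₁ (A B : Matrix (Fin n) (Fin n) ℝ) (T : Fin n → ℝ) :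
    pull₁ B (pull₁ A T) = pull₁ (A * B) T := by
  funext a
  simp only [pull₁, Matrix.mul_apply, Finset.mul_sum, Finset.sum_mul]
  rw [Finset.sum_comm]
  exact Finset.sum_congr rfl fun i _ => Finset.sum_congr rfl fun j _ => by ring

lemma pull₁_comm (A B : Matrix (Fin n) (Fin n) ℝ) (T : Fin n → Fin n → ℝ) (a b : Fin n) :
    pull₁ A (fun i => pull₁ B (T i) b) a = pull₁ B (fun j => pull₁ A (fun i => T i j) a) b := by
  simp only [pull₁, Finset.mul_sum]
  rw [Finset.sum_comm]
  exact Finset.sum_congr rfl fun i _ => Finset.sum_congr rfl fun j _ => by ring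

lemma pull₂_pull₂ (A B : Matrix (Fin n) (Fin n) ℝ) (T : Fin n → Fin n → ℝ) :
    pull₂ B (pull₂ A T) = pull₂ (A * B) T := by
  funext a b
  have h : ∀ k, pull₁ B (fun j => pull₁ A (fun i => pull₁ A (T i) j) k) b
      = pull₁ A (fun i => pull₁ (A * B) (T i) b) k := by
    intro k
    rw [← pull₁_comm A B (fun i j => pull₁ A (T i) j) k b]
    congr 1
    funext i
    exact congrFun (pull₁_pull₁ A B (T i)) b
  have h' : pull₂ B (pull₂ A T) a b
      = pull₁ B (fun k => pull₁ B (fun j => pull₁ A (fun i => pull₁ A (T i) j) k) b) a := rfl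
  rw [h']
  simp only [h]
  exact congrFun (pull₁_pull₁ A B _) a

lemma pull₃_pull₃ (A B : Matrix (Fin n) (Fin n) ℝ) (T : Fin n → Fin n → Fin n → ℝ) :
    pull₃ B (pull₃ A T) = pull₃ (A * B) T := by
  funext a b c
  have hlin : ∀ k, pull₂ B (fun j l => pull₁ A (fun i => pull₂ A (T i) j l) k) b c
      = pull₁ A (fun i => pull₂ B (pull₂ A (T i)) b c) k := by
    intro k
    have h1 : pull₁ A (fun i => pull₂ B (pull₂ A (T i)) b c) k
        = pull₁ A (fun i => pull₁ B (fun j => pull₁ B (pull₂ A (T i) j) c) b) k := rfl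
    rw [h1, pull₁_comm A B (fun i j => pull₁ B (pull₂ A (T i) j) c)]
    refine congrArg (fun S => pull₁ B S b) (funext fun j => ?_)
    exact (pull₁_comm A B (fun i => pull₂ A (T i) j) k c).symm
  have h : pull₃ B (pull₃ A T) a b c
      = pull₁ B (fun k => pull₂ B (fun j l => pull₁ A (fun i => pull₂ A (T i) j l) k) b c) a := rfl
  rw [h]
  simp only [hlin, pull₂_pull₂]
  exact congrFun (pull₁_pull₁ A B _) a

lemma pull₁_one (T : Fin n → ℝ) : pull₁ 1 T = T := by
  funext a
  simp [pull₁, Matrix.one_apply]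

lemma pull₂_one (T : Fin n → Fin n → ℝ) : pull₂ 1 T = T := by
  funext a b
  simp [pull₂, pull₁_one]

lemma pull₃_one (T : Fin n → Fin n → Fin n → ℝ) : pull₃ 1 T = T := by
  funext a b c
  simp [pull₃, pull₁_one, pull₂_one]

lemma sum_mul_transpose_contract (B : Matrix (Fin n) (Fin n) ℝ) (u v : Fin n → ℝ) :
    ∑ i, ∑ i', (B * B.transpose) i i' * u i * v i' = ∑ a, pull₁ B u a * pull₁ B v a := by
  have h : ∀ i i', (B * B.transpose) i i' * u i * v i' = ∑ a, B i a * u i * (B i' a * v i') := by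
    intro i i'
    rw [Matrix.mul_apply, Finset.sum_mul, Finset.sum_mul]
    exact Finset.sum_congr rfl fun a _ => by rw [Matrix.transpose_apply]; ring
  simp only [h, pull₁, Finset.sum_mul_sum]
  refine Eq.trans (Finset.sum_congr rfl fun i _ => Finset.sum_comm) ?_
  exact Finset.sum_comm

lemma normSq₁_eq_of_frame {G B : Matrix (Fin n) (Fin n) ℝ} (h : G⁻¹ = B * B.transpose)
    (T : Fin n → ℝ) : normSq₁ G T = ∑ a, pull₁ B T a ^ 2 := by
  rw [normSq₁, h, sum_mul_transpose_contract]
  exact Finset.sum_congr rfl fun a _ => (sq _).symm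

lemma normSq₂_eq_of_frame {G B : Matrix (Fin n) (Fin n) ℝ} (h : G⁻¹ = B * B.transpose)
    (T : Fin n → Fin n → ℝ) : normSq₂ G T = ∑ a, ∑ b, pull₂ B T a b ^ 2 := by
  have h1 : ∀ i i', ∑ j, ∑ j', G⁻¹ i i' * G⁻¹ j j' * T i j * T i' j'
      = ∑ b, G⁻¹ i i' * pull₁ B (T i) b * pull₁ B (T i') b := by
    intro i i'
    simp only [mul_assoc]
    rw [← Finset.mul_sum, ← sum_mul_transpose_contract, ← h, Finset.mul_sum]
    exact Finset.sum_congr rfl fun j _ => by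
      rw [Finset.mul_sum]
      exact Finset.sum_congr rfl fun j' _ => by ring
  simp only [normSq₂, h1]
  calc _ = ∑ b, ∑ i, ∑ i', G⁻¹ i i' * pull₁ B (T i) b * pull₁ B (T i') b := by
        rw [Finset.sum_comm]
        refine Eq.trans (Finset.sum_congr rfl fun i' _ => Finset.sum_comm) ?_
        rw [Finset.sum_comm]
        exact Finset.sum_congr rfl fun b _ => Finset.sum_comm
    _ = ∑ b, ∑ a, pull₂ B T a b ^ 2 := by
        refine Finset.sum_congr rfl fun b _ => ?_
        rw [h, sum_mul_transpose_contract]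
        exact Finset.sum_congr rfl fun a _ => (sq _).symm
    _ = _ := Finset.sum_comm

lemma normSq₃_eq_of_frame {G B : Matrix (Fin n) (Fin n) ℝ} (h : G⁻¹ = B * B.transpose)
    (T : Fin n → Fin n → Fin n → ℝ) :
    normSq₃ G T = ∑ a, ∑ b, ∑ c, pull₃ B T a b c ^ 2 := by
  have h2 : ∀ S S' : Fin n → Fin n → ℝ, ∑ j, ∑ j', ∑ k, ∑ k', G⁻¹ j j' * G⁻¹ k k' * S j k * S' j' k'
      = ∑ b, ∑ c, pull₂ B S b c * pull₂ B S' b c := by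
    intro S S'
    have h1 : ∀ i i', ∑ j, ∑ j', G⁻¹ i i' * G⁻¹ j j' * S i j * S' i' j'
        = ∑ b, G⁻¹ i i' * pull₁ B (S i) b * pull₁ B (S' i') b := by
      intro i i'
      simp only [mul_assoc]
      rw [← Finset.mul_sum, ← sum_mul_transpose_contract, ← h, Finset.mul_sum]
      exact Finset.sum_congr rfl fun j _ => by
        rw [Finset.mul_sum]
        exact Finset.sum_congr rfl fun j' _ => by ring
    simp only [h1]
    calc _ = ∑ b, ∑ i, ∑ i', G⁻¹ i i' * pull₁ B (S i) b * pull₁ B (S' i') b := by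
          rw [Finset.sum_comm]
          refine Eq.trans (Finset.sum_congr rfl fun i' _ => Finset.sum_comm) ?_
          rw [Finset.sum_comm]
          exact Finset.sum_congr rfl fun b _ => Finset.sum_comm
      _ = ∑ b, ∑ a, pull₂ B S a b * pull₂ B S' a b := by
          refine Finset.sum_congr rfl fun b _ => ?_
          rw [h, sum_mul_transpose_contract]
          rfl
      _ = _ := Finset.sum_comm
  have h3 : ∀ i i', ∑ j, ∑ j', ∑ k, ∑ k', G⁻¹ i i' * G⁻¹ j j' * G⁻¹ k k' * T i j k * T i' j' k'
      = ∑ b, ∑ c, G⁻¹ i i' * pull₂ B (T i) b c * pull₂ B (T i') b c := by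
    intro i i'
    simp only [mul_assoc]
    simp only [← Finset.mul_sum]
    congr 1
    rw [← h2]
    simp only [Finset.mul_sum, mul_assoc]
  simp only [normSq₃, h3]
  calc _ = ∑ b, ∑ c, ∑ i, ∑ i', G⁻¹ i i' * pull₂ B (T i) b c * pull₂ B (T i') b c := by
        refine Eq.trans (Finset.sum_congr rfl fun i _ => Finset.sum_comm) ?_
        rw [Finset.sum_comm]
        refine Finset.sum_congr rfl fun b _ => ?_
        refine Eq.trans (Finset.sum_congr rfl fun i _ => Finset.sum_comm) ?_
        rw [Finset.sum_comm]
    _ = ∑ b, ∑ c, ∑ a, pull₃ B T a b c ^ 2 := by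
        refine Finset.sum_congr rfl fun b _ => Finset.sum_congr rfl fun c _ => ?_
        rw [h, sum_mul_transpose_contract]
        exact Finset.sum_congr rfl fun a _ => (sq _).symm
    _ = _ := by
        rw [Finset.sum_comm' (s := Finset.univ) (t := fun _ => Finset.univ) (t' := Finset.univ)
          (s' := fun _ => Finset.univ) (by simp)]
        refine Eq.trans (Finset.sum_congr rfl fun b _ => Finset.sum_comm) ?_
        refine Eq.trans Finset.sum_comm ?_
        refine Finset.sum_congr rfl fun a _ => ?_
        exact Finset.sum_comm

open scoped MatrixOrder ComplexOrder in
/-- Every positive definite matrix has an orthonormal frame, given by the columns of `B`. In its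
components the squared norm of a tensor is a sum of squares. -/
lemma exists_frame {G : Matrix (Fin n) (Fin n) ℝ} (hG : G.PosDef) :
    ∃ B : Matrix (Fin n) (Fin n) ℝ, IsUnit B ∧ G⁻¹ = B * B.transpose := by
  have hs : IsStrictlyPositive G⁻¹ := hG.inv.isStrictlyPositive
  obtain ⟨y, hy, h⟩ := CStarAlgebra.isStrictlyPositive_iff_eq_star_mul_self.mp hs
  refine ⟨star y, hy.star, ?_⟩
  rw [h]
  rfl

lemma pull₁_eq_zero {B : Matrix (Fin n) (Fin n) ℝ} (hB : IsUnit B) {T : Fin n → ℝ}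
    (h : pull₁ B T = 0) : T = 0 := by
  have := pull₁_pull₁ B B⁻¹ T
  rw [Matrix.mul_nonsing_inv B ((Matrix.isUnit_iff_isUnit_det B).1 hB), pull₁_one, h] at this
  rw [← this]
  funext a
  simp [pull₁]

lemma pull₂_eq_zero {B : Matrix (Fin n) (Fin n) ℝ} (hB : IsUnit B) {T : Fin n → Fin n → ℝ}
    (h : pull₂ B T = 0) : T = 0 := by
  have := pull₂_pull₂ B B⁻¹ T
  rw [Matrix.mul_nonsing_inv B ((Matrix.isUnit_iff_isUnit_det B).1 hB), pull₂_one, h] at this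
  rw [← this]
  funext a b
  simp [pull₂, pull₁]

lemma pull₃_eq_zero {B : Matrix (Fin n) (Fin n) ℝ} (hB : IsUnit B) {T : Fin n → Fin n → Fin n → ℝ}
    (h : pull₃ B T = 0) : T = 0 := by
  have := pull₃_pull₃ B B⁻¹ T
  rw [Matrix.mul_nonsing_inv B ((Matrix.isUnit_iff_isUnit_det B).1 hB), pull₃_one, h] at this
  rw [← this]
  funext a b c
  simp [pull₃, pull₂, pull₁]

lemma normSq₁_nonneg {G : Matrix (Fin n) (Fin n) ℝ} (hG : G.PosDef) (T : Fin n → ℝ) :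
    0 ≤ normSq₁ G T := by
  obtain ⟨B, -, h⟩ := exists_frame hG
  rw [normSq₁_eq_of_frame h]
  positivity

lemma normSq₂_nonneg {G : Matrix (Fin n) (Fin n) ℝ} (hG : G.PosDef) (T : Fin n → Fin n → ℝ) :
    0 ≤ normSq₂ G T := by
  obtain ⟨B, -, h⟩ := exists_frame hG
  rw [normSq₂_eq_of_frame h]
  positivity

lemma normSq₃_nonneg {G : Matrix (Fin n) (Fin n) ℝ} (hG : G.PosDef)
    (T : Fin n → Fin n → Fin n → ℝ) : 0 ≤ normSq₃ G T := by
  obtain ⟨B, -, h⟩ := exists_frame hG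
  rw [normSq₃_eq_of_frame h]
  positivity

lemma normSq₁_pos {G : Matrix (Fin n) (Fin n) ℝ} (hG : G.PosDef) {T : Fin n → ℝ} (hT : T ≠ 0) :
    0 < normSq₁ G T := by
  obtain ⟨B, hB, h⟩ := exists_frame hG
  rw [normSq₁_eq_of_frame h]
  by_contra hc
  have h0 := le_antisymm (not_lt.1 hc) (by positivity)
  refine hT (pull₁_eq_zero hB (funext fun a => ?_))
  rw [Finset.sum_eq_zero_iff_of_nonneg fun _ _ => sq_nonneg _] at h0
  simpa using h0 a (Finset.mem_univ _)

lemma normSq₂_pos {G : Matrix (Fin n) (Fin n) ℝ} (hG : G.PosDef) {T : Fin n → Fin n → ℝ}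
    (hT : T ≠ 0) : 0 < normSq₂ G T := by
  obtain ⟨B, hB, h⟩ := exists_frame hG
  rw [normSq₂_eq_of_frame h]
  by_contra hc
  have h0 := le_antisymm (not_lt.1 hc) (by positivity)
  refine hT (pull₂_eq_zero hB (funext fun a => funext fun b => ?_))
  rw [Finset.sum_eq_zero_iff_of_nonneg fun _ _ => by positivity] at h0
  have h1 := h0 a (Finset.mem_univ _)
  rw [Finset.sum_eq_zero_iff_of_nonneg fun _ _ => by positivity] at h1
  simpa using h1 b (Finset.mem_univ _)

lemma normSq₃_pos {G : Matrix (Fin n) (Fin n) ℝ} (hG : G.PosDef) {T : Fin n → Fin n → Fin n → ℝ}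
    (hT : T ≠ 0) : 0 < normSq₃ G T := by
  obtain ⟨B, hB, h⟩ := exists_frame hG
  rw [normSq₃_eq_of_frame h]
  by_contra hc
  have h0 := le_antisymm (not_lt.1 hc) (by positivity)
  refine hT (pull₃_eq_zero hB (funext fun a => funext fun b => funext fun c => ?_))
  rw [Finset.sum_eq_zero_iff_of_nonneg fun _ _ => by positivity] at h0
  have h1 := h0 a (Finset.mem_univ _)
  rw [Finset.sum_eq_zero_iff_of_nonneg fun _ _ => by positivity] at h1
  have h2 := h1 b (Finset.mem_univ _)
  rw [Finset.sum_eq_zero_iff_of_nonneg fun _ _ => by positivity] at h2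
  simpa using h2 c (Finset.mem_univ _)

/-- An orthonormal frame `B` for `G` induces the orthonormal frame `A⁻¹ B` for the congruent matrix
`Aᵀ G A`. -/
lemma inv_congruence_eq {G A B : Matrix (Fin n) (Fin n) ℝ} (h : G⁻¹ = B * B.transpose) :
    (A.transpose * G * A)⁻¹ = (A⁻¹ * B) * (A⁻¹ * B).transpose := by
  rw [Matrix.mul_inv_rev, Matrix.mul_inv_rev, h, Matrix.transpose_mul,
    ← Matrix.transpose_nonsing_inv]
  simp only [Matrix.mul_assoc]

lemma normSq₁_congruence {G A : Matrix (Fin n) (Fin n) ℝ} (hG : G.PosDef) (hA : IsUnit A)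
    (T : Fin n → ℝ) : normSq₁ (A.transpose * G * A) (pull₁ A T) = normSq₁ G T := by
  obtain ⟨B, -, h⟩ := exists_frame hG
  rw [normSq₁_eq_of_frame h, normSq₁_eq_of_frame (inv_congruence_eq h), pull₁_pull₁,
    Matrix.mul_nonsing_inv_cancel_left _ _ ((Matrix.isUnit_iff_isUnit_det A).1 hA)]

lemma normSq₂_congruence {G A : Matrix (Fin n) (Fin n) ℝ} (hG : G.PosDef) (hA : IsUnit A)
    (T : Fin n → Fin n → ℝ) : normSq₂ (A.transpose * G * A) (pull₂ A T) = normSq₂ G T := by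
  obtain ⟨B, -, h⟩ := exists_frame hG
  rw [normSq₂_eq_of_frame h, normSq₂_eq_of_frame (inv_congruence_eq h), pull₂_pull₂,
    Matrix.mul_nonsing_inv_cancel_left _ _ ((Matrix.isUnit_iff_isUnit_det A).1 hA)]

lemma normSq₃_congruence {G A : Matrix (Fin n) (Fin n) ℝ} (hG : G.PosDef) (hA : IsUnit A)
    (T : Fin n → Fin n → Fin n → ℝ) :
    normSq₃ (A.transpose * G * A) (pull₃ A T) = normSq₃ G T := by
  obtain ⟨B, -, h⟩ := exists_frame hG
  rw [normSq₃_eq_of_frame h, normSq₃_eq_of_frame (inv_congruence_eq h), pull₃_pull₃,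
    Matrix.mul_nonsing_inv_cancel_left _ _ ((Matrix.isUnit_iff_isUnit_det A).1 hA)]

end Frames

end

noncomputable section

/-! ### The quadratic current and its divergence at a point -/

section Current

open Matrix

variable {n : ℕ}

/-- The contraction `pᵢ = νᵃ f_ai` of a 2-form `f` with the vector dual to `ν`;
`H` is the inverse of the metric. -/
def contr (H : Matrix (Fin n) (Fin n) ℝ) (ν : Fin n → ℝ) (f : Matrix (Fin n) (Fin n) ℝ) :
    Fin n → ℝ :=
  fᵀ *ᵥ (H *ᵥ ν)

/-- The coefficient of the conormal direction in `current`. -/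
def currentScalar (H : Matrix (Fin n) (Fin n) ℝ) (ν : Fin n → ℝ)
    (x : Fin n → ℝ) (f : Matrix (Fin n) (Fin n) ℝ)
    (x' : Fin n → ℝ) (f' : Matrix (Fin n) (Fin n) ℝ) : ℝ :=
  -((ν ⬝ᵥ H *ᵥ ν) * ((x - contr H ν f) ⬝ᵥ H *ᵥ (x' - contr H ν f')))
    - ((n : ℝ) - 4) * (x ⬝ᵥ H *ᵥ ν) * (x' ⬝ᵥ H *ᵥ ν) - contr H ν f ⬝ᵥ H *ᵥ x'

/-- The current: a vector depending bilinearly on the pairs `(x, f)` and `(x', f')`, each consisting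
of a 1-form and a 2-form. It is chosen such that on the diagonal its component along `ν` is
nonpositive, whatever the pair, while its weighted divergence is coercive for pairs that satisfy
the equations of the hyperbolic model. It is kept bilinear because the derivative of the quadratic
current is then the sum of the two terms given by the product rule. -/
def current (H : Matrix (Fin n) (Fin n) ℝ) (ν : Fin n → ℝ)
    (x : Fin n → ℝ) (f : Matrix (Fin n) (Fin n) ℝ)
    (x' : Fin n → ℝ) (f' : Matrix (Fin n) (Fin n) ℝ) : Fin n → ℝ :=
  currentScalar H ν x f x' f' • (H *ᵥ ν)
    + (((n : ℝ) - 3) * (ν ⬝ᵥ H *ᵥ ν) * (x ⬝ᵥ H *ᵥ ν)) • (H *ᵥ x')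
    + (ν ⬝ᵥ H *ᵥ ν) • (H *ᵥ (f *ᵥ (H *ᵥ x')))

/-- The logarithmic derivatives `ρ ∂ₖ` of the rescaled 1-form, as the rows of a matrix, when the
1-form is Killing, up to the terms which are small near infinity. -/
def modelDerivForm (H h : Matrix (Fin n) (Fin n) ℝ) (ν x : Fin n → ℝ)
    (f : Matrix (Fin n) (Fin n) ℝ) : Matrix (Fin n) (Fin n) ℝ :=
  f - vecMulVec x ν + (x ⬝ᵥ H *ᵥ ν) • h

/-- The logarithmic derivative `ρ ∂ₖ` of the rescaled differential of a 1-form annihilated by `U`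
and `S`, up to the terms which are small near infinity. -/
def modelDerivTwoForm (H h : Matrix (Fin n) (Fin n) ℝ) (ν x : Fin n → ℝ)
    (f : Matrix (Fin n) (Fin n) ℝ) (k : Fin n) : Matrix (Fin n) (Fin n) ℝ :=
  Matrix.of fun i j => h i k * (x j + contr H ν f j) - h j k * (x i + contr H ν f i)
    - ν i * f k j + ν j * f k i

variable {H h f : Matrix (Fin n) (Fin n) ℝ} {ν x : Fin n → ℝ}

lemma dotProduct_mulVec_comm_of_symm (hH : Hᵀ = H) (u v : Fin n → ℝ) :
    u ⬝ᵥ H *ᵥ v = v ⬝ᵥ H *ᵥ u := by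
  rw [dotProduct_comm, ← vecMul_transpose, hH, dotProduct_mulVec]

lemma dotProduct_mulVec_self_of_antisymm (hf : fᵀ = -f) (u : Fin n → ℝ) :
    u ⬝ᵥ f *ᵥ u = 0 := by
  have h1 : u ⬝ᵥ f *ᵥ u = u ⬝ᵥ fᵀ *ᵥ u := by
    rw [mulVec_transpose, dotProduct_mulVec, dotProduct_comm]
  rw [hf, neg_mulVec, dotProduct_neg] at h1
  linarith

lemma trace_mul_antisymm (hH : Hᵀ = H) (hf : fᵀ = -f) : trace (H * f) = 0 := by
  have h1 : trace (H * f) = trace (H * f)ᵀ := (trace_transpose _).symm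
  rw [transpose_mul, hf, hH, neg_mul, trace_neg, trace_mul_comm f H] at h1
  linarith

lemma contr_dotProduct (v : Fin n → ℝ) :
    contr H ν f ⬝ᵥ v = (H *ᵥ ν) ⬝ᵥ f *ᵥ v := by
  rw [contr, mulVec_transpose, dotProduct_mulVec]

lemma mulVec_eq_neg_contr (hf : fᵀ = -f) : f *ᵥ (H *ᵥ ν) = -contr H ν f := by
  rw [contr, hf, neg_mulVec, neg_neg]

lemma contr_dotProduct_normal (hf : fᵀ = -f) : contr H ν f ⬝ᵥ H *ᵥ ν = 0 := by
  rw [contr_dotProduct, dotProduct_mulVec_self_of_antisymm hf]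

lemma sum_normal_modelDerivForm (hHh : H * h = 1) (hh : hᵀ = h) (hH : Hᵀ = H) :
    (modelDerivForm H h ν x f)ᵀ *ᵥ (H *ᵥ ν) = contr H ν f := by
  have h1 : h * H = 1 := mul_eq_one_comm.1 hHh
  simp only [modelDerivForm, transpose_add, transpose_sub, transpose_smul, hh, add_mulVec,
    sub_mulVec, smul_mulVec, transpose_vecMulVec, contr]
  rw [mulVec_mulVec _ h H, h1, one_mulVec, vecMulVec_mulVec, dotProduct_mulVec_comm_of_symm hH]
  ext i
  simp

lemma sum_form_modelDerivForm (hHh : H * h = 1) (hh : hᵀ = h) (hf : fᵀ = -f) :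
    (modelDerivForm H h ν x f)ᵀ *ᵥ (H *ᵥ x)
      = -(f *ᵥ (H *ᵥ x)) - (x ⬝ᵥ H *ᵥ x) • ν + (x ⬝ᵥ H *ᵥ ν) • x := by
  have h1 : h * H = 1 := mul_eq_one_comm.1 hHh
  simp only [modelDerivForm, transpose_add, transpose_sub, transpose_smul, hh, add_mulVec,
    sub_mulVec, smul_mulVec, hf, neg_mulVec, transpose_vecMulVec]
  rw [mulVec_mulVec _ h H, h1, one_mulVec, vecMulVec_mulVec]
  ext i
  simp

lemma sum_normal_modelDerivTwoForm (hHh : H * h = 1) :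
    ∑ k, (H *ᵥ ν) k • modelDerivTwoForm H h ν x f k = vecMulVec ν x - vecMulVec x ν := by
  have h1 : h * H = 1 := mul_eq_one_comm.1 hHh
  have h2 : ∀ i, ∑ k, (H *ᵥ ν) k * h i k = ν i := by
    intro i
    have : (h *ᵥ (H *ᵥ ν)) i = ν i := by rw [mulVec_mulVec, h1, one_mulVec]
    rw [← this, mulVec, dotProduct]
    exact Finset.sum_congr rfl fun k _ => mul_comm _ _
  have h3 : ∀ i, ∑ k, (H *ᵥ ν) k * f k i = contr H ν f i := by
    intro i
    rw [contr, mulVec, dotProduct]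
    exact Finset.sum_congr rfl fun k _ => by rw [transpose_apply, mul_comm]
  ext i j
  rw [Matrix.sum_apply]
  calc ∑ k, ((H *ᵥ ν) k • modelDerivTwoForm H h ν x f k) i j
      = ∑ k, ((H *ᵥ ν) k * h i k * (x j + contr H ν f j)
        - (H *ᵥ ν) k * h j k * (x i + contr H ν f i)
        - (H *ᵥ ν) k * f k j * ν i + (H *ᵥ ν) k * f k i * ν j) :=
        Finset.sum_congr rfl fun k _ => by simp [modelDerivTwoForm]; ring
    _ = ν i * x j - x i * ν j := by
        rw [Finset.sum_add_distrib, Finset.sum_sub_distrib, Finset.sum_sub_distrib,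
          ← Finset.sum_mul, ← Finset.sum_mul, ← Finset.sum_mul, ← Finset.sum_mul, h2, h2, h3, h3]
        ring
    _ = _ := by simp [vecMulVec_apply]

lemma sum_mulVec_row (M N : Matrix (Fin n) (Fin n) ℝ) :
    ∑ k, (M *ᵥ N k) k = trace (M * Nᵀ) := by
  simp [trace, mul_apply, mulVec, dotProduct]

lemma trace_modelDerivForm (hHh : H * h = 1) (hh : hᵀ = h) (hH : Hᵀ = H) (hf : fᵀ = -f) :
    trace (H * (modelDerivForm H h ν x f)ᵀ) = ((n : ℝ) - 1) * (x ⬝ᵥ H *ᵥ ν) := by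
  simp only [modelDerivForm, transpose_add, transpose_sub, transpose_smul, hh, Matrix.mul_add,
    Matrix.mul_sub, Matrix.mul_smul, hHh, trace_add, trace_sub, trace_smul, hf, Matrix.mul_neg, trace_neg,
    trace_mul_antisymm hH hf, transpose_vecMulVec, mul_vecMulVec, trace_vecMulVec, trace_one,
    Fintype.card_fin, smul_eq_mul]
  rw [dotProduct_comm (H *ᵥ ν)]
  ring

lemma trace_twoForm_modelDerivForm (hHh : H * h = 1) (hh : hᵀ = h) (hH : Hᵀ = H)
    (hf : fᵀ = -f) :
    trace (H * f * H * (modelDerivForm H h ν x f)ᵀ)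
      = trace (H * f * H * fᵀ) + contr H ν f ⬝ᵥ H *ᵥ x := by
  have h1 : trace (H * f * H * h) = 0 := by
    rw [Matrix.mul_assoc (H * f), hHh, mul_one, trace_mul_antisymm hH hf]
  simp only [modelDerivForm, transpose_add, transpose_sub, transpose_smul, hh, Matrix.mul_add,
    Matrix.mul_sub, Matrix.mul_smul, trace_add, trace_sub, trace_smul, h1,
    transpose_vecMulVec, mul_vecMulVec, trace_vecMulVec, smul_eq_mul, mul_zero, add_zero,
    ← mulVec_mulVec, mulVec_eq_neg_contr hf, mulVec_neg, neg_dotProduct, sub_neg_eq_add]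
  rw [dotProduct_comm, dotProduct_mulVec_comm_of_symm hH]

lemma sum_modelDerivTwoForm (hHh : H * h = 1) (hh : hᵀ = h) (hH : Hᵀ = H) (hf : fᵀ = -f)
    (v : Fin n → ℝ) :
    ∑ k, (H *ᵥ (modelDerivTwoForm H h ν x f k *ᵥ v)) k
      = ((n : ℝ) - 1) * (x ⬝ᵥ v) + ((n : ℝ) - 2) * (contr H ν f ⬝ᵥ v) := by
  have h1 : ∀ k, modelDerivTwoForm H h ν x f k *ᵥ v
      = (((x + contr H ν f) ⬝ᵥ v) • h - vecMulVec (h *ᵥ v) (x + contr H ν f)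
        - vecMulVec (f *ᵥ v) ν + (ν ⬝ᵥ v) • f) k := by
    intro k
    ext i
    simp only [mulVec, dotProduct, modelDerivTwoForm, of_apply, Matrix.add_apply,
      Matrix.sub_apply, Matrix.smul_apply, smul_eq_mul, vecMulVec_apply, Pi.add_apply,
      Finset.sum_mul]
    rw [← Finset.sum_sub_distrib, ← Finset.sum_sub_distrib, ← Finset.sum_add_distrib]
    refine Finset.sum_congr rfl fun j _ => ?_
    have : h k i = h i k := by conv_lhs => rw [← hh, transpose_apply]
    have h' : h k j = h j k := by conv_lhs => rw [← hh, transpose_apply]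
    rw [this, h']
    ring
  simp only [h1]
  rw [sum_mulVec_row]
  simp only [transpose_add, transpose_sub, transpose_smul, hh, Matrix.mul_add, Matrix.mul_sub,
    Matrix.mul_smul, hHh, trace_add, trace_sub, trace_smul, hf, Matrix.mul_neg, trace_neg,
    trace_mul_antisymm hH hf, transpose_vecMulVec, mul_vecMulVec, trace_vecMulVec, trace_one,
    Fintype.card_fin, smul_eq_mul]
  have h2 : (H *ᵥ (x + contr H ν f)) ⬝ᵥ h *ᵥ v = (x + contr H ν f) ⬝ᵥ v := by
    rw [dotProduct_comm, dotProduct_mulVec_comm_of_symm hH, mulVec_mulVec, hHh, one_mulVec]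
  rw [h2, ← contr_dotProduct, add_dotProduct]
  ring

/-- The conormal component of the current. If `f` is antisymmetric, then `p` is orthogonal to `ν`, so
that this is `-|ν|²` times the Gram determinant of `ν` and `x - p`. -/
lemma dotProduct_current (hH : Hᵀ = H) :
    ν ⬝ᵥ current H ν x f x f = -((ν ⬝ᵥ H *ᵥ ν)
      * ((ν ⬝ᵥ H *ᵥ ν) * ((x - contr H ν f) ⬝ᵥ H *ᵥ (x - contr H ν f))
        - (x ⬝ᵥ H *ᵥ ν) ^ 2)) := by
  have h1 : ν ⬝ᵥ H *ᵥ (f *ᵥ (H *ᵥ x)) = contr H ν f ⬝ᵥ H *ᵥ x := by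
    rw [contr_dotProduct, dotProduct_mulVec_comm_of_symm hH, dotProduct_comm]
  have h2 : ν ⬝ᵥ H *ᵥ x = x ⬝ᵥ H *ᵥ ν := dotProduct_mulVec_comm_of_symm hH _ _
  simp only [current, dotProduct_add, dotProduct_smul, smul_eq_mul, h1, h2, currentScalar]
  ring

lemma contr_vecMulVec_sub :
    contr H ν (vecMulVec ν x - vecMulVec x ν)
      = (ν ⬝ᵥ H *ᵥ ν) • x - (x ⬝ᵥ H *ᵥ ν) • ν := by
  simp only [contr, transpose_sub, transpose_vecMulVec, sub_mulVec, vecMulVec_mulVec]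
  ext i
  simp

lemma sum_smul_currentScalar_left (v : Fin n → ℝ) (D : Matrix (Fin n) (Fin n) ℝ)
    (D' : Fin n → Matrix (Fin n) (Fin n) ℝ) (x' : Fin n → ℝ) (f' : Matrix (Fin n) (Fin n) ℝ) :
    ∑ k, currentScalar H ν (D k) (D' k) x' f' * v k
      = currentScalar H ν (Dᵀ *ᵥ v) (∑ k, v k • D' k) x' f' := by
  have h1 : ∀ w : Fin n → ℝ, (Dᵀ *ᵥ v) ⬝ᵥ w = ∑ k, (D k ⬝ᵥ w) * v k := by
    intro w
    rw [dotProduct_comm, mulVec_transpose, dotProduct_comm, ← dotProduct_mulVec, dotProduct]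
    exact Finset.sum_congr rfl fun k _ => mul_comm _ _
  have h2 : ∀ w : Fin n → ℝ, contr H ν (∑ k, v k • D' k) ⬝ᵥ w
      = ∑ k, (contr H ν (D' k) ⬝ᵥ w) * v k := by
    intro w
    simp only [contr, mulVec_transpose, ← dotProduct_mulVec]
    rw [sum_mulVec, dotProduct_sum]
    exact Finset.sum_congr rfl fun k _ => by rw [smul_mulVec, dotProduct_smul, smul_eq_mul, mul_comm]
  simp only [currentScalar, sub_dotProduct, h1, h2]
  simp only [sub_mul, mul_sub, Finset.sum_sub_distrib, Finset.mul_sum, Finset.sum_mul, neg_sub]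
  congr 1
  congr 1
  · congr 1 <;> exact Finset.sum_congr rfl fun k _ => by ring
  · congr 1 <;> exact Finset.sum_congr rfl fun k _ => by ring

lemma sum_smul_currentScalar_right (v : Fin n → ℝ) (D : Matrix (Fin n) (Fin n) ℝ)
    (D' : Fin n → Matrix (Fin n) (Fin n) ℝ) :
    ∑ k, currentScalar H ν x f (D k) (D' k) * v k
      = currentScalar H ν x f (Dᵀ *ᵥ v) (∑ k, v k • D' k) := by
  have h1 : ∀ w : Fin n → ℝ, w ⬝ᵥ (Dᵀ *ᵥ v) = ∑ k, (w ⬝ᵥ D k) * v k := by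
    intro w
    rw [mulVec_transpose, dotProduct_comm, ← dotProduct_mulVec, dotProduct]
    exact Finset.sum_congr rfl fun k _ => by rw [mul_comm, mulVec, dotProduct_comm]
  have h2 : ∀ w : Fin n → ℝ, w ⬝ᵥ contr H ν (∑ k, v k • D' k)
      = ∑ k, (w ⬝ᵥ contr H ν (D' k)) * v k := by
    intro w
    simp only [contr, transpose_sum, transpose_smul]
    rw [sum_mulVec, dotProduct_sum]
    exact Finset.sum_congr rfl fun k _ => by rw [smul_mulVec, dotProduct_smul, smul_eq_mul, mul_comm]
  simp only [currentScalar, dotProduct_mulVec _ H, dotProduct_sub, h1, h2,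
    dotProduct_comm (_ ᵥ* _) ν]
  have h3 : (Dᵀ *ᵥ v) ᵥ* H ⬝ᵥ ν = ∑ k, (D k ᵥ* H ⬝ᵥ ν) * v k := by
    rw [← dotProduct_mulVec, dotProduct_comm, h1]
    exact Finset.sum_congr rfl fun k _ => by rw [← dotProduct_mulVec, dotProduct_comm]
  rw [dotProduct_comm] at h3
  simp only [sub_mul, mul_sub, Finset.sum_sub_distrib, Finset.mul_sum, neg_sub, h3,
    dotProduct_comm (_ ᵥ* _) ν]
  congr 1
  congr 1
  · congr 1 <;> exact Finset.sum_congr rfl fun k _ => by ring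
  · congr 1 <;> exact Finset.sum_congr rfl fun k _ => by ring

/-- The divergence of the current in the hyperbolic model, without the contribution of the weight. -/
lemma sum_current_model (hHh : H * h = 1) (hh : hᵀ = h) (hH : Hᵀ = H) (hf : fᵀ = -f)
    {lam t T m P Φ : ℝ} (hlam : ν ⬝ᵥ H *ᵥ ν = lam) (ht : x ⬝ᵥ H *ᵥ ν = t) (hT : x ⬝ᵥ H *ᵥ x = T)
    (hm : contr H ν f ⬝ᵥ H *ᵥ x = m) (hP : contr H ν f ⬝ᵥ H *ᵥ contr H ν f = P)
    (hΦ : trace (H * f * H * fᵀ) = Φ) :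
    ∑ k, (current H ν (modelDerivForm H h ν x f k) (modelDerivTwoForm H h ν x f k) x f k
      + current H ν x f (modelDerivForm H h ν x f k) (modelDerivTwoForm H h ν x f k) k)
    = -lam * (2 * m - 2 * (P + lam * T - t ^ 2) + 2 * lam * m) - (P + lam * T - t ^ 2)
      + ((n : ℝ) - 3) * lam * (-m - lam * T + t ^ 2 + ((n : ℝ) - 1) * t ^ 2)
      + lam * (((n : ℝ) - 1) * (T + m) + Φ) := by
  set D := modelDerivForm H h ν x f with hD
  set D' := modelDerivTwoForm H h ν x f with hD'
  set p := contr H ν f with hp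
  have e1 : ∑ k, currentScalar H ν (D k) (D' k) x f * (H *ᵥ ν) k
      = currentScalar H ν p (vecMulVec ν x - vecMulVec x ν) x f := by
    rw [sum_smul_currentScalar_left, sum_normal_modelDerivForm hHh hh hH,
      sum_normal_modelDerivTwoForm hHh]
  have e2 : ∑ k, currentScalar H ν x f (D k) (D' k) * (H *ᵥ ν) k
      = currentScalar H ν x f p (vecMulVec ν x - vecMulVec x ν) := by
    rw [sum_smul_currentScalar_right, sum_normal_modelDerivForm hHh hh hH,
      sum_normal_modelDerivTwoForm hHh]
  have hxp : x ⬝ᵥ H *ᵥ p = m := by rw [dotProduct_mulVec_comm_of_symm hH, hm]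
  have hνx : ν ⬝ᵥ H *ᵥ x = t := by rw [dotProduct_mulVec_comm_of_symm hH, ht]
  have hpν : p ⬝ᵥ H *ᵥ ν = 0 := contr_dotProduct_normal hf
  have hνp : ν ⬝ᵥ H *ᵥ p = 0 := by rw [dotProduct_mulVec_comm_of_symm hH, hpν]
  have e1' : currentScalar H ν p (vecMulVec ν x - vecMulVec x ν) x f
      = -lam * (m - P - lam * T + lam * m + t ^ 2) - (lam * T - t ^ 2) := by
    simp only [currentScalar, contr_vecMulVec_sub, ← hp, hlam, ht, mulVec_sub,
      sub_dotProduct, dotProduct_sub, smul_dotProduct, smul_eq_mul, hm, hP, hT,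
      hxp, hνx, hpν, hνp]
    ring
  have e2' : currentScalar H ν x f p (vecMulVec ν x - vecMulVec x ν)
      = -lam * (m - P - lam * T + lam * m + t ^ 2) - P := by
    simp only [currentScalar, contr_vecMulVec_sub, ← hp, hlam, ht, mulVec_sub, mulVec_smul,
      sub_dotProduct, dotProduct_sub, dotProduct_smul, smul_eq_mul, hm, hP, hT, hxp, hpν]
    ring
  have e3 : ∑ k, (D k ⬝ᵥ H *ᵥ ν) * (H *ᵥ x) k = -m - lam * T + t ^ 2 := by
    have : ∑ k, (D k ⬝ᵥ H *ᵥ ν) * (H *ᵥ x) k = (Dᵀ *ᵥ (H *ᵥ x)) ⬝ᵥ (H *ᵥ ν) := by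
      rw [dotProduct_comm, mulVec_transpose, dotProduct_comm, ← dotProduct_mulVec, dotProduct]
      exact Finset.sum_congr rfl fun k _ => mul_comm _ _
    rw [this, sum_form_modelDerivForm hHh hh hf, add_dotProduct, sub_dotProduct, neg_dotProduct,
      smul_dotProduct, smul_dotProduct, hlam, ht, hT, dotProduct_comm,
      ← contr_dotProduct, ← hp, hm]
    simp only [smul_eq_mul]
    ring
  have e4 : ∑ k, (H *ᵥ D k) k = ((n : ℝ) - 1) * t := by
    rw [sum_mulVec_row, trace_modelDerivForm hHh hh hH hf, ht]
  have e5 : ∑ k, (H *ᵥ (D' k *ᵥ (H *ᵥ x))) k = ((n : ℝ) - 1) * T + ((n : ℝ) - 2) * m := by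
    rw [sum_modelDerivTwoForm hHh hh hH hf, ← hp, hT, hm]
  have e6 : ∑ k, (H *ᵥ (f *ᵥ (H *ᵥ D k))) k = Φ + m := by
    simp only [mulVec_mulVec]
    rw [sum_mulVec_row, ← Matrix.mul_assoc, trace_twoForm_modelDerivForm hHh hh hH hf, hΦ, ← hp, hm]
  have e7 : ∀ k, (current H ν (D k) (D' k) x f k + current H ν x f (D k) (D' k) k)
      = currentScalar H ν (D k) (D' k) x f * (H *ᵥ ν) k
        + currentScalar H ν x f (D k) (D' k) * (H *ᵥ ν) k
        + ((n : ℝ) - 3) * lam * ((D k ⬝ᵥ H *ᵥ ν) * (H *ᵥ x) k)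
        + ((n : ℝ) - 3) * lam * t * (H *ᵥ D k) k
        + lam * (H *ᵥ (D' k *ᵥ (H *ᵥ x))) k + lam * (H *ᵥ (f *ᵥ (H *ᵥ D k))) k := by
    intro k
    simp only [current, Pi.add_apply, Pi.smul_apply, smul_eq_mul, hlam, ht]
    ring
  simp only [e7, Finset.sum_add_distrib, ← Finset.mul_sum]
  rw [e1, e2, e1', e2', e3, e4, e5, e6]
  ring

end Current

end

noncomputable section

/-! ### Coercivity in the hyperbolic model -/

section Coercivity

open Matrix

variable {n : ℕ} {H h f B : Matrix (Fin n) (Fin n) ℝ} {ν x : Fin n → ℝ}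

lemma dotProduct_mulVec_of_frame (hB : H = B * Bᵀ) (u v : Fin n → ℝ) :
    u ⬝ᵥ H *ᵥ v = (Bᵀ *ᵥ u) ⬝ᵥ (Bᵀ *ᵥ v) := by
  rw [hB, ← mulVec_mulVec, dotProduct_mulVec, mulVec_transpose B u]

lemma dotProduct_mulVec_self_nonneg (hB : H = B * Bᵀ) (u : Fin n → ℝ) : 0 ≤ u ⬝ᵥ H *ᵥ u := by
  rw [dotProduct_mulVec_of_frame hB]
  exact Finset.sum_nonneg fun i _ => mul_self_nonneg _

lemma dotProduct_mulVec_sq_le (hB : H = B * Bᵀ) (u v : Fin n → ℝ) :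
    (u ⬝ᵥ H *ᵥ v) ^ 2 ≤ (v ⬝ᵥ H *ᵥ v) * (u ⬝ᵥ H *ᵥ u) := by
  rw [mul_comm, dotProduct_mulVec_of_frame hB, dotProduct_mulVec_of_frame hB,
    dotProduct_mulVec_of_frame hB]
  have := Finset.sum_mul_sq_le_sq_mul_sq Finset.univ (Bᵀ *ᵥ u) (Bᵀ *ᵥ v)
  simpa only [dotProduct, sq] using this

lemma trace_mul_transpose_nonneg (hB : H = B * Bᵀ) (k : Matrix (Fin n) (Fin n) ℝ) :
    0 ≤ trace (H * k * H * kᵀ) := by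
  have h1 : trace (H * k * H * kᵀ) = trace ((Bᵀ * k * B) * (Bᵀ * k * B)ᵀ) := by
    rw [hB, Matrix.mul_assoc, Matrix.mul_assoc, Matrix.mul_assoc, trace_mul_comm]
    simp only [transpose_mul, transpose_transpose, Matrix.mul_assoc]
  rw [h1]
  generalize Bᵀ * k * B = M
  simp only [trace, diag_apply, mul_apply, transpose_apply]
  exact Finset.sum_nonneg fun i _ => Finset.sum_nonneg fun j _ => mul_self_nonneg _

/-- A 2-form is at least as long as its part `ν ∧ p`; for `|ν| = 1` this reads `2 |p|² ≤ |f|²`. -/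
lemma two_form_norm_bound (hB : H = B * Bᵀ) (hH : Hᵀ = H) (hf : fᵀ = -f) :
    (4 - 2 * (ν ⬝ᵥ H *ᵥ ν)) * (contr H ν f ⬝ᵥ H *ᵥ contr H ν f) ≤ trace (H * f * H * fᵀ) := by
  set p := contr H ν f with hp
  have hpν : p ⬝ᵥ H *ᵥ ν = 0 := contr_dotProduct_normal hf
  have hνp : ν ⬝ᵥ H *ᵥ p = 0 := by rw [dotProduct_mulVec_comm_of_symm hH, hpν]
  have hfν : f *ᵥ (H *ᵥ ν) = -p := mulVec_eq_neg_contr hf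
  have hfp : ν ⬝ᵥ H *ᵥ (f *ᵥ (H *ᵥ p)) = p ⬝ᵥ H *ᵥ p := by
    rw [contr_dotProduct, dotProduct_mulVec_comm_of_symm hH, dotProduct_comm]
  have key := trace_mul_transpose_nonneg hB (f - (vecMulVec ν p - vecMulVec p ν))
  have e1 : trace (H * f * H * (vecMulVec ν p - vecMulVec p ν)ᵀ) = 2 * (p ⬝ᵥ H *ᵥ p) := by
    simp only [transpose_sub, transpose_vecMulVec, Matrix.mul_sub, trace_sub, mul_vecMulVec,
      trace_vecMulVec, ← mulVec_mulVec, hfν, mulVec_neg, neg_dotProduct]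
    rw [dotProduct_comm _ ν, hfp, dotProduct_comm]
    ring
  have e2 : trace (H * (vecMulVec ν p - vecMulVec p ν) * H * fᵀ) = 2 * (p ⬝ᵥ H *ᵥ p) := by
    rw [← e1, ← trace_transpose]
    simp only [transpose_mul, transpose_transpose, hH]
    rw [Matrix.mul_assoc H f, Matrix.mul_assoc H, trace_mul_comm H]
    simp only [Matrix.mul_assoc]
  have e3 : trace (H * (vecMulVec ν p - vecMulVec p ν) * H * (vecMulVec ν p - vecMulVec p ν)ᵀ)
      = 2 * (ν ⬝ᵥ H *ᵥ ν) * (p ⬝ᵥ H *ᵥ p) := by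
    simp only [transpose_sub, transpose_vecMulVec, Matrix.mul_sub, Matrix.sub_mul, trace_sub,
      mul_vecMulVec, vecMulVec_mul, vecMulVec_mulVec, trace_vecMulVec,
      sub_mulVec, ← dotProduct_mulVec]
    simp only [op_smul_eq_smul, sub_dotProduct, smul_dotProduct, dotProduct_comm (H *ᵥ _) _, hpν,
      hνp, smul_eq_mul]
    ring
  have e4 : trace (H * (f - (vecMulVec ν p - vecMulVec p ν)) * H
      * (f - (vecMulVec ν p - vecMulVec p ν))ᵀ)
      = trace (H * f * H * fᵀ) - trace (H * (vecMulVec ν p - vecMulVec p ν) * H * fᵀ)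
        - trace (H * f * H * (vecMulVec ν p - vecMulVec p ν)ᵀ)
        + trace (H * (vecMulVec ν p - vecMulVec p ν) * H * (vecMulVec ν p - vecMulVec p ν)ᵀ) := by
    generalize vecMulVec ν p - vecMulVec p ν = W
    simp only [transpose_sub, Matrix.mul_sub, Matrix.sub_mul, trace_sub]
    ring
  rw [e4, e1, e2, e3] at key
  linarith

lemma normSq₂_eq_trace {G : Matrix (Fin n) (Fin n) ℝ} (hG : (G⁻¹)ᵀ = G⁻¹)
    (k : Matrix (Fin n) (Fin n) ℝ) : normSq₂ G k = trace (G⁻¹ * k * G⁻¹ * kᵀ) := by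
  have h1 : ∀ j j', G⁻¹ j j' = G⁻¹ j' j := fun j j' => by conv_lhs => rw [← hG, transpose_apply]
  simp only [normSq₂, trace, diag_apply, mul_apply, transpose_apply, Finset.sum_mul]
  refine Finset.sum_congr rfl fun i _ => ?_
  rw [Finset.sum_comm]
  refine Finset.sum_congr rfl fun j _ => ?_
  rw [Finset.sum_comm]
  refine Finset.sum_congr rfl fun j' _ => Finset.sum_congr rfl fun i' _ => ?_
  rw [h1 j j']
  ring

/-- The quadratic form obtained in the divergence of the weighted current is coercive:
for `|dρ| = 1` it equals `(n + 1 - 2 s) |x_T - p|² + |x_T + p|² + (n - 1) (n - 2) x_ν² + |f_T|²`,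
where the subscript `T` denotes tangential parts. -/
lemma coercive_scalar {s N : ℝ} (hs : s < 2) (hN : 3 ≤ N) :
    ∃ c η : ℝ, 0 < c ∧ 0 < η ∧ ∀ lam t T m P Φ : ℝ, |lam - 1| ≤ η → 0 ≤ P → t ^ 2 ≤ lam * T →
      0 ≤ lam * (T - 2 * m + P) - t ^ 2 → 0 ≤ lam * (T + 2 * m + P) - t ^ 2 →
      (4 - 2 * lam) * P ≤ Φ →
      c * (T + Φ) ≤ -lam * (2 * m - 2 * (P + lam * T - t ^ 2) + 2 * lam * m)
        - (P + lam * T - t ^ 2) + (N - 3) * lam * (-m - lam * T + t ^ 2 + (N - 1) * t ^ 2)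
        + lam * ((N - 1) * (T + m) + Φ)
        + (N - 1 - 2 * s) * (lam * (lam * (T - 2 * m + P) - t ^ 2)) := by
  set κ : ℝ := min ((N + 1 - 2 * s) / 2) 1 with hκ
  have hκ0 : 0 < κ := lt_min (by linarith) one_pos
  have hκ1 : κ ≤ 1 := min_le_right _ _
  have hκ2 : κ ≤ (N + 1 - 2 * s) / 2 := min_le_left _ _
  set C : ℝ := 8 + 4 * N ^ 2 with hC
  have hC0 : 0 < C := by positivity
  refine ⟨κ / 4, min (1 / 2) (κ / (4 * (C + 2))), by positivity,
    lt_min (by norm_num) (by positivity), ?_⟩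
  intro lam t T m P Φ hl hP ht hq hq' hΦ
  set η := |lam - 1| with hη
  have hη0 : 0 ≤ η := abs_nonneg _
  have hη1 : η ≤ 1 / 2 := hl.trans (min_le_left _ _)
  have hη2 : η * (C + 2) ≤ κ / 4 := by
    have := hl.trans (min_le_right _ _)
    rw [le_div_iff₀ (by positivity)] at this
    linarith
  obtain ⟨hl1, hl2⟩ := abs_le.1 (hη.symm.le.trans hη1)
  have hlam : 1 / 2 ≤ lam := by linarith
  have hlam' : lam ≤ 3 / 2 := by linarith
  have hT : 0 ≤ T := by
    have : 0 ≤ lam * T := (sq_nonneg t).trans ht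
    exact nonneg_of_mul_nonneg_right this (by linarith)
  have hPΦ : P ≤ Φ := by nlinarith
  have hΦ0 : 0 ≤ Φ := hP.trans hPΦ
  have hm : |2 * m| ≤ T + P := by
    have h1 : 0 ≤ lam * (T - 2 * m + P) := by nlinarith [sq_nonneg t]
    have h2 : 0 ≤ lam * (T + 2 * m + P) := by nlinarith [sq_nonneg t]
    have h3 := nonneg_of_mul_nonneg_right h1 (by linarith : 0 < lam)
    have h4 := nonneg_of_mul_nonneg_right h2 (by linarith : 0 < lam)
    rw [abs_le]
    constructor <;> linarith
  have ht2 : t ^ 2 ≤ 3 / 2 * T := ht.trans (by nlinarith)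
  set E := 2 * lam * m - (2 * lam + 1) * P - (N - 3) * lam * T + N * (N - 3) * t ^ 2 + Φ with hE
  -- the terms that vanish for `lam = 1`
  have hEbound : |E| ≤ C * (T + Φ) := by
    have a1 : |2 * lam * m| ≤ 3 / 2 * (T + Φ) := by
      have : 2 * lam * m = lam * (2 * m) := by ring
      rw [this, abs_mul, abs_of_pos (by linarith : 0 < lam)]
      have := abs_nonneg (2 * m)
      nlinarith
    have a2 : 0 ≤ (2 * lam + 1) * P := by positivity
    have a3 : (2 * lam + 1) * P ≤ 4 * Φ := by nlinarith
    have a4 : 0 ≤ (N - 3) * lam * T := by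
      have : 0 ≤ N - 3 := by linarith
      positivity
    have a5 : (N - 3) * lam * T ≤ N ^ 2 * T := by
      apply mul_le_mul_of_nonneg_right _ hT
      nlinarith
    have a6 : 0 ≤ N * (N - 3) * t ^ 2 := by
      have : 0 ≤ N - 3 := by linarith
      positivity
    have a7 : N * (N - 3) * t ^ 2 ≤ N ^ 2 * (3 / 2 * T) := by
      apply mul_le_mul _ ht2 (sq_nonneg _) (sq_nonneg _)
      nlinarith
    have a8 : 0 ≤ N ^ 2 * T := by positivity
    have a9 : 0 ≤ N ^ 2 * Φ := by positivity
    obtain ⟨b1, b2⟩ := abs_le.1 a1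
    have hexp : C * (T + Φ) = 8 * T + 8 * Φ + 4 * (N ^ 2 * T) + 4 * (N ^ 2 * Φ) := by
      rw [hC]
      ring
    rw [abs_le, hexp, hE]
    constructor <;> linarith
  have hR : -(η * C * (T + Φ)) ≤ (lam - 1) * E := by
    have h1 : |(lam - 1) * E| ≤ η * (C * (T + Φ)) := by
      rw [abs_mul]
      exact mul_le_mul_of_nonneg_left hEbound hη0
    have := (abs_le.1 h1).1
    linarith
  have hmain : κ * (T + P) + (Φ - 2 * P) ≤ (N + 1 - 2 * s) * (lam * (lam * (T - 2 * m + P) - t ^ 2))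
      + (lam * (T + 2 * m + P) - t ^ 2) + (N - 1) * (N - 2) * t ^ 2 + (Φ - 2 * P) := by
    have c1 : κ * (lam * (T - 2 * m + P) - t ^ 2)
        ≤ (N + 1 - 2 * s) * (lam * (lam * (T - 2 * m + P) - t ^ 2)) := by
      rw [← mul_assoc]
      refine mul_le_mul_of_nonneg_right (hκ2.trans ?_) hq
      have := mul_le_mul_of_nonneg_left hlam (by linarith : 0 ≤ N + 1 - 2 * s)
      linarith
    have c2 : κ * (lam * (T + 2 * m + P) - t ^ 2) ≤ lam * (T + 2 * m + P) - t ^ 2 :=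
      mul_le_of_le_one_left hq' hκ1
    have c3 : 2 * κ * t ^ 2 ≤ (N - 1) * (N - 2) * t ^ 2 := by
      apply mul_le_mul_of_nonneg_right _ (sq_nonneg _)
      have : (N - 1) * (N - 2) = (N - 3) ^ 2 + 3 * (N - 3) + 2 := by ring
      have := sq_nonneg (N - 3)
      linarith
    have c4 : κ * (T + P) ≤ κ * (2 * lam * (T + P)) := by
      apply mul_le_mul_of_nonneg_left _ hκ0.le
      exact le_mul_of_one_le_left (by linarith) (by linarith)
    linarith
  have hΦP : κ / 2 * Φ - 2 * η * Φ ≤ κ * P + (Φ - 2 * P) := by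
    have d1 : -(2 * η * Φ) ≤ Φ - 2 * P := by
      have : lam - 1 ≤ η := le_abs_self _
      have h1 : (lam - 1) * P ≤ η * P := mul_le_mul_of_nonneg_right this hP
      have h2 : η * P ≤ η * Φ := mul_le_mul_of_nonneg_left hPΦ hη0
      linarith
    have d2 : 0 ≤ κ * (η * Φ) := by positivity
    have d3 := mul_le_mul_of_nonneg_left d1 (by linarith : 0 ≤ 1 - κ / 2)
    linarith
  have hid : -lam * (2 * m - 2 * (P + lam * T - t ^ 2) + 2 * lam * m)
        - (P + lam * T - t ^ 2) + (N - 3) * lam * (-m - lam * T + t ^ 2 + (N - 1) * t ^ 2)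
        + lam * ((N - 1) * (T + m) + Φ)
        + (N - 1 - 2 * s) * (lam * (lam * (T - 2 * m + P) - t ^ 2))
      = (N + 1 - 2 * s) * (lam * (lam * (T - 2 * m + P) - t ^ 2))
      + (lam * (T + 2 * m + P) - t ^ 2) + (N - 1) * (N - 2) * t ^ 2 + (Φ - 2 * P)
      + (lam - 1) * E := by
    rw [hE]
    ring
  rw [hid]
  have f1 : η * (C + 2) * (T + Φ) ≤ κ / 4 * (T + Φ) :=
    mul_le_mul_of_nonneg_right hη2 (by linarith)
  have f2 : 0 ≤ κ * T := by positivity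
  have f3 : 0 ≤ η * T := by positivity
  linarith

/-- Coercivity of the divergence of the weighted current in the hyperbolic model, when the length
of the conormal `ν` is close to one. -/
lemma exists_model_coercive {s : ℝ} (hs : s < 2) (hn : 3 ≤ n) :
    ∃ c η : ℝ, 0 < c ∧ 0 < η ∧ ∀ (H h B : Matrix (Fin n) (Fin n) ℝ) (ν x : Fin n → ℝ)
      (f : Matrix (Fin n) (Fin n) ℝ), H * h = 1 → hᵀ = h → H = B * Bᵀ → fᵀ = -f →
      |ν ⬝ᵥ H *ᵥ ν - 1| ≤ η →
      c * (x ⬝ᵥ H *ᵥ x + trace (H * f * H * fᵀ)) ≤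
        ∑ k, (current H ν (modelDerivForm H h ν x f k) (modelDerivTwoForm H h ν x f k) x f k
          + current H ν x f (modelDerivForm H h ν x f k) (modelDerivTwoForm H h ν x f k) k)
        + (1 + 2 * s - n) * (ν ⬝ᵥ current H ν x f x f) := by
  obtain ⟨c, η, hc, hη, hcoer⟩ := coercive_scalar (N := n) hs (by exact_mod_cast hn)
  refine ⟨c, η, hc, hη, ?_⟩
  intro H h B ν x f hHh hh hB hf hlam
  have hH : Hᵀ = H := by rw [hB, transpose_mul, transpose_transpose]
  rw [sum_current_model hHh hh hH hf rfl rfl rfl rfl rfl rfl, dotProduct_current hH]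
  have hpν : contr H ν f ⬝ᵥ H *ᵥ ν = 0 := contr_dotProduct_normal hf
  have hxp : x ⬝ᵥ H *ᵥ contr H ν f = contr H ν f ⬝ᵥ H *ᵥ x := dotProduct_mulVec_comm_of_symm hH _ _
  have h1 : (x - contr H ν f) ⬝ᵥ H *ᵥ (x - contr H ν f)
      = x ⬝ᵥ H *ᵥ x - 2 * (contr H ν f ⬝ᵥ H *ᵥ x) + contr H ν f ⬝ᵥ H *ᵥ contr H ν f := by
    simp only [mulVec_sub, dotProduct_sub, sub_dotProduct, hxp]
    ring
  have h2 : (x + contr H ν f) ⬝ᵥ H *ᵥ (x + contr H ν f)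
      = x ⬝ᵥ H *ᵥ x + 2 * (contr H ν f ⬝ᵥ H *ᵥ x) + contr H ν f ⬝ᵥ H *ᵥ contr H ν f := by
    simp only [mulVec_add, dotProduct_add, add_dotProduct, hxp]
    ring
  have cs1 := dotProduct_mulVec_sq_le hB (x - contr H ν f) ν
  have cs2 := dotProduct_mulVec_sq_le hB (x + contr H ν f) ν
  rw [h1, sub_dotProduct, hpν, sub_zero] at cs1
  rw [h2, add_dotProduct, hpν, add_zero] at cs2
  have key := hcoer (ν ⬝ᵥ H *ᵥ ν) (x ⬝ᵥ H *ᵥ ν) (x ⬝ᵥ H *ᵥ x) (contr H ν f ⬝ᵥ H *ᵥ x)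
    (contr H ν f ⬝ᵥ H *ᵥ contr H ν f) (trace (H * f * H * fᵀ)) hlam
    (dotProduct_mulVec_self_nonneg hB _) (dotProduct_mulVec_sq_le hB x ν) (by linarith)
    (by linarith) (two_form_norm_bound hB hH hf)
  rw [h1]
  linarith

/-- The conormal component of the current is nonpositive. -/
lemma dotProduct_current_nonpos (hB : H = B * Bᵀ) (hf : fᵀ = -f) :
    ν ⬝ᵥ current H ν x f x f ≤ 0 := by
  have hH : Hᵀ = H := by rw [hB, transpose_mul, transpose_transpose]
  have hpν : contr H ν f ⬝ᵥ H *ᵥ ν = 0 := contr_dotProduct_normal hf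
  have cs1 := dotProduct_mulVec_sq_le hB (x - contr H ν f) ν
  rw [sub_dotProduct, hpν, sub_zero] at cs1
  rw [dotProduct_current hH, neg_nonpos]
  exact mul_nonneg (dotProduct_mulVec_self_nonneg hB _) (by linarith)

end Coercivity

end

noncomputable section

/-! ### Calculus in the half space -/

section PartialDeriv

variable {n : ℕ} [NeZero n]

/-- The open half space, in which partial derivatives are ordinary ones. -/
abbrev openHalf (n : ℕ) [NeZero n] : Set (EuclideanSpace ℝ (Fin n)) := interior (range (𝓡∂ n))

lemma openHalf_mem_nhds {y : EuclideanSpace ℝ (Fin n)} (hy : y ∈ openHalf n) :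
    range (𝓡∂ n) ∈ nhds y := mem_interior_iff_mem_nhds.1 hy

lemma partialDeriv_eq_fderiv {y : EuclideanSpace ℝ (Fin n)} (hy : y ∈ openHalf n) (k : Fin n)
    (f : EuclideanSpace ℝ (Fin n) → ℝ) :
    partialDeriv k f y = fderiv ℝ f y (EuclideanSpace.single k (1 : ℝ)) := by
  rw [partialDeriv, fderivWithin_of_mem_nhds (openHalf_mem_nhds hy)]

lemma partialDeriv_congr {y : EuclideanSpace ℝ (Fin n)} {f f' : EuclideanSpace ℝ (Fin n) → ℝ}
    (k : Fin n) (h : f =ᶠ[nhds y] f') : partialDeriv k f y = partialDeriv k f' y := by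
  rw [partialDeriv, partialDeriv,
    Filter.EventuallyEq.fderivWithin_eq (h.filter_mono nhdsWithin_le_nhds) h.self_of_nhds]

variable {y : EuclideanSpace ℝ (Fin n)} (hy : y ∈ openHalf n)
  {f f' : EuclideanSpace ℝ (Fin n) → ℝ}

include hy

lemma partialDeriv_sub (k : Fin n) (hf : DifferentiableAt ℝ f y) (hf' : DifferentiableAt ℝ f' y) :
    partialDeriv k (fun z => f z - f' z) y = partialDeriv k f y - partialDeriv k f' y := by
  simp only [partialDeriv_eq_fderiv hy]
  rw [fderiv_fun_sub hf hf']
  rfl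

lemma partialDeriv_mul (k : Fin n) (hf : DifferentiableAt ℝ f y) (hf' : DifferentiableAt ℝ f' y) :
    partialDeriv k (fun z => f z * f' z) y = partialDeriv k f y * f' y + f y * partialDeriv k f' y := by
  simp only [partialDeriv_eq_fderiv hy]
  rw [fderiv_fun_mul hf hf']
  simp
  ring

lemma partialDeriv_const_mul (k : Fin n) (c : ℝ) (hf : DifferentiableAt ℝ f y) :
    partialDeriv k (fun z => c * f z) y = c * partialDeriv k f y := by
  simp only [partialDeriv_eq_fderiv hy]
  rw [fderiv_const_mul hf]
  rfl

lemma partialDeriv_sum {ι : Type*} (s : Finset ι) (k : Fin n)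
    {F : ι → EuclideanSpace ℝ (Fin n) → ℝ} (hF : ∀ i ∈ s, DifferentiableAt ℝ (F i) y) :
    partialDeriv k (fun z => ∑ i ∈ s, F i z) y = ∑ i ∈ s, partialDeriv k (F i) y := by
  simp only [partialDeriv_eq_fderiv hy]
  rw [fderiv_fun_sum hF]
  simp

lemma contDiffAt_partialDeriv (k : Fin n) (hf : ContDiffAt ℝ ∞ f y) :
    ContDiffAt ℝ ∞ (fun z => partialDeriv k f z) y := by
  have h1 : (fun z => partialDeriv k f z) =ᶠ[nhds y]
      fun z => fderiv ℝ f z (EuclideanSpace.single k (1 : ℝ)) := by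
    filter_upwards [isOpen_interior.mem_nhds hy] with z hz
    exact partialDeriv_eq_fderiv hz k f
  refine ContDiffAt.congr_of_eventuallyEq ?_ h1
  exact (hf.fderiv_right (m := ∞) (by simp)).clm_apply contDiffAt_const

lemma partialDeriv_comm (k i : Fin n) (hf : ContDiffAt ℝ ∞ f y) :
    partialDeriv k (fun z => partialDeriv i f z) y = partialDeriv i (fun z => partialDeriv k f z) y := by
  have h1 : ∀ i : Fin n, (fun z => partialDeriv i f z) =ᶠ[nhds y]
      fun z => fderiv ℝ f z (EuclideanSpace.single i (1 : ℝ)) := by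
    intro i
    filter_upwards [isOpen_interior.mem_nhds hy] with z hz
    exact partialDeriv_eq_fderiv hz i f
  have hd : DifferentiableAt ℝ (fderiv ℝ f) y :=
    (hf.fderiv_right (m := ∞) (by simp)).differentiableAt (by simp)
  rw [partialDeriv_congr k (h1 i), partialDeriv_congr i (h1 k), partialDeriv_eq_fderiv hy,
    partialDeriv_eq_fderiv hy, fderiv_clm_apply hd (differentiableAt_const _),
    fderiv_clm_apply hd (differentiableAt_const _)]
  have hs : IsSymmSndFDerivAt ℝ f y := hf.isSymmSndFDerivAt (by
    simp only [minSmoothness_of_isRCLikeNormedField]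
    exact WithTop.coe_le_coe.2 le_top)
  simpa using hs (EuclideanSpace.single k (1 : ℝ)) (EuclideanSpace.single i (1 : ℝ))

lemma partialDeriv_comp {τ : EuclideanSpace ℝ (Fin n) → EuclideanSpace ℝ (Fin n)}
    (hτy : τ y ∈ openHalf n) (k : Fin n) (hτ : DifferentiableAt ℝ τ y)
    {u : EuclideanSpace ℝ (Fin n) → ℝ} (hu : DifferentiableAt ℝ u (τ y)) :
    partialDeriv k (fun z => u (τ z)) y
      = ∑ a, partialDeriv k (fun z => τ z a) y * partialDeriv a u (τ y) := by
  have hc : ∀ a, partialDeriv k (fun z => τ z a) y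
      = (fderiv ℝ τ y (EuclideanSpace.single k (1 : ℝ))) a := by
    intro a
    rw [partialDeriv_eq_fderiv hy]
    have := ((EuclideanSpace.proj (𝕜 := ℝ) a).hasFDerivAt.comp y hτ.hasFDerivAt).fderiv
    exact congrArg (fun L => L (EuclideanSpace.single k (1 : ℝ))) this
  simp only [hc, partialDeriv_eq_fderiv hy, partialDeriv_eq_fderiv hτy]
  have h2 : fderiv ℝ (fun z => u (τ z)) y = (fderiv ℝ u (τ y)).comp (fderiv ℝ τ y) :=
    fderiv_comp y hu hτ
  rw [h2, ContinuousLinearMap.comp_apply]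
  set v := fderiv ℝ τ y (EuclideanSpace.single k (1 : ℝ))
  have hv : v = ∑ a, v a • EuclideanSpace.single a (1 : ℝ) := by
    ext b
    simp [Finset.sum_apply, Pi.single_apply]
  conv_lhs => rw [hv]
  simp [map_sum]

end PartialDeriv

/-! ### Tensor calculus in coordinates and its transformation laws -/

section FlatTensorCalculus

variable {n : ℕ} [NeZero n]

/-- The Christoffel symbols of a metric given by its matrix in coordinates. -/
def flatChristoffel (G : EuclideanSpace ℝ (Fin n) → Matrix (Fin n) (Fin n) ℝ)
    (y : EuclideanSpace ℝ (Fin n)) (k i j : Fin n) : ℝ :=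
  (1 / 2 : ℝ) * ∑ l, (G y)⁻¹ k l *
    (partialDeriv i (fun z => G z j l) y + partialDeriv j (fun z => G z i l) y
      - partialDeriv l (fun z => G z i j) y)

/-- The covariant derivative `∇_i X_j` of a 1-form given by its components in coordinates. -/
def flatCov (G : EuclideanSpace ℝ (Fin n) → Matrix (Fin n) (Fin n) ℝ)
    (X : EuclideanSpace ℝ (Fin n) → Fin n → ℝ) (y : EuclideanSpace ℝ (Fin n)) (i j : Fin n) : ℝ :=
  partialDeriv i (fun z => X z j) y - ∑ l, flatChristoffel G y l i j * X y l

/-- The covariant derivative `∇_k T_ji` of a 2-tensor given by its components in coordinates. -/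
def flatCovTwo (G : EuclideanSpace ℝ (Fin n) → Matrix (Fin n) (Fin n) ℝ)
    (T : EuclideanSpace ℝ (Fin n) → Fin n → Fin n → ℝ) (y : EuclideanSpace ℝ (Fin n))
    (k j i : Fin n) : ℝ :=
  partialDeriv k (fun z => T z j i) y - ∑ l, flatChristoffel G y l k j * T y l i
    - ∑ l, flatChristoffel G y l k i * T y j l

/-- The Jacobian matrix of a change of coordinates. -/
def jac (τ : EuclideanSpace ℝ (Fin n) → EuclideanSpace ℝ (Fin n))
    (y : EuclideanSpace ℝ (Fin n)) : Matrix (Fin n) (Fin n) ℝ :=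
  Matrix.of fun a i => partialDeriv i (fun z => τ z a) y

omit [NeZero n] in
lemma transpose_mul_mul_apply (A G : Matrix (Fin n) (Fin n) ℝ) (i j : Fin n) :
    (A.transpose * G * A) i j = pull₂ A G i j := by
  simp only [Matrix.mul_apply, Matrix.transpose_apply, pull₂, pull₁, Finset.sum_mul,
    Finset.mul_sum]
  rw [Finset.sum_comm]
  exact Finset.sum_congr rfl fun a _ => Finset.sum_congr rfl fun b _ => by ring

section Transform

variable {τ : EuclideanSpace ℝ (Fin n) → EuclideanSpace ℝ (Fin n)}
  {W : Set (EuclideanSpace ℝ (Fin n))} (hW : IsOpen W)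
  (hWi : ∀ y ∈ W, y ∈ openHalf n) (hτi : ∀ y ∈ W, τ y ∈ openHalf n)
  (hτ : ∀ y ∈ W, ContDiffAt ℝ ∞ τ y)

include hWi hτ in
lemma contDiffAt_jac {y : EuclideanSpace ℝ (Fin n)} (hy : y ∈ W) (a i : Fin n) :
    ContDiffAt ℝ ∞ (fun z => jac τ z a i) y :=
  contDiffAt_partialDeriv (hWi y hy) i (contDiffAt_euclidean.1 (hτ y hy) a)

include hWi hτ in
lemma partialDeriv_jac_symm {y : EuclideanSpace ℝ (Fin n)} (hy : y ∈ W) (a i k : Fin n) :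
    partialDeriv k (fun z => jac τ z a i) y = partialDeriv i (fun z => jac τ z a k) y :=
  partialDeriv_comm (hWi y hy) k i (contDiffAt_euclidean.1 (hτ y hy) a)

include hW hWi hτi hτ

/-- The derivative of a 1-form pulled back by `τ`: the pulled back derivative, and a term with the
second derivatives of `τ`, which the Christoffel symbols compensate. -/
lemma partialDeriv_pull₁ {X X' : EuclideanSpace ℝ (Fin n) → Fin n → ℝ}
    (hX : ∀ y ∈ W, ∀ a, ContDiffAt ℝ ∞ (fun z => X z a) (τ y))
    (hX' : ∀ y ∈ W, X' y = pull₁ (jac τ y) (X (τ y)))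
    {y : EuclideanSpace ℝ (Fin n)} (hy : y ∈ W) (k i : Fin n) :
    partialDeriv k (fun z => X' z i) y
      = ∑ a, partialDeriv k (fun z => jac τ z a i) y * X (τ y) a
        + pull₂ (jac τ y) (fun c a => partialDeriv c (fun z => X z a) (τ y)) k i := by
  have hyi := hWi y hy
  have h1 : (fun z => X' z i) =ᶠ[nhds y] fun z => ∑ a, jac τ z a i * X (τ z) a := by
    filter_upwards [hW.mem_nhds hy] with z hz
    rw [hX' z hz, pull₁]
  have dA : ∀ a, DifferentiableAt ℝ (fun z => jac τ z a i) y := fun a =>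
    (contDiffAt_jac hWi hτ hy a i).differentiableAt (by simp)
  have dτ : DifferentiableAt ℝ τ y := (hτ y hy).differentiableAt (by simp)
  have dX0 : ∀ a, DifferentiableAt ℝ (fun z => X z a) (τ y) := fun a =>
    (hX y hy a).differentiableAt (by simp)
  have dX : ∀ a, DifferentiableAt ℝ (fun z => X (τ z) a) y := fun a => (dX0 a).fun_comp' y dτ
  rw [partialDeriv_congr k h1, partialDeriv_sum hyi _ _ fun a _ => (dA a).fun_mul (dX a)]
  simp only [fun a => partialDeriv_mul hyi k (dA a) (dX a), Finset.sum_add_distrib]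
  congr 1
  have h2 : ∀ a, partialDeriv k (fun z => X (τ z) a) y
      = pull₁ (jac τ y) (fun c => partialDeriv c (fun z => X z a) (τ y)) k := fun a =>
    partialDeriv_comp hyi (hτi y hy) k dτ (dX0 a)
  simp only [h2]
  exact (pull₁_comm (jac τ y) (jac τ y)
    (fun c a => partialDeriv c (fun z => X z a) (τ y)) k i).symm

/-- The derivative of a 2-tensor pulled back by `τ`, in the same form as `partialDeriv_pull₁`. -/
lemma partialDeriv_pull₂ {T T' : EuclideanSpace ℝ (Fin n) → Fin n → Fin n → ℝ}
    (hT : ∀ y ∈ W, ∀ a b, ContDiffAt ℝ ∞ (fun z => T z a b) (τ y))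
    (hT' : ∀ y ∈ W, T' y = pull₂ (jac τ y) (T (τ y)))
    {y : EuclideanSpace ℝ (Fin n)} (hy : y ∈ W) (k i j : Fin n) :
    partialDeriv k (fun z => T' z i j) y
      = ∑ a, partialDeriv k (fun z => jac τ z a i) y * pull₁ (jac τ y) (T (τ y) a) j
        + pull₁ (jac τ y)
          (fun a => ∑ b, partialDeriv k (fun z => jac τ z b j) y * T (τ y) a b) i
        + pull₃ (jac τ y) (fun c a b => partialDeriv c (fun z => T z a b) (τ y)) k i j := by
  have hyi := hWi y hy
  have h1 : (fun z => T' z i j) =ᶠ[nhds y]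
      fun z => ∑ a, jac τ z a i * pull₁ (jac τ z) (T (τ z) a) j := by
    filter_upwards [hW.mem_nhds hy] with z hz
    rw [hT' z hz, pull₂, pull₁]
  have dA : ∀ a, DifferentiableAt ℝ (fun z => jac τ z a i) y := fun a =>
    (contDiffAt_jac hWi hτ hy a i).differentiableAt (by simp)
  have dA' : ∀ a, DifferentiableAt ℝ (fun z => jac τ z a j) y := fun a =>
    (contDiffAt_jac hWi hτ hy a j).differentiableAt (by simp)
  have dτ : DifferentiableAt ℝ τ y := (hτ y hy).differentiableAt (by simp)
  have dT : ∀ a b, DifferentiableAt ℝ (fun z => T (τ z) a b) y := fun a b =>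
    ((hT y hy a b).differentiableAt (by simp)).fun_comp' y dτ
  have dP : ∀ a, DifferentiableAt ℝ (fun z => pull₁ (jac τ z) (T (τ z) a) j) y := by
    intro a
    simp only [pull₁]
    exact DifferentiableAt.fun_sum fun b _ => (dA' b).mul (dT a b)
  rw [partialDeriv_congr k h1, partialDeriv_sum hyi _ _ fun a _ => (dA a).fun_mul (dP a)]
  simp only [fun a => partialDeriv_mul hyi k (dA a) (dP a), Finset.sum_add_distrib, add_assoc]
  congr 1
  have h2 : ∀ a, partialDeriv k (fun z => pull₁ (jac τ z) (T (τ z) a) j) y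
      = ∑ b, partialDeriv k (fun z => jac τ z b j) y * T (τ y) a b
        + pull₂ (jac τ y) (fun c b => partialDeriv c (fun z => T z a b) (τ y)) k j := fun a =>
    partialDeriv_pull₁ hW hWi hτi hτ (X := fun z => T z a)
      (X' := fun z => pull₁ (jac τ z) (T (τ z) a)) (fun y hy b => hT y hy a b) (fun _ _ => rfl)
      hy k j
  simp only [h2, mul_add, Finset.sum_add_distrib]
  congr 1
  refine Eq.trans ?_ (pull₁_comm (jac τ y) (jac τ y)
    (fun c a => pull₁ (jac τ y) (fun b => partialDeriv c (fun z => T z a b) (τ y)) j) k i).symm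
  rfl

variable {G G' : EuclideanSpace ℝ (Fin n) → Matrix (Fin n) (Fin n) ℝ}
  (hG : ∀ y ∈ W, ∀ a b, ContDiffAt ℝ ∞ (fun z => G z a b) (τ y))
  (hGs : ∀ y ∈ W, ∀ a b, G (τ y) a b = G (τ y) b a)
  (hGu : ∀ y ∈ W, IsUnit (G (τ y)))
  (hA : ∀ y ∈ W, IsUnit (jac τ y))
  (hG' : ∀ y ∈ W, G' y = (jac τ y).transpose * G (τ y) * jac τ y)

include hG hGs hGu hA hG'

/-- The transformation law of the Christoffel symbols. -/
lemma flatChristoffel_transform {y : EuclideanSpace ℝ (Fin n)} (hy : y ∈ W) (a i j : Fin n) :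
    ∑ k, jac τ y a k * flatChristoffel G' y k i j
      = pull₂ (jac τ y) (flatChristoffel G (τ y) a) i j
        + partialDeriv i (fun z => jac τ z a j) y := by
  set A := jac τ y with hAdef
  set dA : Fin n → Fin n → Fin n → ℝ := fun k i a => partialDeriv k (fun z => jac τ z a i) y
  have dAs : ∀ k i a, dA k i a = dA i k a := fun k i a => partialDeriv_jac_symm hWi hτ hy a i k
  set Q : Fin n → Fin n → Fin n → ℝ := fun k i j => ∑ a, dA k i a * pull₁ A (G (τ y) a) j with hQ
  have hQs : ∀ k i j, Q k i j = Q i k j := fun k i j => by simp only [hQ, dAs k i]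
  have hdG : ∀ k i j, partialDeriv k (fun z => G' z i j) y
      = Q k i j + Q k j i
        + pull₃ A (fun c a b => partialDeriv c (fun z => G z a b) (τ y)) k i j := by
    intro k i j
    rw [partialDeriv_pull₂ hW hWi hτi hτ (T := fun z => G z) (T' := fun z => G' z) hG
      (fun z hz => by
        funext i j
        rw [hG' z hz, transpose_mul_mul_apply]) hy k i j]
    congr 2
    simp only [hQ, pull₁, Finset.mul_sum]
    rw [Finset.sum_comm]
    refine Finset.sum_congr rfl fun b _ => Finset.sum_congr rfl fun c _ => ?_
    rw [hGs y hy c b]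
    ring
  -- the vector whose image under `Aᵀ` consists of the lowered symbols of `G'`
  set w : Fin n → ℝ := fun c => ∑ a, dA i j a * G (τ y) a c
    + (1 / 2 : ℝ) * (pull₂ A (fun a b => partialDeriv a (fun z => G z b c) (τ y)) i j
      + pull₂ A (fun a b => partialDeriv b (fun z => G z a c) (τ y)) i j
      - pull₂ A (fun a b => partialDeriv c (fun z => G z a b) (τ y)) i j) with hw
  have hlow : (fun l => (1 / 2 : ℝ) * (partialDeriv i (fun z => G' z j l) y
      + partialDeriv j (fun z => G' z i l) y - partialDeriv l (fun z => G' z i j) y))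
      = A.transpose.mulVec w := by
    funext l
    have e0 : A.transpose.mulVec w l = pull₁ A w l := rfl
    have e1 : pull₁ A w l = Q i j l
        + (1 / 2 : ℝ) * (pull₃ A (fun c a b => partialDeriv c (fun z => G z a b) (τ y)) i j l
        + pull₃ A (fun c a b => partialDeriv c (fun z => G z a b) (τ y)) j i l
        - pull₃ A (fun c a b => partialDeriv c (fun z => G z a b) (τ y)) l i j) := by
      have f1 : pull₁ A (fun c => ∑ a, dA i j a * G (τ y) a c) l = Q i j l := by
        simp only [hQ, pull₁, Finset.mul_sum]
        rw [Finset.sum_comm]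
        exact Finset.sum_congr rfl fun b _ => Finset.sum_congr rfl fun c _ => by ring
      have f2 : pull₁ A (fun c => pull₂ A (fun a b => partialDeriv a (fun z => G z b c) (τ y)) i j) l
          = pull₃ A (fun c a b => partialDeriv c (fun z => G z a b) (τ y)) i j l := by
        simp only [pull₂, pull₃]
        rw [pull₁_comm A A (fun c a => pull₁ A (fun b => partialDeriv a (fun z => G z b c) (τ y)) j)]
        congr 1
        funext a
        exact pull₁_comm A A (fun c b => partialDeriv a (fun z => G z b c) (τ y)) l j
      have f3 : pull₁ A (fun c => pull₂ A (fun a b => partialDeriv b (fun z => G z a c) (τ y)) i j) l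
          = pull₃ A (fun c a b => partialDeriv c (fun z => G z a b) (τ y)) j i l := by
        rw [← show (pull₁ A (fun c => pull₂ A (fun a b => partialDeriv a (fun z => G z b c) (τ y)) j i) l
          = pull₃ A (fun c a b => partialDeriv c (fun z => G z a b) (τ y)) j i l) from ?_]
        · congr 1
          funext c
          exact pull₁_comm A A (fun a b => partialDeriv b (fun z => G z a c) (τ y)) i j
        · simp only [pull₂, pull₃]
          rw [pull₁_comm A A
            (fun c a => pull₁ A (fun b => partialDeriv a (fun z => G z b c) (τ y)) i)]
          congr 1
          funext a
          exact pull₁_comm A A (fun c b => partialDeriv a (fun z => G z b c) (τ y)) l i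
      have f4 : pull₁ A (fun c => pull₂ A (fun a b => partialDeriv c (fun z => G z a b) (τ y)) i j) l
          = pull₃ A (fun c a b => partialDeriv c (fun z => G z a b) (τ y)) l i j := rfl
      rw [← f1, ← f2, ← f3, ← f4]
      simp only [pull₁, hw]
      rw [← Finset.sum_add_distrib, ← Finset.sum_sub_distrib, Finset.mul_sum,
        ← Finset.sum_add_distrib]
      exact Finset.sum_congr rfl fun c _ => by ring
    rw [e0, e1, hdG, hdG, hdG, hQs j i l, hQs i l j, hQs j l i]
    ring
  have hΓ' : (fun k => flatChristoffel G' y k i j) = (G' y)⁻¹.mulVec (A.transpose.mulVec w) := by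
    rw [← hlow]
    funext k
    simp only [flatChristoffel, Matrix.mulVec, dotProduct, Finset.mul_sum]
    exact Finset.sum_congr rfl fun l _ => by ring
  have hAu := (Matrix.isUnit_iff_isUnit_det A).1 (hA y hy)
  have hGu' := (Matrix.isUnit_iff_isUnit_det (G (τ y))).1 (hGu y hy)
  have hAt : IsUnit A.transpose.det := by rwa [Matrix.det_transpose]
  have hfin : A.mulVec (fun k => flatChristoffel G' y k i j) = (G (τ y))⁻¹.mulVec w := by
    rw [hΓ', Matrix.mulVec_mulVec, Matrix.mulVec_mulVec, hG' y hy, Matrix.mul_inv_rev,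
      Matrix.mul_inv_rev, Matrix.mul_nonsing_inv_cancel_left _ _ hAu, Matrix.mul_assoc,
      Matrix.nonsing_inv_mul _ hAt, Matrix.mul_one]
  have h1 : ∑ k, A a k * flatChristoffel G' y k i j
      = A.mulVec (fun k => flatChristoffel G' y k i j) a := rfl
  rw [h1, hfin]
  have g1 : (G (τ y))⁻¹.mulVec (fun c => ∑ b, dA i j b * G (τ y) b c) = dA i j := by
    have : (fun c => ∑ b, dA i j b * G (τ y) b c) = (G (τ y)).mulVec (dA i j) := by
      funext c
      simp only [Matrix.mulVec, dotProduct]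
      exact Finset.sum_congr rfl fun b _ => by rw [hGs y hy b c, mul_comm]
    rw [this, Matrix.mulVec_mulVec, Matrix.nonsing_inv_mul _ hGu', Matrix.one_mulVec]
  have g2 : pull₂ A (flatChristoffel G (τ y) a) i j = (G (τ y))⁻¹.mulVec (fun c => (1 / 2 : ℝ) *
      (pull₂ A (fun a b => partialDeriv a (fun z => G z b c) (τ y)) i j
      + pull₂ A (fun a b => partialDeriv b (fun z => G z a c) (τ y)) i j
      - pull₂ A (fun a b => partialDeriv c (fun z => G z a b) (τ y)) i j)) a := by
    simp only [Matrix.mulVec, dotProduct, pull₂, pull₁, flatChristoffel, Finset.mul_sum]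
    simp only [← Finset.sum_add_distrib, ← Finset.sum_sub_distrib, Finset.mul_sum]
    refine Eq.trans (Finset.sum_congr rfl fun p _ => Finset.sum_comm) ?_
    rw [Finset.sum_comm]
    exact Finset.sum_congr rfl fun c _ => Finset.sum_congr rfl fun p _ =>
      Finset.sum_congr rfl fun q _ => by ring
  rw [g2, show partialDeriv i (fun z => jac τ z a j) y = dA i j a from rfl, ← congrFun g1 a,
    ← Pi.add_apply, ← Matrix.mulVec_add]
  congr 2
  funext c
  simp only [hw, Pi.add_apply]
  ring

variable {X X' : EuclideanSpace ℝ (Fin n) → Fin n → ℝ}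

/-- The covariant derivative of a 1-form is a tensor. -/
lemma flatCov_transform
    (hX : ∀ y ∈ W, ∀ a, ContDiffAt ℝ ∞ (fun z => X z a) (τ y))
    (hX' : ∀ y ∈ W, X' y = pull₁ (jac τ y) (X (τ y)))
    {y : EuclideanSpace ℝ (Fin n)} (hy : y ∈ W) :
    flatCov G' X' y = pull₂ (jac τ y) (flatCov G X (τ y)) := by
  funext i j
  have h1 : ∑ l, flatChristoffel G' y l i j * X' y l
      = ∑ a, (∑ k, jac τ y a k * flatChristoffel G' y k i j) * X (τ y) a := by
    rw [hX' y hy]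
    simp only [pull₁, Finset.mul_sum, Finset.sum_mul]
    rw [Finset.sum_comm]
    exact Finset.sum_congr rfl fun a _ => Finset.sum_congr rfl fun k _ => by ring
  rw [flatCov, partialDeriv_pull₁ hW hWi hτi hτ hX hX' hy, h1]
  simp only [flatChristoffel_transform hW hWi hτi hτ hG hGs hGu hA hG' hy]
  simp only [add_mul, Finset.sum_add_distrib]
  have h2 : pull₂ (jac τ y) (flatCov G X (τ y)) i j
      = pull₂ (jac τ y) (fun c a => partialDeriv c (fun z => X z a) (τ y)) i j
        - ∑ a, pull₂ (jac τ y) (flatChristoffel G (τ y) a) i j * X (τ y) a := by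
    simp only [pull₂, pull₁, flatCov, mul_sub, Finset.sum_sub_distrib, Finset.mul_sum,
      Finset.sum_mul]
    congr 1
    refine Eq.trans (Finset.sum_congr rfl fun p _ => Finset.sum_comm) ?_
    rw [Finset.sum_comm]
    exact Finset.sum_congr rfl fun c _ => Finset.sum_congr rfl fun p _ =>
      Finset.sum_congr rfl fun q _ => by ring
  rw [h2]
  ring

/-- The covariant derivative of a 2-tensor is a tensor. -/
lemma flatCovTwo_transform {T T' : EuclideanSpace ℝ (Fin n) → Fin n → Fin n → ℝ}
    (hT : ∀ y ∈ W, ∀ a b, ContDiffAt ℝ ∞ (fun z => T z a b) (τ y))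
    (hT' : ∀ y ∈ W, T' y = pull₂ (jac τ y) (T (τ y)))
    {y : EuclideanSpace ℝ (Fin n)} (hy : y ∈ W) :
    flatCovTwo G' T' y = pull₃ (jac τ y) (flatCovTwo G T (τ y)) := by
  funext k j i
  set A := jac τ y with hAdef
  have h1 : ∑ l, flatChristoffel G' y l k j * T' y l i
      = ∑ a, (∑ l, A a l * flatChristoffel G' y l k j) * pull₁ A (T (τ y) a) i := by
    rw [hT' y hy]
    simp only [pull₂, pull₁, Finset.mul_sum, Finset.sum_mul]
    rw [Finset.sum_comm]
    refine Finset.sum_congr rfl fun a _ => ?_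
    rw [Finset.sum_comm]
    refine Finset.sum_congr rfl fun b _ => Finset.sum_congr rfl fun l _ => by ring
  have h2 : ∑ l, flatChristoffel G' y l k i * T' y j l
      = ∑ b, (∑ l, A b l * flatChristoffel G' y l k i) * pull₁ A (fun a => T (τ y) a b) j := by
    rw [hT' y hy]
    have : ∀ l, pull₂ (jac τ y) (T (τ y)) j l
        = pull₁ A (fun b => pull₁ A (fun a => T (τ y) a b) j) l := fun l => pull₁_comm A A _ j l
    simp only [this]
    have key : ∀ V : Fin n → ℝ, ∑ l, flatChristoffel G' y l k i * pull₁ A V l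
        = ∑ b, (∑ l, A b l * flatChristoffel G' y l k i) * V b := by
      intro V
      simp only [pull₁, Finset.mul_sum, Finset.sum_mul]
      rw [Finset.sum_comm]
      exact Finset.sum_congr rfl fun a _ => Finset.sum_congr rfl fun l _ => by ring
    exact key _
  rw [flatCovTwo, partialDeriv_pull₂ hW hWi hτi hτ hT hT' hy, h1, h2]
  simp only [hAdef, flatChristoffel_transform hW hWi hτi hτ hG hGs hGu hA hG' hy]
  simp only [← hAdef, add_mul, Finset.sum_add_distrib]
  have h3 : pull₃ A (flatCovTwo G T (τ y)) k j i
      = pull₃ A (fun c a b => partialDeriv c (fun z => T z a b) (τ y)) k j i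
        - ∑ a, pull₂ A (flatChristoffel G (τ y) a) k j * pull₁ A (T (τ y) a) i
        - ∑ b, pull₂ A (flatChristoffel G (τ y) b) k i * pull₁ A (fun a => T (τ y) a b) j := by
    have e1 : ∑ a, pull₂ A (flatChristoffel G (τ y) a) k j * pull₁ A (T (τ y) a) i
        = pull₃ A (fun c a b => ∑ l, flatChristoffel G (τ y) l c a * T (τ y) l b) k j i := by
      have g1 : ∀ c a, pull₁ A (fun b => ∑ l, flatChristoffel G (τ y) l c a * T (τ y) l b) i
          = ∑ l, flatChristoffel G (τ y) l c a * pull₁ A (T (τ y) l) i := by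
        intro c a
        simp only [pull₁, Finset.mul_sum]
        rw [Finset.sum_comm]
        exact Finset.sum_congr rfl fun c _ => Finset.sum_congr rfl fun p _ => by ring
      simp only [pull₃, pull₂, g1]
      have key : ∀ V : Fin n → ℝ, ∑ a, pull₁ A (fun i => pull₁ A (flatChristoffel G (τ y) a i) j) k
          * V a = pull₁ A (fun c => pull₁ A (fun a => ∑ l, flatChristoffel G (τ y) l c a * V l) j)
            k := by
        intro V
        simp only [pull₁, Finset.mul_sum, Finset.sum_mul]
        rw [Finset.sum_comm]
        refine Finset.sum_congr rfl fun c _ => ?_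
        rw [Finset.sum_comm]
        refine Finset.sum_congr rfl fun b _ => Finset.sum_congr rfl fun l _ => by ring
      exact key _
    have e2 : ∑ b, pull₂ A (flatChristoffel G (τ y) b) k i * pull₁ A (fun a => T (τ y) a b) j
        = pull₃ A (fun c a b => ∑ l, flatChristoffel G (τ y) l c b * T (τ y) a l) k j i := by
      have g1 : ∀ c, pull₂ A (fun a b => ∑ l, flatChristoffel G (τ y) l c b * T (τ y) a l) j i
          = ∑ l, pull₁ A (flatChristoffel G (τ y) l c) i * pull₁ A (fun a => T (τ y) a l) j := by
        intro c
        simp only [pull₂, pull₁, Finset.mul_sum, Finset.sum_mul]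
        refine Eq.trans (Finset.sum_congr rfl fun p _ => Finset.sum_comm) ?_
        rw [Finset.sum_comm]
        exact Finset.sum_congr rfl fun c _ => Finset.sum_congr rfl fun p _ =>
          Finset.sum_congr rfl fun q _ => by ring
      simp only [pull₃, g1]
      have key : ∀ V : Fin n → ℝ, ∑ b, pull₂ A (flatChristoffel G (τ y) b) k i * V b
          = pull₁ A (fun c => ∑ l, pull₁ A (flatChristoffel G (τ y) l c) i * V l) k := by
        intro V
        simp only [pull₂, pull₁, Finset.mul_sum, Finset.sum_mul]
        rw [Finset.sum_comm]
        refine Finset.sum_congr rfl fun c _ => ?_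
        refine Finset.sum_congr rfl fun b _ => Finset.sum_congr rfl fun l _ => by ring
      exact key _
    rw [e1, e2]
    simp only [pull₃, pull₂, pull₁, flatCovTwo, mul_sub, Finset.sum_sub_distrib]
  rw [h3]
  have h4 : pull₁ A (fun a => ∑ b, partialDeriv k (fun z => jac τ z b i) y * T (τ y) a b) j
      = ∑ b, partialDeriv k (fun z => jac τ z b i) y * pull₁ A (fun a => T (τ y) a b) j := by
    simp only [pull₁, Finset.mul_sum]
    rw [Finset.sum_comm]
    exact Finset.sum_congr rfl fun c _ => Finset.sum_congr rfl fun p _ => by ring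
  rw [h4]
  ring

end Transform

end FlatTensorCalculus

end

noncomputable section

/-! ### Conformally compact metrics in coordinates -/

section Conformal

open Matrix

section MatrixInverse

variable {n : ℕ} {V : Type*} [NormedAddCommGroup V] [NormedSpace ℝ V] {s : Set V} {y : V}

lemma contDiffWithinAt_det {A : V → Matrix (Fin n) (Fin n) ℝ}
    (hA : ∀ i j, ContDiffWithinAt ℝ ∞ (fun z => A z i j) s y) :
    ContDiffWithinAt ℝ ∞ (fun z => (A z).det) s y := by
  simp only [Matrix.det_apply]
  exact ContDiffWithinAt.sum fun σ _ => ContDiffWithinAt.const_smul _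
    (contDiffWithinAt_prod fun i _ => hA _ _)

lemma contDiffWithinAt_inv_matrix {A : V → Matrix (Fin n) (Fin n) ℝ}
    (hA : ∀ i j, ContDiffWithinAt ℝ ∞ (fun z => A z i j) s y) (hu : IsUnit (A y)) (i j : Fin n) :
    ContDiffWithinAt ℝ ∞ (fun z => (A z)⁻¹ i j) s y := by
  have hdet : (A y).det ≠ 0 := ((Matrix.isUnit_iff_isUnit_det _).1 hu).ne_zero
  simp only [Matrix.inv_def, Ring.inverse_eq_inv', Matrix.smul_apply, smul_eq_mul,
    Matrix.adjugate_apply]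
  refine ((contDiffWithinAt_det hA).inv hdet).mul (contDiffWithinAt_det fun a b => ?_)
  by_cases h : a = j
  · subst h
    simpa using contDiffWithinAt_const
  · simpa [Matrix.updateRow_ne h] using hA a b

end MatrixInverse

variable {n : ℕ} [NeZero n]

/-- The components `(dX)_ij / 2` of half the exterior derivative of a 1-form. -/
def flatCurl (X : EuclideanSpace ℝ (Fin n) → Fin n → ℝ) (y : EuclideanSpace ℝ (Fin n)) :
    Matrix (Fin n) (Fin n) ℝ :=
  Matrix.of fun i j =>
    (1 / 2 : ℝ) * (partialDeriv i (fun z => X z j) y - partialDeriv j (fun z => X z i) y)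

/-- The symmetrized covariant derivative of a 1-form in coordinates. -/
def flatKilling (G : EuclideanSpace ℝ (Fin n) → Matrix (Fin n) (Fin n) ℝ)
    (X : EuclideanSpace ℝ (Fin n) → Fin n → ℝ) (y : EuclideanSpace ℝ (Fin n)) (i j : Fin n) : ℝ :=
  (1 / 2 : ℝ) * (flatCov G X y i j + flatCov G X y j i)

/-- The operator `U` in coordinates. -/
def flatU (G : EuclideanSpace ℝ (Fin n) → Matrix (Fin n) (Fin n) ℝ)
    (X : EuclideanSpace ℝ (Fin n) → Fin n → ℝ) (y : EuclideanSpace ℝ (Fin n)) (k j i : Fin n) : ℝ :=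
  flatCovTwo G (flatCov G X) y k j i - G y j k * X y i + G y i k * X y j

/-- The differential of a function in coordinates. -/
def flatGrad (r : EuclideanSpace ℝ (Fin n) → ℝ) (y : EuclideanSpace ℝ (Fin n)) (k : Fin n) : ℝ :=
  partialDeriv k r y

lemma flatCurl_transpose (X : EuclideanSpace ℝ (Fin n) → Fin n → ℝ)
    (y : EuclideanSpace ℝ (Fin n)) : (flatCurl X y)ᵀ = -flatCurl X y := by
  ext i j
  simp [flatCurl]
  ring

variable {y : EuclideanSpace ℝ (Fin n)}
  {G h : EuclideanSpace ℝ (Fin n) → Matrix (Fin n) (Fin n) ℝ}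
  {r : EuclideanSpace ℝ (Fin n) → ℝ} {X : EuclideanSpace ℝ (Fin n) → Fin n → ℝ}

lemma flatChristoffel_symm (hG : ∀ᶠ z in nhds y, ∀ i j, G z i j = G z j i) (k i j : Fin n) :
    flatChristoffel G y k i j = flatChristoffel G y k j i := by
  have h1 : ∀ l, partialDeriv l (fun z => G z i j) y = partialDeriv l (fun z => G z j i) y :=
    fun l => partialDeriv_congr l (hG.mono fun z hz => hz i j)
  simp only [flatChristoffel, h1]
  congr 1
  exact Finset.sum_congr rfl fun l _ => by ring

lemma contDiffAt_flatChristoffel (hy : y ∈ openHalf n)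
    (hG : ∀ i j, ContDiffAt ℝ ∞ (fun z => G z i j) y) (hu : IsUnit (G y)) (k i j : Fin n) :
    ContDiffAt ℝ ∞ (fun z => flatChristoffel G z k i j) y := by
  refine contDiffAt_const.mul (ContDiffAt.sum fun l _ => ContDiffAt.mul ?_ ?_)
  · rw [← contDiffWithinAt_univ]
    exact contDiffWithinAt_inv_matrix (fun i j => (hG i j).contDiffWithinAt) hu k l
  · exact ((contDiffAt_partialDeriv hy i (hG j l)).add (contDiffAt_partialDeriv hy j (hG i l))).sub
      (contDiffAt_partialDeriv hy l (hG i j))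

lemma contDiffAt_flatCov (hy : y ∈ openHalf n)
    (hG : ∀ i j, ContDiffAt ℝ ∞ (fun z => G z i j) y) (hu : IsUnit (G y))
    (hX : ∀ i, ContDiffAt ℝ ∞ (fun z => X z i) y) (i j : Fin n) :
    ContDiffAt ℝ ∞ (fun z => flatCov G X z i j) y :=
  (contDiffAt_partialDeriv hy i (hX j)).sub
    (ContDiffAt.sum fun l _ => (contDiffAt_flatChristoffel hy hG hu l i j).mul (hX l))

lemma contDiffAt_flatCovTwo {T : EuclideanSpace ℝ (Fin n) → Fin n → Fin n → ℝ}
    (hy : y ∈ openHalf n)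
    (hG : ∀ i j, ContDiffAt ℝ ∞ (fun z => G z i j) y) (hu : IsUnit (G y))
    (hT : ∀ i j, ContDiffAt ℝ ∞ (fun z => T z i j) y) (k i j : Fin n) :
    ContDiffAt ℝ ∞ (fun z => flatCovTwo G T z k i j) y :=
  ((contDiffAt_partialDeriv hy k (hT i j)).sub
    (ContDiffAt.sum fun l _ => (contDiffAt_flatChristoffel hy hG hu l k i).mul (hT l j))).sub
    (ContDiffAt.sum fun l _ => (contDiffAt_flatChristoffel hy hG hu l k j).mul (hT i l))

lemma flatCov_eq_curl_add_killing (hG : ∀ᶠ z in nhds y, ∀ i j, G z i j = G z j i) (i j : Fin n) :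
    flatCov G X y i j = flatCurl X y i j + flatKilling G X y i j := by
  simp only [flatKilling, flatCurl, flatCov, of_apply,
    fun l => flatChristoffel_symm hG l j i]
  ring

/-- The Christoffel symbols of `ρ⁻² h` differ from those of `h` by a term of order `ρ⁻¹`. Its
contribution to the covariant derivative makes up the hyperbolic model. -/
lemma flatChristoffel_conformal (hy : y ∈ openHalf n) (hr : r y ≠ 0)
    (hrd : DifferentiableAt ℝ r y) (hhd : ∀ i j, DifferentiableAt ℝ (fun z => h z i j) y)
    (hu : IsUnit (h y)) (hhs : (h y)ᵀ = h y) (hG : ∀ᶠ z in nhds y, G z = (r z ^ 2)⁻¹ • h z)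
    (k i j : Fin n) :
    r y * flatChristoffel G y k i j = r y * flatChristoffel h y k i j
      - ((1 : Matrix (Fin n) (Fin n) ℝ) k i * flatGrad r y j
        + (1 : Matrix (Fin n) (Fin n) ℝ) k j * flatGrad r y i
        - ((h y)⁻¹ *ᵥ flatGrad r y) k * h y i j) := by
  have hd : ∀ l i j, partialDeriv l (fun z => G z i j) y
      = (r y ^ 2)⁻¹ * partialDeriv l (fun z => h z i j) y
        - 2 * (r y ^ 3)⁻¹ * flatGrad r y l * h y i j := by
    intro l i j
    have h1 : (fun z => G z i j) =ᶠ[nhds y] fun z => (r z ^ 2)⁻¹ * h z i j :=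
      hG.mono fun z hz => by simp only [hz, Matrix.smul_apply, smul_eq_mul]
    have hinv : HasFDerivAt (fun z => (r z ^ 2)⁻¹)
        (-(((r y ^ 2) ^ 2)⁻¹) • ((2 * r y) • fderiv ℝ r y)) y := by
      have h2 : HasFDerivAt (fun z => r z ^ 2) ((2 * r y) • fderiv ℝ r y) y := by
        simpa using hrd.hasFDerivAt.pow 2
      have h3 := (hasDerivAt_inv (pow_ne_zero 2 hr)).comp_hasFDerivAt y h2
      exact h3
    rw [partialDeriv_congr l h1, partialDeriv_mul hy l hinv.differentiableAt (hhd i j),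
      partialDeriv_eq_fderiv hy l (fun z => (r z ^ 2)⁻¹), hinv.fderiv, flatGrad,
      partialDeriv_eq_fderiv hy l r]
    simp only [_root_.smul_apply, smul_eq_mul]
    field_simp
    ring
  have hGi : (G y)⁻¹ = r y ^ 2 • (h y)⁻¹ := by
    rw [hG.self_of_nhds]
    have : Invertible ((r y ^ 2)⁻¹ : ℝ) := invertibleOfNonzero (inv_ne_zero (pow_ne_zero 2 hr))
    rw [Matrix.inv_smul _ _ ((Matrix.isUnit_iff_isUnit_det _).1 hu)]
    congr 1
    simp
  have hHh : (h y)⁻¹ * h y = 1 :=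
    Matrix.nonsing_inv_mul _ ((Matrix.isUnit_iff_isUnit_det _).1 hu)
  have hδ : ∀ k j, ∑ l, (h y)⁻¹ k l * h y j l = (1 : Matrix (Fin n) (Fin n) ℝ) k j := by
    intro k j
    rw [← hHh, mul_apply]
    exact Finset.sum_congr rfl fun l _ => by rw [← congrFun (congrFun hhs l) j, transpose_apply]
  simp only [flatChristoffel, hd, hGi, Matrix.smul_apply, smul_eq_mul]
  rw [← hδ k i, ← hδ k j, mulVec, dotProduct]
  simp only [Finset.mul_sum, Finset.sum_mul]
  simp only [← Finset.sum_add_distrib, ← Finset.sum_sub_distrib]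
  refine Finset.sum_congr rfl fun l _ => ?_
  field_simp
  ring

section Equations

variable (hy : y ∈ openHalf n) (hr : r y ≠ 0) (hrd : ContDiffAt ℝ ∞ r y)
  (hhd : ∀ i j, ContDiffAt ℝ ∞ (fun z => h z i j) y)
  (hu : IsUnit (h y)) (hhs : ∀ᶠ z in nhds y, (h z)ᵀ = h z)
  (hG : ∀ᶠ z in nhds y, G z = (r z ^ 2)⁻¹ • h z)
  (hX : ∀ i, ContDiffAt ℝ ∞ (fun z => X z i) y)

omit [NeZero n] in
lemma eventually_conformal_symm (hhs : ∀ᶠ z in nhds y, (h z)ᵀ = h z)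
    (hG : ∀ᶠ z in nhds y, G z = (r z ^ 2)⁻¹ • h z) :
    ∀ᶠ z in nhds y, ∀ i j, G z i j = G z j i := by
  filter_upwards [hhs, hG] with z h1 h2 i j
  rw [h2, Matrix.smul_apply, Matrix.smul_apply, ← h1, transpose_apply, h1]

include hy hX in
lemma contDiffAt_flatCurl (i j : Fin n) : ContDiffAt ℝ ∞ (fun z => flatCurl X z i j) y :=
  contDiffAt_const.mul ((contDiffAt_partialDeriv hy i (hX j)).sub
    (contDiffAt_partialDeriv hy j (hX i)))

include hy hr hrd hhd hu hhs hG hX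

/-- The rescaled form `x = ρ X` satisfies the equation of the hyperbolic model up to the Killing
operator and a term of order `ρ`. -/
lemma scaled_form_equation (k b : Fin n) :
    r y * partialDeriv k (fun z => r z * X z b) y
      = modelDerivForm (h y)⁻¹ (h y) (flatGrad r y) (r y • X y) (r y ^ 2 • flatCurl X y) k b
        + (r y ^ 2 * flatKilling G X y k b
          + r y * ∑ l, flatChristoffel h y l k b * (r y * X y l)) := by
  have hGs := eventually_conformal_symm hhs hG
  have hrd' := hrd.differentiableAt (by simp)
  have hc := flatCov_eq_curl_add_killing (X := X) hGs k b
  have h1 : partialDeriv k (fun z => X z b) y = flatCurl X y k b + flatKilling G X y k b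
      + ∑ l, flatChristoffel G y l k b * X y l := by
    rw [← hc, flatCov]
    ring
  rw [partialDeriv_mul hy k hrd' ((hX b).differentiableAt (by simp)), h1]
  have h2 : r y * ∑ l, flatChristoffel G y l k b * X y l
      = r y * ∑ l, flatChristoffel h y l k b * X y l
        - (X y k * flatGrad r y b + X y b * flatGrad r y k
          - ((h y)⁻¹ *ᵥ flatGrad r y) ⬝ᵥ X y * h y k b) := by
    rw [Finset.mul_sum]
    simp only [← mul_assoc, flatChristoffel_conformal hy hr hrd'
      (fun i j => (hhd i j).differentiableAt (by simp)) hu hhs.self_of_nhds hG]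
    simp only [sub_mul, add_mul, Finset.sum_sub_distrib, Finset.sum_add_distrib, Matrix.one_apply,
      ite_mul, one_mul, zero_mul, Finset.sum_ite_eq', Finset.mem_univ, if_true, dotProduct,
      Finset.sum_mul, Finset.mul_sum]
    congr 1
    · exact Finset.sum_congr rfl fun l _ => by ring
    · congr 1
      · ring
      · exact Finset.sum_congr rfl fun l _ => by ring
  have h3 : r y * ∑ l, flatChristoffel h y l k b * (r y * X y l)
      = r y * (r y * ∑ l, flatChristoffel h y l k b * X y l) := by
    congr 1
    rw [Finset.mul_sum]
    exact Finset.sum_congr rfl fun l _ => by ring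
  have h4 : (r y • X y) ⬝ᵥ (h y)⁻¹ *ᵥ flatGrad r y
      = r y * ((h y)⁻¹ *ᵥ flatGrad r y ⬝ᵥ X y) := by
    rw [smul_dotProduct, dotProduct_comm, smul_eq_mul]
  rw [h3]
  simp only [modelDerivForm, Matrix.add_apply, Matrix.sub_apply, Matrix.smul_apply,
    vecMulVec_apply, Pi.smul_apply, smul_eq_mul, h4]
  have h5 : partialDeriv k r y = flatGrad r y k := rfl
  rw [h5]
  linear_combination r y * h2

/-- The rescaled differential `f = ρ² dX / 2` satisfies the equation of the hyperbolic model up to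
the operator `U` and a term of order `ρ`. -/
lemma scaled_curl_equation (k i j : Fin n) :
    r y * partialDeriv k (fun z => r z ^ 2 * flatCurl X z i j) y
      = modelDerivTwoForm (h y)⁻¹ (h y) (flatGrad r y) (r y • X y) (r y ^ 2 • flatCurl X y) k i j
        + (r y ^ 3 * ((1 / 2 : ℝ) * (flatU G X y k i j - flatU G X y k j i))
          + r y * (∑ l, flatChristoffel h y l k i * (r y ^ 2 * flatCurl X y l j)
            + ∑ l, flatChristoffel h y l k j * (r y ^ 2 * flatCurl X y i l))) := by
  have hGs := eventually_conformal_symm hhs hG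
  have hrd' := hrd.differentiableAt (by simp)
  have hFd := fun i j => (contDiffAt_flatCurl hy hX i j).differentiableAt (by simp)
  have hFe : ∀ᶠ z in nhds y, ∀ i j, flatCurl X z i j
      = (1 / 2 : ℝ) * (flatCov G X z i j - flatCov G X z j i) := by
    filter_upwards [hGs.eventually_nhds] with z hz i j
    rw [flatCov_eq_curl_add_killing hz i j, flatCov_eq_curl_add_killing hz j i]
    have : flatCurl X z j i = -flatCurl X z i j := by
      have := congrFun (congrFun (flatCurl_transpose X z) i) j
      simpa using this
    simp only [flatKilling, this]
    ring
  have hGc : ∀ i j, ContDiffAt ℝ ∞ (fun z => G z i j) y := by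
    intro i j
    have h1 : (fun z => G z i j) =ᶠ[nhds y] fun z => (r z ^ 2)⁻¹ * h z i j :=
      hG.mono fun z hz => by simp only [hz, Matrix.smul_apply, smul_eq_mul]
    exact (((hrd.pow 2).inv (pow_ne_zero 2 hr)).mul (hhd i j)).congr_of_eventuallyEq h1
  have hGu : IsUnit (G y) := by
    rw [hG.self_of_nhds, Matrix.isUnit_iff_isUnit_det, Matrix.det_smul, isUnit_iff_ne_zero]
    exact mul_ne_zero (pow_ne_zero _ (inv_ne_zero (pow_ne_zero 2 hr)))
      ((Matrix.isUnit_iff_isUnit_det _).1 hu).ne_zero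
  have hcd := fun i j => (contDiffAt_flatCov hy hGc hGu hX i j).differentiableAt (by simp)
  -- antisymmetrizing the second derivative in its last two indices gives the derivative of `dX / 2`
  have h1 : (1 / 2 : ℝ) * (flatU G X y k i j - flatU G X y k j i)
      = flatCovTwo G (fun z => flatCurl X z) y k i j - G y i k * X y j + G y j k * X y i := by
    have e1 : partialDeriv k (fun z => flatCurl X z i j) y
        = (1 / 2 : ℝ) * (partialDeriv k (fun z => flatCov G X z i j) y
          - partialDeriv k (fun z => flatCov G X z j i) y) := by
      rw [partialDeriv_congr k (hFe.mono fun z hz => hz i j),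
        partialDeriv_const_mul hy k _ ((hcd i j).fun_sub (hcd j i)),
        partialDeriv_sub hy k (hcd i j) (hcd j i)]
    have e2 : ∀ a b, flatCurl X y a b = (1 / 2 : ℝ) * (flatCov G X y a b - flatCov G X y b a) :=
      hFe.self_of_nhds
    simp only [flatU, flatCovTwo, e1, e2, mul_sub, Finset.sum_sub_distrib]
    have e3 : ∀ a b : Fin n, ∑ l, flatChristoffel G y l k a * (1 / 2 * flatCov G X y l b)
        = 1 / 2 * ∑ l, flatChristoffel G y l k a * flatCov G X y l b := by
      intro a b
      rw [Finset.mul_sum]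
      exact Finset.sum_congr rfl fun l _ => by ring
    have e4 : ∀ a b : Fin n, ∑ l, flatChristoffel G y l k a * (1 / 2 * flatCov G X y b l)
        = 1 / 2 * ∑ l, flatChristoffel G y l k a * flatCov G X y b l := by
      intro a b
      rw [Finset.mul_sum]
      exact Finset.sum_congr rfl fun l _ => by ring
    simp only [e3, e4]
    ring
  have hconf := flatChristoffel_conformal hy hr hrd'
    (fun i j => (hhd i j).differentiableAt (by simp)) hu hhs.self_of_nhds hG
  have h2 : r y * ∑ l, flatChristoffel G y l k i * flatCurl X y l j
      = r y * ∑ l, flatChristoffel h y l k i * flatCurl X y l j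
        - (flatCurl X y k j * flatGrad r y i + flatCurl X y i j * flatGrad r y k
          - contr (h y)⁻¹ (flatGrad r y) (flatCurl X y) j * h y k i) := by
    rw [Finset.mul_sum]
    simp only [← mul_assoc, hconf]
    simp only [sub_mul, add_mul, Finset.sum_sub_distrib, Finset.sum_add_distrib, Matrix.one_apply,
      ite_mul, one_mul, zero_mul, Finset.sum_ite_eq', Finset.mem_univ, if_true, contr,
      mulVec, dotProduct, transpose_apply, Finset.mul_sum]
    congr 1
    · exact Finset.sum_congr rfl fun l _ => by ring
    · congr 1
      · ring
      · simp only [Finset.sum_mul]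
        exact Finset.sum_congr rfl fun l _ => Finset.sum_congr rfl fun l _ => by ring
  have hanti : ∀ a b, flatCurl X y a b = -flatCurl X y b a := fun a b => by
    have := congrFun (congrFun (flatCurl_transpose X y) b) a
    simpa using this
  have h3 : r y * ∑ l, flatChristoffel G y l k j * flatCurl X y i l
      = r y * ∑ l, flatChristoffel h y l k j * flatCurl X y i l
        - (flatCurl X y i k * flatGrad r y j + flatCurl X y i j * flatGrad r y k
          + contr (h y)⁻¹ (flatGrad r y) (flatCurl X y) i * h y k j) := by
    rw [Finset.mul_sum]
    simp only [← mul_assoc, hconf]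
    simp only [sub_mul, add_mul, Finset.sum_sub_distrib, Finset.sum_add_distrib, Matrix.one_apply,
      ite_mul, one_mul, zero_mul, Finset.sum_ite_eq', Finset.mem_univ, if_true, contr,
      mulVec, dotProduct, transpose_apply, Finset.mul_sum, hanti i]
    rw [sub_eq_add_neg, sub_eq_add_neg]
    congr 1
    · exact Finset.sum_congr rfl fun l _ => by ring
    · rw [neg_inj]
      congr 1
      · ring
      · simp only [Finset.sum_mul, ← Finset.sum_neg_distrib]
        exact Finset.sum_congr rfl fun l _ => Finset.sum_congr rfl fun l _ => by ring
  have h4 : partialDeriv k (fun z => r z ^ 2) y = 2 * r y * flatGrad r y k := by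
    simp only [sq]
    rw [partialDeriv_mul hy k hrd' hrd', flatGrad]
    ring
  have h5 : partialDeriv k (fun z => flatCurl X z i j) y
      = flatCovTwo G (fun z => flatCurl X z) y k i j
        + ∑ l, flatChristoffel G y l k i * flatCurl X y l j
        + ∑ l, flatChristoffel G y l k j * flatCurl X y i l := by
    simp only [flatCovTwo]
    ring
  have h6 : ∀ a b : Fin n, r y ^ 2 * G y a b = h y a b := by
    intro a b
    rw [hG.self_of_nhds, Matrix.smul_apply, smul_eq_mul]
    field_simp
  have h7 : contr (h y)⁻¹ (flatGrad r y) (r y ^ 2 • flatCurl X y)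
      = r y ^ 2 • contr (h y)⁻¹ (flatGrad r y) (flatCurl X y) := by
    simp only [contr, transpose_smul, smul_mulVec]
  have h8 : ∑ l, flatChristoffel h y l k i * (r y ^ 2 * flatCurl X y l j)
      = r y ^ 2 * ∑ l, flatChristoffel h y l k i * flatCurl X y l j := by
    rw [Finset.mul_sum]
    exact Finset.sum_congr rfl fun l _ => by ring
  have h9 : ∑ l, flatChristoffel h y l k j * (r y ^ 2 * flatCurl X y i l)
      = r y ^ 2 * ∑ l, flatChristoffel h y l k j * flatCurl X y i l := by
    rw [Finset.mul_sum]
    exact Finset.sum_congr rfl fun l _ => by ring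
  have hsy : ∀ a b, h y a b = h y b a := fun a b => by
    rw [← congrFun (congrFun hhs.self_of_nhds a) b, transpose_apply]
  rw [partialDeriv_mul hy k (hrd'.fun_pow 2) (hFd i j), h4, h5, h1, h8, h9]
  simp only [modelDerivTwoForm, of_apply, h7, Pi.smul_apply, Matrix.smul_apply, smul_eq_mul]
  rw [← h6 i k, ← h6 j k]
  rw [hsy k i, ← h6 i k] at h2
  rw [hsy k j, ← h6 j k, hanti i k] at h3
  linear_combination r y ^ 2 * h2 + r y ^ 2 * h3

end Equations

end Conformal

end

noncomputable section

/-! ### Uniform estimates on compact sets of coordinates -/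

section CompactBounds

variable {n : ℕ}

/-- A positive function, homogeneous of degree two in its second variable, is bounded below by a
multiple of the square of the norm, uniformly on compact sets. -/
lemma exists_lower_bound_of_homogeneous {V Z : Type*} [TopologicalSpace V]
    [NormedAddCommGroup Z] [NormedSpace ℝ Z] [FiniteDimensional ℝ Z] {K : Set V} (hK : IsCompact K)
    {N : V → Z → ℝ} (hN : ContinuousOn (Function.uncurry N) (K ×ˢ univ))
    (hhom : ∀ v ∈ K, ∀ (a : ℝ) z, N v (a • z) = a ^ 2 * N v z)
    (hpos : ∀ v ∈ K, ∀ z, z ≠ 0 → 0 < N v z) :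
    ∃ κ : ℝ, 0 < κ ∧ ∀ v ∈ K, ∀ z, κ * ‖z‖ ^ 2 ≤ N v z := by
  have : ProperSpace Z := FiniteDimensional.proper_real Z
  have hcomp : IsCompact (K ×ˢ Metric.sphere (0 : Z) 1) := hK.prod (isCompact_sphere 0 1)
  obtain ⟨κ, hκ, hκb⟩ : ∃ κ : ℝ, 0 < κ ∧ ∀ q ∈ K ×ˢ Metric.sphere (0 : Z) 1,
      κ ≤ Function.uncurry N q := by
    rcases (K ×ˢ Metric.sphere (0 : Z) 1).eq_empty_or_nonempty with h | h
    · exact ⟨1, one_pos, by simp [h]⟩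
    · obtain ⟨q, hq, hmin⟩ := hcomp.exists_isMinOn h
        (hN.mono (prod_mono_right (subset_univ _)))
      refine ⟨Function.uncurry N q, ?_, fun q' hq' => hmin hq'⟩
      refine hpos q.1 hq.1 q.2 ?_
      intro h0
      have := mem_sphere_zero_iff_norm.1 hq.2
      simp [h0] at this
  refine ⟨κ, hκ, fun v hv z => ?_⟩
  have h0 : N v 0 = 0 := by
    have := hhom v hv 0 0
    simpa using this
  by_cases hz : z = 0
  · simp [hz, h0]
  · have hz' : ‖z‖ ≠ 0 := norm_ne_zero_iff.2 hz
    have h1 := hκb (v, ‖z‖⁻¹ • z) ⟨hv, by simp [norm_smul, hz']⟩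
    have h2 := hhom v hv ‖z‖ (‖z‖⁻¹ • z)
    rw [smul_smul, mul_inv_cancel₀ hz', one_smul] at h2
    rw [h2]
    simp only [Function.uncurry] at h1
    nlinarith [sq_nonneg ‖z‖]

lemma normSq₁_smul (G : Matrix (Fin n) (Fin n) ℝ) (a : ℝ) (T : Fin n → ℝ) :
    normSq₁ G (a • T) = a ^ 2 * normSq₁ G T := by
  simp only [normSq₁, Pi.smul_apply, smul_eq_mul, Finset.mul_sum]
  exact Finset.sum_congr rfl fun i _ => Finset.sum_congr rfl fun j _ => by ring

lemma normSq₂_smul (G : Matrix (Fin n) (Fin n) ℝ) (a : ℝ) (T : Fin n → Fin n → ℝ) :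
    normSq₂ G (a • T) = a ^ 2 * normSq₂ G T := by
  simp only [normSq₂, Pi.smul_apply, smul_eq_mul, Finset.mul_sum]
  exact Finset.sum_congr rfl fun i _ => Finset.sum_congr rfl fun j _ =>
    Finset.sum_congr rfl fun i _ => Finset.sum_congr rfl fun j _ => by ring

lemma normSq₃_smul (G : Matrix (Fin n) (Fin n) ℝ) (a : ℝ) (T : Fin n → Fin n → Fin n → ℝ) :
    normSq₃ G (a • T) = a ^ 2 * normSq₃ G T := by
  simp only [normSq₃, Pi.smul_apply, smul_eq_mul, Finset.mul_sum]
  exact Finset.sum_congr rfl fun i _ => Finset.sum_congr rfl fun j _ =>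
    Finset.sum_congr rfl fun i _ => Finset.sum_congr rfl fun j _ =>
    Finset.sum_congr rfl fun i _ => Finset.sum_congr rfl fun j _ => by ring

lemma inv_conformal {h : Matrix (Fin n) (Fin n) ℝ} {ρ : ℝ} (hρ : ρ ≠ 0) (hu : IsUnit h) :
    ((ρ ^ 2)⁻¹ • h)⁻¹ = ρ ^ 2 • h⁻¹ := by
  have : Invertible ((ρ ^ 2)⁻¹ : ℝ) := invertibleOfNonzero (inv_ne_zero (pow_ne_zero 2 hρ))
  rw [Matrix.inv_smul _ _ ((Matrix.isUnit_iff_isUnit_det _).1 hu)]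
  congr 1
  simp

/-- The norm of a covariant tensor of rank `k` with respect to `ρ⁻² h` is the norm of `ρᵏ` times the
tensor with respect to `h`. -/
lemma normSq₁_conformal {h : Matrix (Fin n) (Fin n) ℝ} {ρ : ℝ} (hρ : ρ ≠ 0) (hu : IsUnit h)
    (T : Fin n → ℝ) : normSq₁ ((ρ ^ 2)⁻¹ • h) T = normSq₁ h (ρ • T) := by
  rw [normSq₁_smul]
  simp only [normSq₁, inv_conformal hρ hu, Matrix.smul_apply, smul_eq_mul, Finset.mul_sum]
  exact Finset.sum_congr rfl fun i _ => Finset.sum_congr rfl fun j _ => by ring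

lemma normSq₂_conformal {h : Matrix (Fin n) (Fin n) ℝ} {ρ : ℝ} (hρ : ρ ≠ 0) (hu : IsUnit h)
    (T : Fin n → Fin n → ℝ) : normSq₂ ((ρ ^ 2)⁻¹ • h) T = normSq₂ h (ρ ^ 2 • T) := by
  rw [normSq₂_smul]
  simp only [normSq₂, inv_conformal hρ hu, Matrix.smul_apply, smul_eq_mul, Finset.mul_sum]
  exact Finset.sum_congr rfl fun i _ => Finset.sum_congr rfl fun j _ =>
    Finset.sum_congr rfl fun i _ => Finset.sum_congr rfl fun j _ => by ring

lemma normSq₃_conformal {h : Matrix (Fin n) (Fin n) ℝ} {ρ : ℝ} (hρ : ρ ≠ 0) (hu : IsUnit h)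
    (T : Fin n → Fin n → Fin n → ℝ) : normSq₃ ((ρ ^ 2)⁻¹ • h) T = normSq₃ h (ρ ^ 3 • T) := by
  rw [normSq₃_smul]
  simp only [normSq₃, inv_conformal hρ hu, Matrix.smul_apply, smul_eq_mul, Finset.mul_sum]
  exact Finset.sum_congr rfl fun i _ => Finset.sum_congr rfl fun j _ =>
    Finset.sum_congr rfl fun i _ => Finset.sum_congr rfl fun j _ =>
    Finset.sum_congr rfl fun i _ => Finset.sum_congr rfl fun j _ => by ring

lemma normSq₂_add_le {G : Matrix (Fin n) (Fin n) ℝ} (hG : G.PosDef) (S T : Fin n → Fin n → ℝ) :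
    normSq₂ G (fun i j => S i j + T i j) ≤ 2 * normSq₂ G S + 2 * normSq₂ G T := by
  obtain ⟨B, -, h⟩ := exists_frame hG
  have hlin : ∀ a b, pull₂ B (fun i j => S i j + T i j) a b = pull₂ B S a b + pull₂ B T a b := by
    intro a b
    simp only [pull₂, pull₁, mul_add, Finset.sum_add_distrib]
  rw [normSq₂_eq_of_frame h, normSq₂_eq_of_frame h, normSq₂_eq_of_frame h]
  simp only [Finset.mul_sum, ← Finset.sum_add_distrib, hlin]
  exact Finset.sum_le_sum fun a _ => Finset.sum_le_sum fun b _ => by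
    nlinarith [sq_nonneg (pull₂ B S a b - pull₂ B T a b)]

section

variable {V : Type*} [TopologicalSpace V] {K : Set V} {h : V → Matrix (Fin n) (Fin n) ℝ}
  (hK : IsCompact K) (hc : ∀ i j, ContinuousOn (fun y => (h y)⁻¹ i j) K)
  (hp : ∀ y ∈ K, (h y).PosDef)

include hK hc hp

lemma exists_normSq₁_lower_bound :
    ∃ κ : ℝ, 0 < κ ∧ ∀ y ∈ K, ∀ T : Fin n → ℝ, κ * ‖T‖ ^ 2 ≤ normSq₁ (h y) T := by
  refine exists_lower_bound_of_homogeneous hK (N := fun y T => normSq₁ (h y) T) ?_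
    (fun v _ a z => normSq₁_smul _ _ _) (fun v hv z hz => normSq₁_pos (hp v hv) hz)
  have h1 : ∀ i j, ContinuousOn (fun q : V × (Fin n → ℝ) => (h q.1)⁻¹ i j) (K ×ˢ univ) :=
    fun i j => (hc i j).comp continuousOn_fst fun q hq => hq.1
  have h2 : ∀ i, Continuous (fun q : V × (Fin n → ℝ) => q.2 i) := fun i => by fun_prop
  simp only [normSq₁, Function.uncurry_def]
  exact continuousOn_finsetSum _ fun i _ => continuousOn_finsetSum _ fun j _ =>
    ((h1 i j).fun_mul (h2 i).continuousOn).fun_mul (h2 j).continuousOn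

lemma exists_normSq₂_lower_bound :
    ∃ κ : ℝ, 0 < κ ∧ ∀ y ∈ K, ∀ T : Fin n → Fin n → ℝ, κ * ‖T‖ ^ 2 ≤ normSq₂ (h y) T := by
  refine exists_lower_bound_of_homogeneous hK (N := fun y T => normSq₂ (h y) T) ?_
    (fun v _ a z => normSq₂_smul _ _ _) (fun v hv z hz => normSq₂_pos (hp v hv) hz)
  have h1 : ∀ i j, ContinuousOn (fun q : V × (Fin n → Fin n → ℝ) => (h q.1)⁻¹ i j) (K ×ˢ univ) :=
    fun i j => (hc i j).comp continuousOn_fst fun q hq => hq.1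
  have h2 : ∀ i j, Continuous (fun q : V × (Fin n → Fin n → ℝ) => q.2 i j) :=
    fun i j => by fun_prop
  simp only [normSq₂, Function.uncurry_def]
  exact continuousOn_finsetSum _ fun i _ => continuousOn_finsetSum _ fun i' _ =>
    continuousOn_finsetSum _ fun j _ => continuousOn_finsetSum _ fun j' _ =>
    (((h1 i i').fun_mul (h1 j j')).fun_mul (h2 i j).continuousOn).fun_mul (h2 i' j').continuousOn

lemma exists_normSq₃_lower_bound :
    ∃ κ : ℝ, 0 < κ ∧ ∀ y ∈ K, ∀ T : Fin n → Fin n → Fin n → ℝ,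
      κ * ‖T‖ ^ 2 ≤ normSq₃ (h y) T := by
  refine exists_lower_bound_of_homogeneous hK (N := fun y T => normSq₃ (h y) T) ?_
    (fun v _ a z => normSq₃_smul _ _ _) (fun v hv z hz => normSq₃_pos (hp v hv) hz)
  have h1 : ∀ i j, ContinuousOn (fun q : V × (Fin n → Fin n → Fin n → ℝ) => (h q.1)⁻¹ i j)
      (K ×ˢ univ) := fun i j => (hc i j).comp continuousOn_fst fun q hq => hq.1
  have h2 : ∀ i j k, Continuous (fun q : V × (Fin n → Fin n → Fin n → ℝ) => q.2 i j k) :=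
    fun i j k => by fun_prop
  simp only [normSq₃, Function.uncurry_def]
  exact continuousOn_finsetSum _ fun i _ => continuousOn_finsetSum _ fun i' _ =>
    continuousOn_finsetSum _ fun j _ => continuousOn_finsetSum _ fun j' _ =>
    continuousOn_finsetSum _ fun k _ => continuousOn_finsetSum _ fun k' _ =>
    ((((h1 i i').fun_mul (h1 j j')).fun_mul (h1 k k')).fun_mul (h2 i j k).continuousOn).fun_mul
      (h2 i' j' k').continuousOn

end

end CompactBounds

/-! ### The current as a bilinear form with smooth coefficients -/

section CurrentBilinear

open Matrix

variable {n : ℕ}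

/-- The index set of the components of a pair of a 1-form and a 2-tensor. -/
abbrev PairIndex (n : ℕ) := Fin n ⊕ Fin n × Fin n

/-- The 1-form part of a pair. -/
def pairForm (z : PairIndex n → ℝ) (i : Fin n) : ℝ := z (Sum.inl i)

/-- The 2-tensor part of a pair. -/
def pairTensor (z : PairIndex n → ℝ) : Matrix (Fin n) (Fin n) ℝ :=
  Matrix.of fun i j => z (Sum.inr (i, j))

/-- The pair consisting of a 1-form and a 2-tensor. -/
def mkPair (x : Fin n → ℝ) (f : Matrix (Fin n) (Fin n) ℝ) : PairIndex n → ℝ :=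
  Sum.elim x fun q => f q.1 q.2

variable (H : Matrix (Fin n) (Fin n) ℝ) (ν : Fin n → ℝ)

/-- A component of the current as a bilinear form. -/
def currentBilin (k : Fin n) : (PairIndex n → ℝ) →ₗ[ℝ] (PairIndex n → ℝ) →ₗ[ℝ] ℝ :=
  LinearMap.mk₂ ℝ
    (fun z z' => current H ν (pairForm z) (pairTensor z) (pairForm z') (pairTensor z') k)
    (by
      intro a b c
      have h1 : pairForm (a + b) = pairForm a + pairForm b := rfl
      have h2 : pairTensor (a + b) = pairTensor a + pairTensor b := rfl
      simp only [h1, h2, current, currentScalar, contr, transpose_add, add_mulVec, mulVec_add,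
        add_dotProduct, sub_dotProduct, dotProduct_sub, Pi.add_apply,
        Pi.smul_apply, smul_eq_mul, mulVec_sub]
      ring)
    (by
      intro c a b
      have h1 : pairForm (c • a) = c • pairForm a := rfl
      have h2 : pairTensor (c • a) = c • pairTensor a := rfl
      simp only [h1, h2, current, currentScalar, contr, transpose_smul, smul_mulVec, mulVec_smul,
        smul_dotProduct, sub_dotProduct, dotProduct_sub, Pi.add_apply,
        Pi.smul_apply, smul_eq_mul, mulVec_sub]
      ring)
    (by
      intro a b c
      have h1 : pairForm (b + c) = pairForm b + pairForm c := rfl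
      have h2 : pairTensor (b + c) = pairTensor b + pairTensor c := rfl
      simp only [h1, h2, current, currentScalar, contr, transpose_add, add_mulVec, mulVec_add,
        add_dotProduct, sub_dotProduct, dotProduct_add, dotProduct_sub, Pi.add_apply,
        Pi.smul_apply, smul_eq_mul, mulVec_sub]
      ring)
    (by
      intro c a b
      have h1 : pairForm (c • b) = c • pairForm b := rfl
      have h2 : pairTensor (c • b) = c • pairTensor b := rfl
      simp only [h1, h2, current, currentScalar, contr, transpose_smul, smul_mulVec, mulVec_smul,
        smul_dotProduct, sub_dotProduct, dotProduct_smul, dotProduct_sub, Pi.add_apply,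
        Pi.smul_apply, smul_eq_mul, mulVec_sub]
      ring)

/-- The coefficients of a component of the current as a quadratic form. -/
def currentCoeff (k : Fin n) (α β : PairIndex n) : ℝ :=
  currentBilin H ν k (Pi.single α 1) (Pi.single β 1)

lemma current_eq_sum (k : Fin n) (x : Fin n → ℝ) (f : Matrix (Fin n) (Fin n) ℝ)
    (x' : Fin n → ℝ) (f' : Matrix (Fin n) (Fin n) ℝ) :
    current H ν x f x' f' k
      = ∑ α, ∑ β, currentCoeff H ν k α β * (mkPair x f α * mkPair x' f' β) := by
  have h1 : current H ν x f x' f' k = currentBilin H ν k (mkPair x f) (mkPair x' f') := rfl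
  have h2 : ∀ z : PairIndex n → ℝ, z = ∑ α, z α • Pi.single α (1 : ℝ) := fun z => by
    funext β
    simp [Finset.sum_apply, Pi.single_apply]
  rw [h1]
  conv_lhs => rw [h2 (mkPair x f), h2 (mkPair x' f')]
  simp only [map_sum, LinearMap.sum_apply, map_smul, LinearMap.smul_apply, smul_eq_mul]
  simp only [Finset.mul_sum]
  rw [Finset.sum_comm]
  exact Finset.sum_congr rfl fun α _ => Finset.sum_congr rfl fun β _ => by
    unfold currentCoeff
    ring

section Smooth

variable {V : Type*} [NormedAddCommGroup V] [NormedSpace ℝ V] {s : Set V} {y : V}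

lemma contDiffWithinAt_dotProduct {u v : V → Fin n → ℝ}
    (hu : ∀ i, ContDiffWithinAt ℝ ∞ (fun z => u z i) s y)
    (hv : ∀ i, ContDiffWithinAt ℝ ∞ (fun z => v z i) s y) :
    ContDiffWithinAt ℝ ∞ (fun z => u z ⬝ᵥ v z) s y :=
  ContDiffWithinAt.sum fun i _ => (hu i).mul (hv i)

lemma contDiffWithinAt_mulVec {A : V → Matrix (Fin n) (Fin n) ℝ} {v : V → Fin n → ℝ}
    (hA : ∀ i j, ContDiffWithinAt ℝ ∞ (fun z => A z i j) s y)
    (hv : ∀ i, ContDiffWithinAt ℝ ∞ (fun z => v z i) s y) (i : Fin n) :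
    ContDiffWithinAt ℝ ∞ (fun z => (A z *ᵥ v z) i) s y :=
  contDiffWithinAt_dotProduct (hA i) hv

lemma contDiffWithinAt_current {H : V → Matrix (Fin n) (Fin n) ℝ} {ν : V → Fin n → ℝ}
    {x x' : V → Fin n → ℝ} {f f' : V → Matrix (Fin n) (Fin n) ℝ}
    (hH : ∀ i j, ContDiffWithinAt ℝ ∞ (fun z => H z i j) s y)
    (hν : ∀ i, ContDiffWithinAt ℝ ∞ (fun z => ν z i) s y)
    (hx : ∀ i, ContDiffWithinAt ℝ ∞ (fun z => x z i) s y)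
    (hx' : ∀ i, ContDiffWithinAt ℝ ∞ (fun z => x' z i) s y)
    (hf : ∀ i j, ContDiffWithinAt ℝ ∞ (fun z => f z i j) s y)
    (hf' : ∀ i j, ContDiffWithinAt ℝ ∞ (fun z => f' z i j) s y) (k : Fin n) :
    ContDiffWithinAt ℝ ∞ (fun z => current (H z) (ν z) (x z) (f z) (x' z) (f' z) k) s y := by
  have c1 := contDiffWithinAt_mulVec hH hν
  have c2 := contDiffWithinAt_mulVec hH hx'
  have c3 : ∀ i, ContDiffWithinAt ℝ ∞ (fun z => contr (H z) (ν z) (f z) i) s y :=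
    contDiffWithinAt_mulVec (A := fun z => (f z)ᵀ) (fun i j => hf j i) c1
  have c4 : ∀ i, ContDiffWithinAt ℝ ∞ (fun z => contr (H z) (ν z) (f' z) i) s y :=
    contDiffWithinAt_mulVec (A := fun z => (f' z)ᵀ) (fun i j => hf' j i) c1
  have c5 := contDiffWithinAt_dotProduct hν c1
  have c6 := contDiffWithinAt_dotProduct hx c1
  have c7 := contDiffWithinAt_dotProduct hx' c1
  have c8 := contDiffWithinAt_mulVec hH (v := fun z => x' z - contr (H z) (ν z) (f' z))
    (fun i => (hx' i).sub (c4 i))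
  have c9 := contDiffWithinAt_dotProduct (u := fun z => x z - contr (H z) (ν z) (f z))
    (fun i => (hx i).sub (c3 i)) c8
  have c10 := contDiffWithinAt_dotProduct c3 c2
  have c11 := contDiffWithinAt_mulVec hH (contDiffWithinAt_mulVec hf c2)
  have c12 : ContDiffWithinAt ℝ ∞
      (fun z => currentScalar (H z) (ν z) (x z) (f z) (x' z) (f' z)) s y :=
    (((c5.mul c9).neg).sub ((contDiffWithinAt_const.mul c6).mul c7)).sub c10
  exact ((c12.mul (c1 k)).add (((contDiffWithinAt_const.mul c5).mul c6).mul (c2 k))).add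
    (c5.mul (c11 k))

end Smooth

end CurrentBilinear

end

noncomputable section

/-! ### The divergence of the current near infinity, in coordinates -/

section ErrorEstimate

/-- If the components `z_α` satisfy `ρ ∂ₖ z_α = L_kα + E_kα`, the derivatives of a quadratic
expression in `z` differ from those prescribed by `L` by a controlled error. -/
lemma abs_sum_quadratic_sub_le {κ ι : Type*} [Fintype κ] [Fintype ι] (C C' : κ → ι → ι → ℝ)
    (z : ι → ℝ) (L E : κ → ι → ℝ) {ρ m Z B : ℝ} (hρ : 0 ≤ ρ)
    (hC : ∀ k α β, |C k α β| ≤ m) (hC' : ∀ k α β, |C' k α β| ≤ m) (hz : ∀ α, |z α| ≤ Z)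
    (hE : ∀ k α, |E k α| ≤ B) (hm : 0 ≤ m) (hZ : 0 ≤ Z) :
    |∑ k, ∑ α, ∑ β, (ρ * C' k α β * (z α * z β)
        + C k α β * ((L k α + E k α) * z β + z α * (L k β + E k β)))
      - ∑ k, ∑ α, ∑ β, C k α β * (L k α * z β + z α * L k β)|
    ≤ Fintype.card κ * (Fintype.card ι) ^ 2 * (ρ * m * Z ^ 2 + 2 * m * B * Z) := by
  simp only [← Finset.sum_sub_distrib]
  have key : ∀ k α β, |ρ * C' k α β * (z α * z β)
        + C k α β * ((L k α + E k α) * z β + z α * (L k β + E k β))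
        - C k α β * (L k α * z β + z α * L k β)| ≤ ρ * m * Z ^ 2 + 2 * m * B * Z := by
    intro k α β
    have e : ρ * C' k α β * (z α * z β)
        + C k α β * ((L k α + E k α) * z β + z α * (L k β + E k β))
        - C k α β * (L k α * z β + z α * L k β)
        = ρ * C' k α β * (z α * z β) + (C k α β * (E k α * z β) + C k α β * (z α * E k β)) := by
      ring
    rw [e]
    have hB : 0 ≤ B := (abs_nonneg _).trans (hE k α)
    have h1 : |ρ * C' k α β * (z α * z β)| ≤ ρ * m * (Z * Z) := by
      rw [abs_mul, abs_mul, abs_of_nonneg hρ, abs_mul]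
      exact mul_le_mul (mul_le_mul_of_nonneg_left (hC' k α β) hρ)
        (mul_le_mul (hz α) (hz β) (abs_nonneg _) hZ) (by positivity) (by positivity)
    have h2 : |C k α β * (E k α * z β)| ≤ m * (B * Z) := by
      rw [abs_mul, abs_mul]
      exact mul_le_mul (hC k α β) (mul_le_mul (hE k α) (hz β) (abs_nonneg _) hB)
        (by positivity) hm
    have h3 : |C k α β * (z α * E k β)| ≤ m * (Z * B) := by
      rw [abs_mul, abs_mul]
      exact mul_le_mul (hC k α β) (mul_le_mul (hz α) (hE k β) (abs_nonneg _) hZ)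
        (by positivity) hm
    calc _ ≤ ρ * m * (Z * Z) + (m * (B * Z) + m * (Z * B)) :=
          (abs_add_le _ _).trans (add_le_add h1 ((abs_add_le _ _).trans (add_le_add h2 h3)))
      _ = _ := by ring
  refine (Finset.abs_sum_le_sum_abs _ _).trans ?_
  calc ∑ k, |∑ α, ∑ β, _| ≤ ∑ _k : κ, ∑ _α : ι, ∑ _β : ι, (ρ * m * Z ^ 2 + 2 * m * B * Z) := by
        refine Finset.sum_le_sum fun k _ => ?_
        refine (Finset.abs_sum_le_sum_abs _ _).trans (Finset.sum_le_sum fun α _ => ?_)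
        exact (Finset.abs_sum_le_sum_abs _ _).trans (Finset.sum_le_sum fun β _ => key k α β)
    _ = _ := by
        simp only [Finset.sum_const, Finset.card_univ, nsmul_eq_mul]
        ring

end ErrorEstimate

open Matrix

variable {n : ℕ} [NeZero n]

section Regularity

variable {O : Set (EuclideanSpace ℝ (Fin n))}

lemma uniqueDiffOn_inter_range (hO : IsOpen O) :
    UniqueDiffOn ℝ (O ∩ range (𝓡∂ n)) := by
  rw [inter_comm]
  exact (𝓡∂ n).uniqueDiffOn.inter hO

lemma contDiffOn_partialDeriv (hO : IsOpen O) {f : EuclideanSpace ℝ (Fin n) → ℝ}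
    (hf : ContDiffOn ℝ ∞ f (O ∩ range (𝓡∂ n))) (k : Fin n) :
    ContDiffOn ℝ ∞ (fun z => partialDeriv k f z) (O ∩ range (𝓡∂ n)) := by
  have h1 : ContDiffOn ℝ ∞ (fderivWithin ℝ f (O ∩ range (𝓡∂ n))) (O ∩ range (𝓡∂ n)) :=
    hf.fderivWithin (uniqueDiffOn_inter_range hO) (by simp)
  refine (h1.clm_apply (contDiffOn_const (c := EuclideanSpace.single k (1 : ℝ)))).congr
    fun z hz => ?_
  rw [partialDeriv, inter_comm, fderivWithin_inter (hO.mem_nhds hz.1)]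

variable {h : EuclideanSpace ℝ (Fin n) → Matrix (Fin n) (Fin n) ℝ}
  {r : EuclideanSpace ℝ (Fin n) → ℝ}

lemma contDiffOn_flatChristoffel (hO : IsOpen O)
    (hh : ∀ i j, ContDiffOn ℝ ∞ (fun z => h z i j) (O ∩ range (𝓡∂ n)))
    (hp : ∀ y ∈ O ∩ range (𝓡∂ n), (h y).PosDef) (k i j : Fin n) :
    ContDiffOn ℝ ∞ (fun z => flatChristoffel h z k i j) (O ∩ range (𝓡∂ n)) := by
  refine contDiffOn_const.mul (ContDiffOn.sum fun l _ => ContDiffOn.mul ?_ ?_)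
  · exact fun z hz => contDiffWithinAt_inv_matrix (fun a b => hh a b z hz) (hp z hz).isUnit k l
  · exact ((contDiffOn_partialDeriv hO (hh j l) i).add
      (contDiffOn_partialDeriv hO (hh i l) j)).sub (contDiffOn_partialDeriv hO (hh i j) l)

lemma contDiffOn_flatGrad (hO : IsOpen O) (hr : ContDiffOn ℝ ∞ r (O ∩ range (𝓡∂ n)))
    (k : Fin n) : ContDiffOn ℝ ∞ (fun z => flatGrad r z k) (O ∩ range (𝓡∂ n)) :=
  contDiffOn_partialDeriv hO hr k

lemma contDiffOn_inv_matrix (hh : ∀ i j, ContDiffOn ℝ ∞ (fun z => h z i j) (O ∩ range (𝓡∂ n)))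
    (hp : ∀ y ∈ O ∩ range (𝓡∂ n), (h y).PosDef) (i j : Fin n) :
    ContDiffOn ℝ ∞ (fun z => (h z)⁻¹ i j) (O ∩ range (𝓡∂ n)) :=
  fun z hz => contDiffWithinAt_inv_matrix (fun a b => hh a b z hz) (hp z hz).isUnit i j

lemma contDiffOn_sqrt_det (hh : ∀ i j, ContDiffOn ℝ ∞ (fun z => h z i j) (O ∩ range (𝓡∂ n)))
    (hp : ∀ y ∈ O ∩ range (𝓡∂ n), (h y).PosDef) :
    ContDiffOn ℝ ∞ (fun z => Real.sqrt (h z).det) (O ∩ range (𝓡∂ n)) :=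
  fun z hz => (contDiffWithinAt_det fun a b => hh a b z hz).sqrt (hp z hz).det_pos.ne'

/-- The coefficients of the current density as a quadratic form in the rescaled pair. -/
def densityCoeff (h : EuclideanSpace ℝ (Fin n) → Matrix (Fin n) (Fin n) ℝ)
    (r : EuclideanSpace ℝ (Fin n) → ℝ) (k : Fin n) (α β : PairIndex n)
    (z : EuclideanSpace ℝ (Fin n)) : ℝ :=
  Real.sqrt (h z).det * currentCoeff (h z)⁻¹ (flatGrad r z) k α β

lemma contDiffOn_densityCoeff (hO : IsOpen O)
    (hh : ∀ i j, ContDiffOn ℝ ∞ (fun z => h z i j) (O ∩ range (𝓡∂ n)))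
    (hp : ∀ y ∈ O ∩ range (𝓡∂ n), (h y).PosDef)
    (hr : ContDiffOn ℝ ∞ r (O ∩ range (𝓡∂ n))) (k : Fin n) (α β : PairIndex n) :
    ContDiffOn ℝ ∞ (densityCoeff h r k α β) (O ∩ range (𝓡∂ n)) :=
  (contDiffOn_sqrt_det hh hp).mul fun z hz =>
    contDiffWithinAt_current (x := fun _ => pairForm (Pi.single α 1))
      (x' := fun _ => pairForm (Pi.single β 1)) (f := fun _ => pairTensor (Pi.single α 1))
      (f' := fun _ => pairTensor (Pi.single β 1)) (fun i j => contDiffOn_inv_matrix hh hp i j z hz)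
      (fun i => contDiffOn_flatGrad hO hr i z hz) (fun _ => contDiffWithinAt_const)
      (fun _ => contDiffWithinAt_const) (fun _ _ => contDiffWithinAt_const)
      (fun _ _ => contDiffWithinAt_const) k

end Regularity

/-- The rescaled pair `(ρ X, ρ² dX / 2)`, which obeys a regular first order system. -/
def scaledPair (r : EuclideanSpace ℝ (Fin n) → ℝ) (X : EuclideanSpace ℝ (Fin n) → Fin n → ℝ)
    (z : EuclideanSpace ℝ (Fin n)) : PairIndex n → ℝ :=
  mkPair (r z • X z) (r z ^ 2 • flatCurl X z)

/-- The current of the rescaled pair, as a vector density. -/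
def currentDensity (h : EuclideanSpace ℝ (Fin n) → Matrix (Fin n) (Fin n) ℝ)
    (r : EuclideanSpace ℝ (Fin n) → ℝ) (X : EuclideanSpace ℝ (Fin n) → Fin n → ℝ)
    (z : EuclideanSpace ℝ (Fin n)) (k : Fin n) : ℝ :=
  Real.sqrt (h z).det * current (h z)⁻¹ (flatGrad r z) (r z • X z) (r z ^ 2 • flatCurl X z)
    (r z • X z) (r z ^ 2 • flatCurl X z) k

section Divergence

variable {h G : EuclideanSpace ℝ (Fin n) → Matrix (Fin n) (Fin n) ℝ}
  {r : EuclideanSpace ℝ (Fin n) → ℝ} {X : EuclideanSpace ℝ (Fin n) → Fin n → ℝ}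
  {y : EuclideanSpace ℝ (Fin n)}

lemma currentDensity_eq_sum (z : EuclideanSpace ℝ (Fin n)) (k : Fin n) :
    currentDensity h r X z k = ∑ α, ∑ β, densityCoeff h r k α β z
      * (scaledPair r X z α * scaledPair r X z β) := by
  rw [currentDensity, current_eq_sum, Finset.mul_sum]
  refine Finset.sum_congr rfl fun α _ => ?_
  rw [Finset.mul_sum]
  exact Finset.sum_congr rfl fun β _ => by rw [densityCoeff, scaledPair, mul_assoc]

lemma contDiffAt_scaledPair (hy : y ∈ openHalf n) (hrd : ContDiffAt ℝ ∞ r y)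
    (hX : ∀ i, ContDiffAt ℝ ∞ (fun z => X z i) y) (α : PairIndex n) :
    ContDiffAt ℝ ∞ (fun z => scaledPair r X z α) y := by
  rcases α with i | ⟨i, j⟩
  · exact hrd.mul (hX i)
  · exact (hrd.pow 2).mul (contDiffAt_flatCurl hy hX i j)

lemma contDiffAt_currentDensity (hy : y ∈ openHalf n) (hrd : ContDiffAt ℝ ∞ r y)
    (hX : ∀ i, ContDiffAt ℝ ∞ (fun z => X z i) y)
    (hc : ∀ k α β, ContDiffAt ℝ ∞ (densityCoeff h r k α β) y) (k : Fin n) :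
    ContDiffAt ℝ ∞ (fun z => currentDensity h r X z k) y := by
  simp only [currentDensity_eq_sum]
  exact ContDiffAt.sum fun α _ => ContDiffAt.sum fun β _ => (hc k α β).mul
    ((contDiffAt_scaledPair hy hrd hX α).mul (contDiffAt_scaledPair hy hrd hX β))

lemma partialDeriv_currentDensity (hy : y ∈ openHalf n) (hrd : ContDiffAt ℝ ∞ r y)
    (hX : ∀ i, ContDiffAt ℝ ∞ (fun z => X z i) y)
    (hc : ∀ k α β, ContDiffAt ℝ ∞ (densityCoeff h r k α β) y) (k : Fin n) (a : ℝ) :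
    a * partialDeriv k (fun z => currentDensity h r X z k) y
      = ∑ α, ∑ β, (a * partialDeriv k (densityCoeff h r k α β) y
          * (scaledPair r X y α * scaledPair r X y β)
        + densityCoeff h r k α β y
          * ((a * partialDeriv k (fun z => scaledPair r X z α) y) * scaledPair r X y β
            + scaledPair r X y α * (a * partialDeriv k (fun z => scaledPair r X z β) y))) := by
  have hz := fun α => (contDiffAt_scaledPair hy hrd hX α).differentiableAt (by simp)
  have hc' := fun k α β => (hc k α β).differentiableAt (by simp)
  simp only [currentDensity_eq_sum]
  rw [partialDeriv_sum hy _ k fun α _ => DifferentiableAt.fun_sum fun β _ =>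
    (hc' k α β).fun_mul ((hz α).fun_mul (hz β)), Finset.mul_sum]
  refine Finset.sum_congr rfl fun α _ => ?_
  rw [partialDeriv_sum hy _ k fun β _ => (hc' k α β).fun_mul ((hz α).fun_mul (hz β)),
    Finset.mul_sum]
  refine Finset.sum_congr rfl fun β _ => ?_
  rw [partialDeriv_mul hy k (hc' k α β) ((hz α).fun_mul (hz β)), partialDeriv_mul hy k (hz α) (hz β)]
  ring

end Divergence

section LocalEstimate

lemma exists_abs_le_of_isCompact {V ι : Type*} [TopologicalSpace V] [Finite ι] {K : Set V}
    (hK : IsCompact K) {F : ι → V → ℝ} (hF : ∀ i, ContinuousOn (F i) K) :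
    ∃ m : ℝ, 0 < m ∧ ∀ i, ∀ y ∈ K, |F i y| ≤ m := by
  have : Fintype ι := Fintype.ofFinite ι
  choose b hb using fun i => hK.exists_bound_of_continuousOn (hF i)
  refine ⟨∑ i, |b i| + 1, by positivity, fun i y hy => ?_⟩
  have h1 : |b i| ≤ ∑ i, |b i| := Finset.single_le_sum (fun j _ => abs_nonneg (b j)) (Finset.mem_univ i)
  have h2 := hb i y hy
  rw [Real.norm_eq_abs] at h2
  linarith [le_abs_self (b i)]

lemma exists_pos_le_of_isCompact {V : Type*} [TopologicalSpace V] {K : Set V}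
    (hK : IsCompact K) {F : V → ℝ} (hF : ContinuousOn F K) (hpos : ∀ y ∈ K, 0 < F y) :
    ∃ m : ℝ, 0 < m ∧ ∀ y ∈ K, m ≤ F y := by
  rcases K.eq_empty_or_nonempty with rfl | hne
  · exact ⟨1, one_pos, by simp⟩
  · obtain ⟨y, hy, hmin⟩ := hK.exists_isMinOn hne hF
    exact ⟨F y, hpos y hy, fun z hz => hmin hz⟩

/-- A continuous function that equals one on the zero set of `r` is close to one where `r` is
small. -/
lemma exists_abs_sub_one_le_of_isCompact {V : Type*} [TopologicalSpace V] [T2Space V] {K : Set V}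
    (hK : IsCompact K) {F r : V → ℝ} (hF : ContinuousOn F K) (hr : ContinuousOn r K)
    (h0 : ∀ y ∈ K, r y = 0 → F y = 1) {η : ℝ} (hη : 0 < η) :
    ∃ ε : ℝ, 0 < ε ∧ ∀ y ∈ K, |r y| ≤ ε → |F y - 1| ≤ η := by
  have hK' : IsCompact (K ∩ (fun y => |F y - 1|) ⁻¹' Ici η) :=
    hK.of_isClosed_subset
      ((hF.sub continuousOn_const).abs.preimage_isClosed_of_isClosed hK.isClosed isClosed_Ici)
      inter_subset_left
  obtain ⟨m, hm, hmb⟩ := exists_pos_le_of_isCompact hK' (F := fun y => |r y|)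
    (hr.abs.mono inter_subset_left) (by
      rintro y ⟨hy, hy'⟩
      rw [abs_pos]
      intro h
      have : η ≤ |F y - 1| := hy'
      rw [h0 y hy h] at this
      simp at this
      linarith)
  refine ⟨m / 2, by linarith, fun y hy hy' => ?_⟩
  by_contra hcon
  have := hmb y ⟨hy, (not_le.1 hcon).le⟩
  linarith

/-- The error terms are absorbed for small `ρ`, by Young's inequality: they are bounded by a small
multiple `t` of the energy `e` of the pair and a large multiple `C` of the energy `d` of the data.
Here `a`, `b` bound the pair and `D₁`, `D₂` the data. -/
lemma error_absorption {A m g κ t : ℝ} (hA : 0 < A) (hm : 0 < m) (hg : 0 < g) (hκ : 0 < κ)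
    (ht : 0 < t) : ∃ ε C : ℝ, 0 < ε ∧ 0 ≤ C ∧ ∀ ρ a b D₁ D₂ e d : ℝ, 0 ≤ ρ → ρ ≤ ε →
      0 ≤ a → 0 ≤ b → κ * a ^ 2 + κ * b ^ 2 ≤ e → κ * D₁ ^ 2 + κ * D₂ ^ 2 ≤ d →
      A * (ρ * m * (a + b) ^ 2 + 2 * m * (D₁ + D₂ + g * ρ * (a + b)) * (a + b))
        ≤ t * e + C * d := by
  refine ⟨t * κ / (4 * (A * m * (1 + 2 * g))), (A * m) ^ 2 / (t * κ / 4) * (2 / κ), by positivity,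
    by positivity, ?_⟩
  intro ρ a b D₁ D₂ e d hρ hρε ha hb he hd
  have hZ : (a + b) ^ 2 ≤ 2 / κ * e := by
    rw [div_mul_eq_mul_div, le_div_iff₀ hκ]
    nlinarith [mul_nonneg hκ.le (sq_nonneg (a - b))]
  have hD : (D₁ + D₂) ^ 2 ≤ 2 / κ * d := by
    rw [div_mul_eq_mul_div, le_div_iff₀ hκ]
    nlinarith [mul_nonneg hκ.le (sq_nonneg (D₁ - D₂))]
  rw [le_div_iff₀ (by positivity)] at hρε
  set θ := t * κ / 4 with hθ
  have hθ' : 0 < θ := by positivity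
  have h1 : 2 * (A * m) * (D₁ + D₂) * (a + b)
      ≤ θ * (a + b) ^ 2 + (A * m) ^ 2 / θ * (D₁ + D₂) ^ 2 := by
    have : 0 ≤ (θ * (a + b) - A * m * (D₁ + D₂)) ^ 2 / θ := by positivity
    have e1 : (θ * (a + b) - A * m * (D₁ + D₂)) ^ 2 / θ
        = θ * (a + b) ^ 2 + (A * m) ^ 2 / θ * (D₁ + D₂) ^ 2
          - 2 * (A * m) * (D₁ + D₂) * (a + b) := by
      field_simp
      ring
    linarith
  have h2 : A * m * (1 + 2 * g) * ρ * (a + b) ^ 2 ≤ θ * (a + b) ^ 2 :=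
    mul_le_mul_of_nonneg_right (by rw [hθ]; linarith) (sq_nonneg _)
  have h3 : θ * (a + b) ^ 2 ≤ t / 2 * e := by
    calc θ * (a + b) ^ 2 ≤ θ * (2 / κ * e) := mul_le_mul_of_nonneg_left hZ hθ'.le
      _ = t / 2 * e := by
        rw [hθ]
        field_simp
        ring
  have h4 : (A * m) ^ 2 / θ * (D₁ + D₂) ^ 2 ≤ (A * m) ^ 2 / θ * (2 / κ * d) :=
    mul_le_mul_of_nonneg_left hD (by positivity)
  calc _ = A * m * (1 + 2 * g) * ρ * (a + b) ^ 2 + 2 * (A * m) * (D₁ + D₂) * (a + b) := by ring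
    _ ≤ _ := by linarith

omit [NeZero n] in
lemma dotProduct_inv_mulVec (G : Matrix (Fin n) (Fin n) ℝ) (x : Fin n → ℝ) :
    x ⬝ᵥ G⁻¹ *ᵥ x = normSq₁ G x := by
  simp only [dotProduct, mulVec, normSq₁, Finset.mul_sum]
  exact Finset.sum_congr rfl fun i _ => Finset.sum_congr rfl fun j _ => by ring

variable {O K : Set (EuclideanSpace ℝ (Fin n))}
  {h : EuclideanSpace ℝ (Fin n) → Matrix (Fin n) (Fin n) ℝ} {r : EuclideanSpace ℝ (Fin n) → ℝ}

/-- The components of the rescaled pair satisfy the model system up to an error that is controlled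
by the operators `S` and `U` and by `ρ` times the pair. -/
lemma abs_scaledPair_error_le {y : EuclideanSpace ℝ (Fin n)}
    {G : EuclideanSpace ℝ (Fin n) → Matrix (Fin n) (Fin n) ℝ}
    {X : EuclideanSpace ℝ (Fin n) → Fin n → ℝ} (hy : y ∈ openHalf n) (hr : 0 < r y)
    (hrd : ContDiffAt ℝ ∞ r y)
    (hhd : ∀ i j, ContDiffAt ℝ ∞ (fun z => h z i j) y)
    (hu : IsUnit (h y)) (hhs : ∀ᶠ z in nhds y, (h z)ᵀ = h z)
    (hG : ∀ᶠ z in nhds y, G z = (r z ^ 2)⁻¹ • h z)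
    (hX : ∀ i, ContDiffAt ℝ ∞ (fun z => X z i) y) {g : ℝ} (hg : 0 ≤ g)
    (hΓ : ∀ k i j, |flatChristoffel h y k i j| ≤ g) (k : Fin n) (α : PairIndex n) :
    |r y * partialDeriv k (fun z => scaledPair r X z α) y
      - mkPair (modelDerivForm (h y)⁻¹ (h y) (flatGrad r y) (r y • X y) (r y ^ 2 • flatCurl X y) k)
          (modelDerivTwoForm (h y)⁻¹ (h y) (flatGrad r y) (r y • X y) (r y ^ 2 • flatCurl X y) k) α|
      ≤ ‖(r y ^ 2 • flatKilling G X y : Fin n → Fin n → ℝ)‖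
        + ‖(r y ^ 3 • flatU G X y : Fin n → Fin n → Fin n → ℝ)‖
        + (2 * n * g) * r y * (‖(r y • X y : Fin n → ℝ)‖
          + ‖(fun i j => r y ^ 2 * flatCurl X y i j : Fin n → Fin n → ℝ)‖) := by
  set S : Fin n → Fin n → ℝ := r y ^ 2 • flatKilling G X y with hS
  set U : Fin n → Fin n → Fin n → ℝ := r y ^ 3 • flatU G X y with hU
  set x : Fin n → ℝ := r y • X y with hx
  set f : Fin n → Fin n → ℝ := fun i j => r y ^ 2 * flatCurl X y i j with hf
  have nx : ∀ i, |x i| ≤ ‖x‖ := fun i => norm_le_pi_norm x i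
  have n2 : ∀ (T : Fin n → Fin n → ℝ) i j, |T i j| ≤ ‖T‖ := fun T i j =>
    (norm_le_pi_norm (T i) j).trans (norm_le_pi_norm T i)
  have n3 : ∀ (T : Fin n → Fin n → Fin n → ℝ) i j k, |T i j k| ≤ ‖T‖ := fun T i j k =>
    (n2 (T i) j k).trans (norm_le_pi_norm T i)
  have hsum : ∀ (Γ v : Fin n → ℝ) (b : ℝ), (∀ l, |Γ l| ≤ g) → (∀ l, |v l| ≤ b) →
      |∑ l, Γ l * v l| ≤ n * g * b := by
    intro Γ v b h1 h2
    calc |∑ l, Γ l * v l| ≤ ∑ l, |Γ l * v l| := Finset.abs_sum_le_sum_abs _ _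
      _ ≤ ∑ _l : Fin n, g * b := Finset.sum_le_sum fun l _ => by
          rw [abs_mul]
          exact mul_le_mul (h1 l) (h2 l) (abs_nonneg _) hg
      _ = n * g * b := by simp; ring
  have hn0 : (0 : ℝ) ≤ n := Nat.cast_nonneg n
  have hnx := norm_nonneg x
  have hnf := norm_nonneg f
  have hnS := norm_nonneg S
  have hnU := norm_nonneg U
  rcases α with b | ⟨i, j⟩
  · have e := scaled_form_equation hy hr.ne' hrd hhd hu hhs hG hX k b
    refine le_of_eq_of_le (congrArg abs (sub_eq_of_eq_add' e)) ?_
    have h1 : r y ^ 2 * flatKilling G X y k b = S k b := rfl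
    have h2 := hsum (fun l => flatChristoffel h y l k b) x ‖x‖ (fun l => hΓ l k b) nx
    have h3 : |r y * ∑ l, flatChristoffel h y l k b * (r y * X y l)| ≤ r y * (n * g * ‖x‖) := by
      rw [abs_mul, abs_of_pos hr]
      exact mul_le_mul_of_nonneg_left h2 hr.le
    rw [h1]
    refine (abs_add_le _ _).trans ?_
    have h4 := n2 S k b
    have h5 : 0 ≤ r y * (n * g * ‖x‖) := by positivity
    have h6 : 0 ≤ 2 * n * g * r y * ‖f‖ := by positivity
    nlinarith
  · have e := scaled_curl_equation hy hr.ne' hrd hhd hu hhs hG hX k i j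
    refine le_of_eq_of_le (congrArg abs (sub_eq_of_eq_add' e)) ?_
    have h1 : r y ^ 3 * (1 / 2 * (flatU G X y k i j - flatU G X y k j i))
        = 1 / 2 * (U k i j - U k j i) := by
      simp only [hU, Pi.smul_apply, smul_eq_mul]
      ring
    have h2 := hsum (fun l => flatChristoffel h y l k i) (fun l => f l j) ‖f‖ (fun l => hΓ l k i)
      fun l => n2 f l j
    have h3 := hsum (fun l => flatChristoffel h y l k j) (fun l => f i l) ‖f‖ (fun l => hΓ l k j)
      fun l => n2 f i l
    rw [h1]
    have h4 : |r y * (∑ l, flatChristoffel h y l k i * (r y ^ 2 * flatCurl X y l j)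
        + ∑ l, flatChristoffel h y l k j * (r y ^ 2 * flatCurl X y i l))|
        ≤ r y * (n * g * ‖f‖ + n * g * ‖f‖) := by
      rw [abs_mul, abs_of_pos hr]
      exact mul_le_mul_of_nonneg_left ((abs_add_le _ _).trans (add_le_add h2 h3)) hr.le
    have h5 : |1 / 2 * (U k i j - U k j i)| ≤ ‖U‖ := by
      have a1 := n3 U k i j
      have a2 := n3 U k j i
      rw [abs_le] at a1 a2 ⊢
      constructor <;> linarith
    refine (abs_add_le _ _).trans ?_
    have h6 : 0 ≤ 2 * n * g * r y * ‖x‖ := by positivity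
    nlinarith

set_option maxHeartbeats 1000000 in
/-- The coercivity of the divergence of the weighted current near infinity, on a compact set of
coordinates: the constant `c` depends on the weight and the dimension only, whereas `ε` and `C`
depend on the metric. -/
lemma exists_local_estimate {s : ℝ} (hs : s < 2) (hn : 3 ≤ n) : ∃ c : ℝ, 0 < c ∧
    ∀ (O K : Set (EuclideanSpace ℝ (Fin n)))
      (h : EuclideanSpace ℝ (Fin n) → Matrix (Fin n) (Fin n) ℝ) (r : EuclideanSpace ℝ (Fin n) → ℝ),
      IsOpen O → IsCompact K → K ⊆ O ∩ range (𝓡∂ n) →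
      (∀ i j, ContDiffOn ℝ ∞ (fun z => h z i j) (O ∩ range (𝓡∂ n))) →
      (∀ y ∈ O ∩ range (𝓡∂ n), (h y).PosDef) →
      ContDiffOn ℝ ∞ r (O ∩ range (𝓡∂ n)) →
      (∀ y ∈ K, r y = 0 → normSq₁ (h y) (flatGrad r y) = 1) →
      ∃ ε C : ℝ, 0 < ε ∧ 0 ≤ C ∧ ∀ y ∈ K, y ∈ openHalf n → 0 < r y → r y ≤ ε →
        ∀ (G : EuclideanSpace ℝ (Fin n) → Matrix (Fin n) (Fin n) ℝ)
          (X : EuclideanSpace ℝ (Fin n) → Fin n → ℝ),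
        (∀ᶠ z in nhds y, G z = (r z ^ 2)⁻¹ • h z) → (∀ i, ContDiffAt ℝ ∞ (fun z => X z i) y) →
        Real.sqrt (h y).det * (c * (normSq₁ (G y) (X y) + normSq₂ (G y) (flatCov G X y))
            - C * (normSq₂ (G y) (flatKilling G X y) + normSq₃ (G y) (flatU G X y)))
          ≤ ∑ k, r y * partialDeriv k (fun z => currentDensity h r X z k) y
            + (1 + 2 * s - n) * (flatGrad r y ⬝ᵥ currentDensity h r X y) := by
  obtain ⟨c, η, hc, hη, hco⟩ := exists_model_coercive hs hn
  refine ⟨c / 4, by linarith, ?_⟩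
  intro O K h r hO hK hKO hh hp hr hν
  have hKc : ∀ {F : EuclideanSpace ℝ (Fin n) → ℝ}, ContDiffOn ℝ ∞ F (O ∩ range (𝓡∂ n)) →
      ContinuousOn F K := fun hF => hF.continuousOn.mono hKO
  -- uniform bounds on `K`
  obtain ⟨m₁, hm₁, hm₁b⟩ := exists_abs_le_of_isCompact hK
    (F := fun q : Fin n × PairIndex n × PairIndex n => densityCoeff h r q.1 q.2.1 q.2.2)
    fun q => hKc (contDiffOn_densityCoeff hO hh hp hr _ _ _)
  obtain ⟨m₂, hm₂, hm₂b⟩ := exists_abs_le_of_isCompact hK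
    (F := fun q : Fin n × PairIndex n × PairIndex n =>
      partialDeriv q.1 (densityCoeff h r q.1 q.2.1 q.2.2))
    fun q => hKc (contDiffOn_partialDeriv hO (contDiffOn_densityCoeff hO hh hp hr _ _ _) _)
  obtain ⟨g, hg, hgb⟩ := exists_abs_le_of_isCompact hK
    (F := fun (q : Fin n × Fin n × Fin n) z => flatChristoffel h z q.1 q.2.1 q.2.2)
    fun q => hKc (contDiffOn_flatChristoffel hO hh hp _ _ _)
  have hHc : ∀ i j, ContinuousOn (fun y => (h y)⁻¹ i j) K := fun i j =>
    hKc (contDiffOn_inv_matrix hh hp i j)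
  have hpK : ∀ y ∈ K, (h y).PosDef := fun y hy => hp y (hKO hy)
  obtain ⟨κ₁, hκ₁, hκ₁b⟩ := exists_normSq₁_lower_bound hK hHc hpK
  obtain ⟨κ₂, hκ₂, hκ₂b⟩ := exists_normSq₂_lower_bound hK hHc hpK
  obtain ⟨κ₃, hκ₃, hκ₃b⟩ := exists_normSq₃_lower_bound hK hHc hpK
  obtain ⟨μ, hμ, hμb⟩ := exists_pos_le_of_isCompact hK (hKc (contDiffOn_sqrt_det hh hp))
    fun y hy => Real.sqrt_pos.2 (hpK y hy).det_pos
  have hlc : ContinuousOn (fun y => normSq₁ (h y) (flatGrad r y)) K := by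
    have h2 : ∀ i, ContinuousOn (fun y => flatGrad r y i) K := fun i =>
      hKc (contDiffOn_flatGrad hO hr i)
    simp only [normSq₁]
    exact continuousOn_finsetSum _ fun i _ => continuousOn_finsetSum _ fun j _ =>
      ((hHc i j).fun_mul (h2 i)).fun_mul (h2 j)
  obtain ⟨ε₁, hε₁, hε₁b⟩ := exists_abs_sub_one_le_of_isCompact hK hlc (hKc hr) hν hη
  set κ := min κ₁ (min κ₂ κ₃)
  have hκ : 0 < κ := lt_min hκ₁ (lt_min hκ₂ hκ₃)
  have hk1 : κ ≤ κ₁ := min_le_left _ _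
  have hk2 : κ ≤ κ₂ := (min_le_right _ _).trans (min_le_left _ _)
  have hk3 : κ ≤ κ₃ := (min_le_right _ _).trans (min_le_right _ _)
  set m := max m₁ m₂
  have hm : 0 < m := lt_max_of_lt_left hm₁
  have hn0 : (0 : ℝ) < n := by exact_mod_cast (by omega : 0 < n)
  have hcard : 0 < Fintype.card (PairIndex n) := by
    have : Nonempty (PairIndex n) := ⟨Sum.inl 0⟩
    exact Fintype.card_pos
  set A : ℝ := Fintype.card (Fin n) * (Fintype.card (PairIndex n)) ^ 2 with hA
  have hA0 : 0 < A := by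
    rw [hA, Fintype.card_fin]
    positivity
  obtain ⟨ε₂, C, hε₂, hC, habs⟩ := error_absorption (t := c * μ / 2) hA0 hm
    (g := 2 * n * g) (by positivity) hκ (by positivity)
  refine ⟨min ε₁ ε₂, C / μ + c / 2, lt_min hε₁ hε₂, by positivity, ?_⟩
  intro y hyK hy hr0 hrε G X hG hX
  have hnhds : O ∩ range (𝓡∂ n) ∈ nhds y :=
    Filter.inter_mem (hO.mem_nhds (hKO hyK).1) (openHalf_mem_nhds hy)
  have hcd : ∀ {F : EuclideanSpace ℝ (Fin n) → ℝ}, ContDiffOn ℝ ∞ F (O ∩ range (𝓡∂ n)) →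
      ContDiffAt ℝ ∞ F y := fun hF => hF.contDiffAt hnhds
  have hpd := hpK y hyK
  have hhs : ∀ᶠ z in nhds y, (h z)ᵀ = h z := by
    filter_upwards [hnhds] with z hz
    have := (hp z hz).1
    simpa [Matrix.IsHermitian, conjTranspose_eq_transpose_of_trivial] using this
  obtain ⟨B, -, hB⟩ := exists_frame hpd
  have hdet : IsUnit (h y).det := (Matrix.isUnit_iff_isUnit_det _).1 hpd.isUnit
  have hHs : ((h y)⁻¹)ᵀ = (h y)⁻¹ := by rw [hB, transpose_mul, transpose_transpose]
  have hGy : G y = (r y ^ 2)⁻¹ • h y := hG.self_of_nhds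
  have hGpd : (G y).PosDef := by
    rw [hGy]
    exact hpd.smul (by positivity)
  have hGs := eventually_conformal_symm hhs hG
  -- the rescaled tensors
  set v := Real.sqrt (h y).det with hv
  have hvμ : μ ≤ v := hμb y hyK
  set x : Fin n → ℝ := r y • X y with hx
  set f : Matrix (Fin n) (Fin n) ℝ := r y ^ 2 • flatCurl X y with hf
  have hfa : fᵀ = -f := by rw [hf, transpose_smul, flatCurl_transpose, smul_neg]
  set ν := flatGrad r y with hνd
  have hlam : |ν ⬝ᵥ (h y)⁻¹ *ᵥ ν - 1| ≤ η := by
    rw [dotProduct_inv_mulVec]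
    exact hε₁b y hyK (by rw [abs_of_pos hr0]; exact hrε.trans (min_le_left _ _))
  have hmodel := hco (h y)⁻¹ (h y) B ν x f (Matrix.nonsing_inv_mul _ hdet) hhs.self_of_nhds hB hfa
    hlam
  set Lx : Matrix (Fin n) (Fin n) ℝ := modelDerivForm (h y)⁻¹ (h y) ν x f with hLx
  set Lf := modelDerivTwoForm (h y)⁻¹ (h y) ν x f with hLf
  rw [dotProduct_inv_mulVec, ← normSq₂_eq_trace hHs] at hmodel
  -- the error estimate
  set S : Fin n → Fin n → ℝ := r y ^ 2 • flatKilling G X y with hS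
  set U : Fin n → Fin n → Fin n → ℝ := r y ^ 3 • flatU G X y with hU
  set f' : Fin n → Fin n → ℝ := fun i j => r y ^ 2 * flatCurl X y i j with hf'
  have hff : (f : Fin n → Fin n → ℝ) = f' := rfl
  have hzb : ∀ α, |scaledPair r X y α| ≤ ‖x‖ + ‖f'‖ := by
    rintro (i | ⟨i, j⟩)
    · exact (norm_le_pi_norm x i).trans (le_add_of_nonneg_right (norm_nonneg _))
    · exact ((norm_le_pi_norm (f' i) j).trans (norm_le_pi_norm f' i)).trans
        (le_add_of_nonneg_left (norm_nonneg _))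
  have herr := abs_sum_quadratic_sub_le (κ := Fin n) (ι := PairIndex n)
    (fun k α β => densityCoeff h r k α β y) (fun k α β => partialDeriv k (densityCoeff h r k α β) y)
    (scaledPair r X y) (fun k => mkPair (Lx k) (Lf k))
    (fun k α => r y * partialDeriv k (fun z => scaledPair r X z α) y - mkPair (Lx k) (Lf k) α)
    hr0.le (fun k α β => (hm₁b (k, α, β) y hyK).trans (le_max_left _ _))
    (fun k α β => (hm₂b (k, α, β) y hyK).trans (le_max_right _ _)) hzb
    (fun k α => abs_scaledPair_error_le hy hr0 (hcd hr) (fun i j => hcd (hh i j)) hpd.isUnit hhs hG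
      hX hg.le (fun k i j => hgb (k, i, j) y hyK) k α) hm.le
    (add_nonneg (norm_nonneg _) (norm_nonneg _))
  simp only [add_sub_cancel] at herr
  have hdiv : ∑ k, r y * partialDeriv k (fun z => currentDensity h r X z k) y
      = ∑ k, ∑ α, ∑ β, (r y * partialDeriv k (densityCoeff h r k α β) y
          * (scaledPair r X y α * scaledPair r X y β)
        + densityCoeff h r k α β y
          * ((r y * partialDeriv k (fun z => scaledPair r X z α) y) * scaledPair r X y β
            + scaledPair r X y α * (r y * partialDeriv k (fun z => scaledPair r X z β) y))) :=
    Finset.sum_congr rfl fun k _ => partialDeriv_currentDensity hy (hcd hr) hX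
      (fun k α β => hcd (contDiffOn_densityCoeff hO hh hp hr k α β)) k _
  have hmod : ∑ k, ∑ α, ∑ β, densityCoeff h r k α β y
        * (mkPair (Lx k) (Lf k) α * scaledPair r X y β
          + scaledPair r X y α * mkPair (Lx k) (Lf k) β)
      = v * ∑ k, (current (h y)⁻¹ ν (Lx k) (Lf k) x f k + current (h y)⁻¹ ν x f (Lx k) (Lf k) k) := by
    rw [Finset.mul_sum]
    refine Finset.sum_congr rfl fun k _ => ?_
    rw [current_eq_sum, current_eq_sum, ← Finset.sum_add_distrib, Finset.mul_sum]
    refine Finset.sum_congr rfl fun α _ => ?_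
    rw [← Finset.sum_add_distrib, Finset.mul_sum]
    refine Finset.sum_congr rfl fun β _ => ?_
    simp only [densityCoeff, scaledPair]
    ring
  rw [← hdiv, hmod] at herr
  have hflux : ν ⬝ᵥ currentDensity h r X y = v * (ν ⬝ᵥ current (h y)⁻¹ ν x f x f) := by
    have : currentDensity h r X y = v • current (h y)⁻¹ ν x f x f := rfl
    rw [this, dotProduct_smul, smul_eq_mul]
  -- the norms
  have n1 : normSq₁ (G y) (X y) = normSq₁ (h y) x := by
    rw [hGy, normSq₁_conformal hr0.ne' hpd.isUnit]
  have n2 : ∀ T, normSq₂ (G y) T = normSq₂ (h y) (r y ^ 2 • T) := fun T => by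
    rw [hGy, normSq₂_conformal hr0.ne' hpd.isUnit]
  have n3 : normSq₃ (G y) (flatU G X y) = normSq₃ (h y) U := by
    rw [hGy, normSq₃_conformal hr0.ne' hpd.isUnit]
  have ncov : normSq₂ (G y) (flatCov G X y)
      ≤ 2 * normSq₂ (h y) f + 2 * normSq₂ (h y) S := by
    have e1 : flatCov G X y = fun i j => flatCurl X y i j + flatKilling G X y i j := by
      funext i j
      exact flatCov_eq_curl_add_killing hGs i j
    have e2 := normSq₂_add_le hGpd (flatCurl X y) (flatKilling G X y)
    have e3 : normSq₂ (G y) (flatCurl X y) = normSq₂ (h y) f := n2 (flatCurl X y)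
    have e4 : normSq₂ (G y) (flatKilling G X y) = normSq₂ (h y) S := n2 (flatKilling G X y)
    rw [e1]
    linarith
  have hk2b : ∀ T : Fin n → Fin n → ℝ, κ * ‖T‖ ^ 2 ≤ normSq₂ (h y) T := fun T =>
    (mul_le_mul_of_nonneg_right hk2 (sq_nonneg _)).trans (hκ₂b y hyK T)
  have he : κ * ‖x‖ ^ 2 + κ * ‖f'‖ ^ 2 ≤ normSq₁ (h y) x + normSq₂ (h y) f :=
    add_le_add ((mul_le_mul_of_nonneg_right hk1 (sq_nonneg _)).trans (hκ₁b y hyK x)) (hk2b f')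
  have hd : κ * ‖S‖ ^ 2 + κ * ‖U‖ ^ 2 ≤ normSq₂ (h y) S + normSq₃ (h y) U :=
    add_le_add (hk2b S) ((mul_le_mul_of_nonneg_right hk3 (sq_nonneg _)).trans (hκ₃b y hyK U))
  have hb := habs (r y) ‖x‖ ‖f'‖ ‖S‖ ‖U‖ _ _ hr0.le (hrε.trans (min_le_right _ _)) (norm_nonneg _)
    (norm_nonneg _) he hd
  have hfin := (abs_le.1 (herr.trans hb)).1
  rw [n1, n2 (flatKilling G X y), n3, hflux]
  set e := normSq₁ (h y) x + normSq₂ (h y) f with hedef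
  set d := normSq₂ (h y) S + normSq₃ (h y) U with hddef
  have he0 : 0 ≤ e := le_trans (by positivity) he
  have hd0 : 0 ≤ d := le_trans (by positivity) hd
  have hS0 : 0 ≤ normSq₂ (h y) S := normSq₂_nonneg hpd S
  have hU0 : 0 ≤ normSq₃ (h y) U := normSq₃_nonneg hpd U
  have hN0 : 0 ≤ normSq₁ (h y) x := normSq₁_nonneg hpd x
  have hv0 : 0 < v := hμ.trans_le hvμ
  have p1 : v * (c * e) ≤ v * (∑ k, (current (h y)⁻¹ ν (Lx k) (Lf k) x f k
      + current (h y)⁻¹ ν x f (Lx k) (Lf k) k)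
      + (1 + 2 * s - n) * (ν ⬝ᵥ current (h y)⁻¹ ν x f x f)) :=
    mul_le_mul_of_nonneg_left hmodel hv0.le
  have p2 : c * μ / 2 * e ≤ c * v / 2 * e :=
    mul_le_mul_of_nonneg_right (by nlinarith) he0
  have p3 : C * d ≤ v * (C / μ * d) := by
    have : C * d = μ * (C / μ * d) := by field_simp
    rw [this]
    exact mul_le_mul_of_nonneg_right hvμ (by positivity)
  have p4 : v * (c / 4 * (normSq₁ (h y) x + normSq₂ (G y) (flatCov G X y)) - (C / μ + c / 2) * d)
      ≤ v * (c / 2 * e - C / μ * d) := by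
    refine mul_le_mul_of_nonneg_left ?_ hv0.le
    nlinarith
  refine p4.trans ?_
  rw [mul_add] at p1
  nlinarith

end LocalEstimate

end

noncomputable section

/-! ### Tensor components in the charts of the manifold -/

section Charts

variable {n : ℕ} [NeZero n] {M : Type*} [TopologicalSpace M]
  [ChartedSpace (EuclideanHalfSpace n) M] [IsManifold (𝓡∂ n) ∞ M]

local notation "φ" => extChartAt (𝓡∂ n)

/-- The coordinate vector fields of a chart, as sections of the tangent bundle. -/
def frameField (p : M) (i : Fin n) (x : M) : TangentSpace (𝓡∂ n) x :=
  (trivializationAt (EuclideanSpace ℝ (Fin n)) (TangentSpace (𝓡∂ n)) p).symmL ℝ x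
    (EuclideanSpace.single i (1 : ℝ))

lemma frameField_apply {p : M} {x : M} (hx : x ∈ (φ p).source) (i : Fin n) :
    frameField p i x = mfderivWithin 𝓘(ℝ, EuclideanSpace ℝ (Fin n)) (𝓡∂ n) (φ p).symm
      (range (𝓡∂ n)) (φ p x) (EuclideanSpace.single i (1 : ℝ)) := by
  rw [frameField, TangentBundle.symmL_trivializationAt (by simpa using hx)]
  rfl

lemma contMDiffOn_frameField (p : M) (i : Fin n) :
    ContMDiffOn (𝓡∂ n) ((𝓡∂ n).prod 𝓘(ℝ, EuclideanSpace ℝ (Fin n))) ∞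
      (fun x => Bundle.TotalSpace.mk' (EuclideanSpace ℝ (Fin n)) x (frameField p i x))
      (φ p).source := by
  have hb : (trivializationAt (EuclideanSpace ℝ (Fin n)) (TangentSpace (𝓡∂ n)) p).baseSet
      = (φ p).source := by
    rw [extChartAt_source]
    rfl
  rw [← hb, Bundle.Trivialization.contMDiffOn_section_baseSet_iff]
  refine (contMDiffOn_const (c := EuclideanSpace.single i (1 : ℝ))).congr fun x hx => ?_
  rw [frameField, Bundle.Trivialization.symmL_apply, Bundle.Trivialization.apply_mk_symm]
  all_goals exact hx

lemma clm_sum_smul {E F : Type*} [AddCommGroup E] [Module ℝ E] [TopologicalSpace E]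
    [AddCommGroup F] [Module ℝ F] [TopologicalSpace F] (L : E →L[ℝ] F) {ι : Type*} [Fintype ι]
    (c : ι → ℝ) (v : ι → E) : L (∑ a, c a • v a) = ∑ a, c a • L (v a) := by
  simp only [map_sum, map_smul]

lemma bilin_sum_smul {E : Type*} [NormedAddCommGroup E] [NormedSpace ℝ E]
    (g : E →L[ℝ] E →L[ℝ] ℝ) {ι : Type*} [Fintype ι] (c d : ι → ℝ) (v : ι → E) :
    g (∑ a, c a • v a) (∑ b, d b • v b) = ∑ a, c a * ∑ b, d b * g (v a) (v b) := by
  rw [clm_sum_smul g c v]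
  simp only [_root_.sum_apply, _root_.smul_apply, smul_eq_mul,
    clm_sum_smul]

omit [IsManifold (𝓡∂ n) ∞ M] in
lemma form_apply_congr (X : OneForm n M) {x x' : M} (h : x = x') (v : EuclideanSpace ℝ (Fin n)) :
    (X x : EuclideanSpace ℝ (Fin n) →L[ℝ] ℝ) v = (X x' : EuclideanSpace ℝ (Fin n) →L[ℝ] ℝ) v := by
  subst h; rfl

omit [IsManifold (𝓡∂ n) ∞ M] in
lemma bilin_apply_congr (g : BilinField n M) {x x' : M} (h : x = x')
    (v w : EuclideanSpace ℝ (Fin n)) :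
    (g x : EuclideanSpace ℝ (Fin n) →L[ℝ] EuclideanSpace ℝ (Fin n) →L[ℝ] ℝ) v w
      = (g x' : EuclideanSpace ℝ (Fin n) →L[ℝ] EuclideanSpace ℝ (Fin n) →L[ℝ] ℝ) v w := by
  subst h; rfl

lemma contMDiffOn_form_frameField {X : OneForm n M} {N : Set M} (hX : SmoothFormOn X N) (p : M)
    (i : Fin n) : ContMDiffOn (𝓡∂ n) 𝓘(ℝ, ℝ) ∞ (fun x => X x (frameField p i x))
      ((φ p).source ∩ N) := by
  have h1 := ContMDiffOn.clm_bundle_apply (hX.mono (inter_subset_right (s := (φ p).source)))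
    ((contMDiffOn_frameField p i).mono inter_subset_left)
  intro x hx
  have h2 := h1 x hx
  rw [Bundle.contMDiffWithinAt_totalSpace] at h2
  exact h2.2

lemma contMDiffOn_metric_frameField
    (h : Bundle.ContMDiffRiemannianMetric (𝓡∂ n) ∞ (EuclideanSpace ℝ (Fin n))
      (fun x : M => TangentSpace (𝓡∂ n) x)) (p : M) (i j : Fin n) :
    ContMDiffOn (𝓡∂ n) 𝓘(ℝ, ℝ) ∞ (fun x => h.inner x (frameField p i x) (frameField p j x))
      (φ p).source := by
  have h1 := ContMDiffOn.clm_bundle_apply₂ (F₃ := ℝ) (E₃ := Bundle.Trivial M ℝ)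
    (ψ := fun x => h.inner x) (h.contMDiff.contMDiffOn (s := (φ p).source))
    (contMDiffOn_frameField p i) (contMDiffOn_frameField p j)
  intro x hx
  have h2 := h1 x hx
  rw [Bundle.contMDiffWithinAt_totalSpace] at h2
  exact h2.2

lemma contDiffOn_comp_extChartAt_symm {f : M → ℝ} {N : Set M} {p : M}
    (hf : ContMDiffOn (𝓡∂ n) 𝓘(ℝ, ℝ) ∞ f ((φ p).source ∩ N)) :
    ContDiffOn ℝ ∞ (f ∘ (φ p).symm) ((φ p).target ∩ (φ p).symm ⁻¹' N) := by
  rw [← contMDiffOn_iff_contDiffOn]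
  exact hf.comp ((contMDiffOn_extChartAt_symm p).mono inter_subset_left)
    fun y hy => ⟨(φ p).map_target hy.1, hy.2⟩

lemma coordVec_eq_frameField {p : M} {y : EuclideanSpace ℝ (Fin n)} (hy : y ∈ (φ p).target)
    (i : Fin n) : coordVec p y i = frameField p i ((φ p).symm y) := by
  rw [frameField_apply ((φ p).map_target hy), (φ p).right_inv hy]
  rfl

lemma contDiffOn_formCoord {X : OneForm n M} {N : Set M} (hX : SmoothFormOn X N) (p : M)
    (i : Fin n) :
    ContDiffOn ℝ ∞ (fun y => formCoord X p y i) ((φ p).target ∩ (φ p).symm ⁻¹' N) :=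
  (contDiffOn_comp_extChartAt_symm (contMDiffOn_form_frameField hX p i)).congr fun y hy => by
    rw [formCoord, coordVec_eq_frameField hy.1]
    rfl

lemma contDiffOn_metricCoord
    (h : Bundle.ContMDiffRiemannianMetric (𝓡∂ n) ∞ (EuclideanSpace ℝ (Fin n))
      (fun x : M => TangentSpace (𝓡∂ n) x)) (p : M) (i j : Fin n) :
    ContDiffOn ℝ ∞ (fun y => metricCoord (fun x => h.inner x) p y i j) (φ p).target := by
  have h1 := contDiffOn_comp_extChartAt_symm (N := univ)
    (by simpa using contMDiffOn_metric_frameField h p i j)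
  rw [preimage_univ, inter_univ] at h1
  refine h1.congr fun y hy => ?_
  rw [metricCoord, Matrix.of_apply, coordVec_eq_frameField hy, coordVec_eq_frameField hy]
  rfl

/-- The transition map from the chart around `q` to the chart around `p`. -/
def transition (p q : M) (y : EuclideanSpace ℝ (Fin n)) : EuclideanSpace ℝ (Fin n) :=
  φ p ((φ q).symm y)

lemma contDiffWithinAt_transition (p q : M) {y : EuclideanSpace ℝ (Fin n)}
    (hy : y ∈ (φ q).target) (hp : (φ q).symm y ∈ (φ p).source) :
    ContDiffWithinAt ℝ ∞ (transition p q) (range (𝓡∂ n)) y :=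
  contDiffWithinAt_ext_coord_change p q (by
    rw [PartialEquiv.trans_source, PartialEquiv.symm_source]
    exact ⟨hy, hp⟩)

omit [IsManifold (𝓡∂ n) ∞ M] in
lemma preimage_source_mem_nhdsWithin (p q : M) {y : EuclideanSpace ℝ (Fin n)}
    (hy : y ∈ (φ q).target) (hp : (φ q).symm y ∈ (φ p).source) :
    (φ q).target ∩ (φ q).symm ⁻¹' (φ p).source ∈ nhdsWithin y (range (𝓡∂ n)) := by
  have h1 : (φ q).target ∈ nhdsWithin y (range (𝓡∂ n)) := extChartAt_target_mem_nhdsWithin_of_mem hy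
  refine Filter.inter_mem h1 ?_
  have hc : ContinuousWithinAt (φ q).symm (range (𝓡∂ n)) y :=
    (continuousOn_extChartAt_symm q y hy).mono_of_mem_nhdsWithin h1
  exact hc ((isOpen_extChartAt_source p).mem_nhds hp)

/-- The coordinate vectors of two charts are related by the Jacobian matrix. -/
lemma coordVec_eq_sum_jac (p q : M) {y : EuclideanSpace ℝ (Fin n)}
    (hy : y ∈ (φ q).target) (hp : (φ q).symm y ∈ (φ p).source) (i : Fin n) :
    (coordVec q y i : EuclideanSpace ℝ (Fin n))
      = ∑ a, jac (transition p q) y a i •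
        (coordVec p (transition p q y) a : EuclideanSpace ℝ (Fin n)) := by
  have hyr : y ∈ range (𝓡∂ n) := extChartAt_target_subset_range q hy
  have hτt : transition p q y ∈ (φ p).target := (φ p).map_source hp
  have hu : UniqueMDiffWithinAt 𝓘(ℝ, EuclideanSpace ℝ (Fin n)) (range (𝓡∂ n)) y :=
    ((𝓡∂ n).uniqueDiffOn y hyr).uniqueMDiffWithinAt
  have hd : DifferentiableWithinAt ℝ (transition p q) (range (𝓡∂ n)) y :=
    (contDiffWithinAt_transition p q hy hp).differentiableWithinAt (by simp)
  have heq : (φ q).symm =ᶠ[nhdsWithin y (range (𝓡∂ n))] (φ p).symm ∘ transition p q := by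
    filter_upwards [preimage_source_mem_nhdsWithin p q hy hp] with z hz
    exact ((φ p).left_inv hz.2).symm
  have hpre : transition p q ⁻¹' range (𝓡∂ n) ∈ nhdsWithin y (range (𝓡∂ n)) := by
    filter_upwards [preimage_source_mem_nhdsWithin p q hy hp] with z hz
    exact extChartAt_target_subset_range p ((φ p).map_source hz.2)
  have h1 : mfderivWithin 𝓘(ℝ, EuclideanSpace ℝ (Fin n)) (𝓡∂ n) (φ q).symm (range (𝓡∂ n)) y
      = mfderivWithin 𝓘(ℝ, EuclideanSpace ℝ (Fin n)) (𝓡∂ n) ((φ p).symm ∘ transition p q)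
        (range (𝓡∂ n)) y := heq.mfderivWithin_eq (((φ p).left_inv hp).symm)
  have h2 := mfderivWithin_comp_of_preimage_mem_nhdsWithin (I := 𝓘(ℝ, EuclideanSpace ℝ (Fin n)))
    (I' := 𝓘(ℝ, EuclideanSpace ℝ (Fin n))) (I'' := 𝓡∂ n) (x := y)
    (mdifferentiableWithinAt_extChartAt_symm hτt) hd.mdifferentiableWithinAt hpre hu
  have h3 : fderivWithin ℝ (transition p q) (range (𝓡∂ n)) y (EuclideanSpace.single i (1 : ℝ))
      = ∑ a, jac (transition p q) y a i • EuclideanSpace.single a (1 : ℝ) := by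
    ext b
    have hb : jac (transition p q) y b i
        = (fderivWithin ℝ (transition p q) (range (𝓡∂ n)) y (EuclideanSpace.single i (1 : ℝ))) b := by
      have := ((EuclideanSpace.proj (𝕜 := ℝ) b).hasFDerivAt.comp_hasFDerivWithinAt y
        hd.hasFDerivWithinAt).fderivWithin ((𝓡∂ n).uniqueDiffOn y hyr)
      exact congrArg (fun L => L (EuclideanSpace.single i (1 : ℝ))) this
    rw [← hb]
    simp [Pi.single_apply]
  have h4 : (coordVec q y i : EuclideanSpace ℝ (Fin n))
      = (mfderivWithin 𝓘(ℝ, EuclideanSpace ℝ (Fin n)) (𝓡∂ n) (φ p).symm (range (𝓡∂ n))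
          (transition p q y) : EuclideanSpace ℝ (Fin n) →L[ℝ] EuclideanSpace ℝ (Fin n))
        (fderivWithin ℝ (transition p q) (range (𝓡∂ n)) y (EuclideanSpace.single i (1 : ℝ))) := by
    rw [← mfderivWithin_eq_fderivWithin]
    exact congrArg (fun L : EuclideanSpace ℝ (Fin n) →L[ℝ] EuclideanSpace ℝ (Fin n) =>
      L (EuclideanSpace.single i (1 : ℝ))) (h1.trans h2)
  rw [h4, h3]
  exact clm_sum_smul _ _ _

lemma formCoord_transition (X : OneForm n M) (p q : M) {y : EuclideanSpace ℝ (Fin n)}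
    (hy : y ∈ (φ q).target) (hp : (φ q).symm y ∈ (φ p).source) :
    formCoord X q y = pull₁ (jac (transition p q) y) (formCoord X p (transition p q y)) := by
  funext i
  have hx : (φ p).symm (transition p q y) = (φ q).symm y := (φ p).left_inv hp
  have h1 : formCoord X q y i = (X ((φ q).symm y) : EuclideanSpace ℝ (Fin n) →L[ℝ] ℝ)
      (coordVec q y i : EuclideanSpace ℝ (Fin n)) := rfl
  rw [h1, coordVec_eq_sum_jac p q hy hp]
  exact (form_apply_congr X hx.symm _).trans (clm_sum_smul _ _ _)

lemma metricCoord_transition (g : BilinField n M) (p q : M) {y : EuclideanSpace ℝ (Fin n)}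
    (hy : y ∈ (φ q).target) (hp : (φ q).symm y ∈ (φ p).source) :
    metricCoord g q y = (jac (transition p q) y).transpose
      * metricCoord g p (transition p q y) * jac (transition p q) y := by
  ext i j
  have hx : (φ p).symm (transition p q y) = (φ q).symm y := (φ p).left_inv hp
  have h1 : metricCoord g q y i j
      = (g ((φ q).symm y) : EuclideanSpace ℝ (Fin n) →L[ℝ] EuclideanSpace ℝ (Fin n) →L[ℝ] ℝ)
      (coordVec q y i : EuclideanSpace ℝ (Fin n)) (coordVec q y j : EuclideanSpace ℝ (Fin n)) := rfl
  rw [transpose_mul_mul_apply, h1, coordVec_eq_sum_jac p q hy hp, coordVec_eq_sum_jac p q hy hp]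
  exact (bilin_apply_congr g hx.symm _ _).trans (bilin_sum_smul
    (E := EuclideanSpace ℝ (Fin n)) (g ((φ p).symm (transition p q y)))
    (fun a => jac (transition p q) y a i) (fun a => jac (transition p q) y a j)
    (fun a => coordVec p (transition p q y) a))

/-- The components of the differential of a function are the partial derivatives of its coordinate
expression, at boundary points too. -/
lemma formCoord_mfderiv {f : M → ℝ} (hf : ContMDiff (𝓡∂ n) 𝓘(ℝ, ℝ) ∞ f) (p : M)
    {y : EuclideanSpace ℝ (Fin n)} (hy : y ∈ (φ p).target) :
    formCoord (fun z => mfderiv (𝓡∂ n) 𝓘(ℝ, ℝ) f z) p y = flatGrad (f ∘ (φ p).symm) y := by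
  funext i
  have hyr : y ∈ range (𝓡∂ n) := extChartAt_target_subset_range p hy
  have hu : UniqueMDiffWithinAt 𝓘(ℝ, EuclideanSpace ℝ (Fin n)) (range (𝓡∂ n)) y :=
    ((𝓡∂ n).uniqueDiffOn y hyr).uniqueMDiffWithinAt
  have h2 := mfderiv_comp_mfderivWithin (I := 𝓘(ℝ, EuclideanSpace ℝ (Fin n)))
    (I' := 𝓡∂ n) (I'' := 𝓘(ℝ, ℝ)) y (hf.mdifferentiableAt (by simp))
    (mdifferentiableWithinAt_extChartAt_symm hy) hu
  rw [mfderivWithin_eq_fderivWithin] at h2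
  exact (congrArg (fun L : EuclideanSpace ℝ (Fin n) →L[ℝ] ℝ =>
      L (EuclideanSpace.single i (1 : ℝ))) h2).symm

lemma contDiffOn_comp_symm {f : M → ℝ} (hf : ContMDiff (𝓡∂ n) 𝓘(ℝ, ℝ) ∞ f) (p : M) :
    ContDiffOn ℝ ∞ (f ∘ (φ p).symm) (φ p).target := by
  have h1 := contDiffOn_comp_extChartAt_symm (N := univ) (p := p) hf.contMDiffOn
  rwa [preimage_univ, inter_univ] at h1

lemma posDef_metricCoord
    (h : Bundle.ContMDiffRiemannianMetric (𝓡∂ n) ∞ (EuclideanSpace ℝ (Fin n))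
      (fun x : M => TangentSpace (𝓡∂ n) x)) (p : M) {y : EuclideanSpace ℝ (Fin n)}
    (hy : y ∈ (φ p).target) : (metricCoord (fun x => h.inner x) p y).PosDef := by
  set D : EuclideanSpace ℝ (Fin n) →L[ℝ] EuclideanSpace ℝ (Fin n) :=
    mfderivWithin 𝓘(ℝ, EuclideanSpace ℝ (Fin n)) (𝓡∂ n) (φ p).symm (range (𝓡∂ n)) y with hD
  have hDi : Function.Injective D :=
    (isInvertible_mfderivWithin_extChartAt_symm hy).injective
  set g : EuclideanSpace ℝ (Fin n) →L[ℝ] EuclideanSpace ℝ (Fin n) →L[ℝ] ℝ :=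
    h.inner ((φ p).symm y) with hg
  have hM : ∀ i j, metricCoord (fun x => h.inner x) p y i j
    = g (D (EuclideanSpace.single i (1 : ℝ))) (D (EuclideanSpace.single j (1 : ℝ))) := fun i j => rfl
  refine Matrix.PosDef.of_dotProduct_mulVec_pos ?_ ?_
  · ext i j
    rw [Matrix.conjTranspose_apply, star_trivial, hM, hM]
    exact h.symm _ _ _
  · intro v hv
    set w : EuclideanSpace ℝ (Fin n) := ∑ i, v i • EuclideanSpace.single i (1 : ℝ) with hw
    have hw0 : w ≠ 0 := by
      intro h0
      apply hv
      funext i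
      have := congrArg (fun u : EuclideanSpace ℝ (Fin n) => u i) h0
      simpa [hw, Pi.single_apply] using this
    have hpos := h.pos ((φ p).symm y) (D w) (fun h0 => hw0 (hDi (by rw [map_zero]; exact h0)))
    have he : star v ⬝ᵥ (metricCoord (fun x => h.inner x) p y).mulVec v = g (D w) (D w) := by
      rw [hw, clm_sum_smul, bilin_sum_smul]
      simp only [dotProduct, Matrix.mulVec, star_trivial, hM]
      exact Finset.sum_congr rfl fun i _ => congrArg _ (Finset.sum_congr rfl fun j _ => mul_comm _ _)
    rw [he]
    exact hpos

end Charts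

end

noncomputable section

/-! ### Invariance under changes of charts -/

section CurrentInvariance

open Matrix

variable {n : ℕ} [NeZero n]

omit [NeZero n] in
/-- The algebraic part of the operator `U` is a tensor. -/
lemma pull₃_sub_outer_add_outer (A : Matrix (Fin n) (Fin n) ℝ) (Q : Fin n → Fin n → Fin n → ℝ)
    (g : Fin n → Fin n → ℝ) (x : Fin n → ℝ) (k j i : Fin n) :
    pull₃ A (fun c b a => Q c b a - g b c * x a + g a c * x b) k j i
      = pull₃ A Q k j i - pull₂ A g j k * pull₁ A x i + pull₂ A g i k * pull₁ A x j := by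
  have h1 : pull₂ A g j k * pull₁ A x i
      = ∑ c, A c k * ∑ b, A b j * ∑ a, A a i * (g b c * x a) := by
    rw [pull₂, pull₁_comm]
    simp only [pull₁, Finset.sum_mul, Finset.mul_sum]
    rw [Finset.sum_comm]
    refine Finset.sum_congr rfl fun c _ => ?_
    rw [Finset.sum_comm]
    exact Finset.sum_congr rfl fun b _ => Finset.sum_congr rfl fun a _ => by ring
  have h2 : pull₂ A g i k * pull₁ A x j
      = ∑ c, A c k * ∑ b, A b j * ∑ a, A a i * (g a c * x b) := by
    rw [pull₂, pull₁_comm]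
    simp only [pull₁, Finset.sum_mul, Finset.mul_sum]
    rw [Finset.sum_comm]
    exact Finset.sum_congr rfl fun c _ => Finset.sum_congr rfl fun b _ =>
      Finset.sum_congr rfl fun a _ => by ring
  rw [h1, h2]
  simp only [pull₃, pull₂, pull₁, mul_add, mul_sub, Finset.sum_add_distrib,
    Finset.sum_sub_distrib]

omit [NeZero n] in
/-- The pairing of the current with a covector is independent of the frame. -/
lemma dotProduct_current_congruence {A H H' : Matrix (Fin n) (Fin n) ℝ} (hH : A * H' * Aᵀ = H)
    (u ν x : Fin n → ℝ) (f : Matrix (Fin n) (Fin n) ℝ) :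
    (Aᵀ *ᵥ u) ⬝ᵥ current H' (Aᵀ *ᵥ ν) (Aᵀ *ᵥ x) (Aᵀ * f * A) (Aᵀ *ᵥ x) (Aᵀ * f * A)
      = u ⬝ᵥ current H ν x f x f := by
  have h1 : ∀ a b : Fin n → ℝ, (Aᵀ *ᵥ a) ⬝ᵥ H' *ᵥ (Aᵀ *ᵥ b) = a ⬝ᵥ H *ᵥ b := fun a b => by
    rw [← hH, dotProduct_comm, dotProduct_mulVec, vecMul_transpose, dotProduct_comm]
    simp only [mulVec_mulVec, Matrix.mul_assoc]
  have h2 : contr H' (Aᵀ *ᵥ ν) (Aᵀ * f * A) = Aᵀ *ᵥ contr H ν f := by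
    simp only [contr, ← hH, mulVec_mulVec, transpose_mul, transpose_transpose, Matrix.mul_assoc]
  have h3 : (Aᵀ * f * A) *ᵥ (H' *ᵥ (Aᵀ *ᵥ x)) = Aᵀ *ᵥ (f *ᵥ (H *ᵥ x)) := by
    simp only [← hH, mulVec_mulVec, Matrix.mul_assoc]
  simp only [current, currentScalar, h2, h3, ← mulVec_sub, h1, dotProduct_add, dotProduct_smul]

end CurrentInvariance

section Regions

variable {n : ℕ} [NeZero n] {M : Type*} [TopologicalSpace M]
  [ChartedSpace (EuclideanHalfSpace n) M] [IsManifold (𝓡∂ n) ∞ M]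

local notation "φ" => extChartAt (𝓡∂ n)

lemma extChartAt_mem_openHalf {p x : M} (hx : x ∈ (φ p).source)
    (hxi : x ∈ (𝓡∂ n).interior M) : φ p x ∈ openHalf n := by
  have h1 := ((𝓡∂ n).isInteriorPoint_iff_of_mem_atlas (n := ∞) (by simp)
    (chart_mem_atlas (EuclideanHalfSpace n) p) (by simpa using hx)).1 hxi
  exact interior_mono (extChartAt_target_subset_range p) h1

/-- The set of coordinates, in the chart around `p`, of the points of `N` in that chart. -/
def chartDomain (p : M) (N : Set M) : Set (EuclideanSpace ℝ (Fin n)) :=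
  (φ p).target ∩ (φ p).symm ⁻¹' N

lemma chartDomain_subset_openHalf {N : Set M} (hNi : N ⊆ (𝓡∂ n).interior M) (p : M) :
    chartDomain p N ⊆ openHalf n := fun y hy => by
  rw [← (φ p).right_inv hy.1]
  exact extChartAt_mem_openHalf ((φ p).map_target hy.1) (hNi hy.2)

lemma isOpen_chartDomain {N : Set M} (hN : IsOpen N) (hNi : N ⊆ (𝓡∂ n).interior M) (p : M) :
    IsOpen (chartDomain (n := n) p N) := by
  rw [isOpen_iff_mem_nhds]
  intro y hy
  have hyo := chartDomain_subset_openHalf hNi p hy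
  have h1 : (φ p).target ∈ nhds y := by
    have := extChartAt_target_mem_nhdsWithin_of_mem hy.1
    rwa [nhdsWithin_eq_nhds.2 (openHalf_mem_nhds hyo)] at this
  refine Filter.inter_mem h1 ?_
  exact ((continuousOn_extChartAt_symm p y hy.1).continuousAt h1) (hN.mem_nhds hy.2)

end Regions

section Invariance

variable {n : ℕ} [NeZero n] {M : Type*} [TopologicalSpace M]
  [ChartedSpace (EuclideanHalfSpace n) M] [IsManifold (𝓡∂ n) ∞ M]

local notation "φ" => extChartAt (𝓡∂ n)

namespace AsymptoticallyHyperbolic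

variable (𝓐 : AsymptoticallyHyperbolic n M)

/-- The matrix of the metric of the compactification in a chart. -/
abbrev hCoord (p : M) : EuclideanSpace ℝ (Fin n) → Matrix (Fin n) (Fin n) ℝ :=
  metricCoord (fun x => 𝓐.h.inner x) p

/-- The defining function in a chart. -/
abbrev rCoord (p : M) : EuclideanSpace ℝ (Fin n) → ℝ := 𝓐.ρ ∘ (φ p).symm

lemma metricCoord_g (p : M) (y : EuclideanSpace ℝ (Fin n)) :
    metricCoord 𝓐.g p y = (𝓐.rCoord p y ^ 2)⁻¹ • 𝓐.hCoord p y := rfl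

/-- An open set of interior points in which the metric `ρ⁻² h` and the 1-form `X` are smooth. -/
structure RegularOn (X : OneForm n M) (N : Set M) : Prop where
  isOpen : IsOpen N
  interior : N ⊆ (𝓡∂ n).interior M
  pos : ∀ x ∈ N, 0 < 𝓐.ρ x
  smooth : SmoothFormOn X N

variable {𝓐} {X : OneForm n M} {N : Set M} (hN : 𝓐.RegularOn X N)

omit [IsManifold (𝓡∂ n) ∞ M] in
lemma contDiffAt_of_contDiffOn_target {p : M} {y : EuclideanSpace ℝ (Fin n)}
    (hy : y ∈ (φ p).target) (hyo : y ∈ openHalf n) {f : EuclideanSpace ℝ (Fin n) → ℝ}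
    (hf : ContDiffOn ℝ ∞ f (φ p).target) : ContDiffAt ℝ ∞ f y := by
  refine hf.contDiffAt ?_
  have := extChartAt_target_mem_nhdsWithin_of_mem hy
  rwa [nhdsWithin_eq_nhds.2 (openHalf_mem_nhds hyo)] at this

include hN

lemma RegularOn.mono {N' : Set M} (h : N' ⊆ N) (ho : IsOpen N') : 𝓐.RegularOn X N' :=
  ⟨ho, h.trans hN.interior, fun x hx => hN.pos x (h hx), hN.smooth.mono h⟩

variable {p : M} {y : EuclideanSpace ℝ (Fin n)} (hy : y ∈ chartDomain p N)

include hy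

lemma RegularOn.mem_openHalf : y ∈ openHalf n := chartDomain_subset_openHalf hN.interior p hy

lemma RegularOn.chartDomain_mem_nhds : chartDomain p N ∈ nhds y :=
  (isOpen_chartDomain hN.isOpen hN.interior p).mem_nhds hy

lemma RegularOn.rCoord_pos : 0 < 𝓐.rCoord p y := hN.pos _ hy.2

lemma RegularOn.contDiffAt_formCoord (i : Fin n) :
    ContDiffAt ℝ ∞ (fun z => formCoord X p z i) y :=
  (contDiffOn_formCoord hN.smooth p i).contDiffAt (hN.chartDomain_mem_nhds hy)

lemma RegularOn.contDiffAt_rCoord : ContDiffAt ℝ ∞ (𝓐.rCoord p) y :=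
  contDiffAt_of_contDiffOn_target hy.1 (hN.mem_openHalf hy) (contDiffOn_comp_symm 𝓐.smooth p)

lemma RegularOn.contDiffAt_hCoord (i j : Fin n) :
    ContDiffAt ℝ ∞ (fun z => 𝓐.hCoord p z i j) y :=
  contDiffAt_of_contDiffOn_target hy.1 (hN.mem_openHalf hy) (contDiffOn_metricCoord 𝓐.h p i j)

omit hN in
lemma posDef_hCoord : (𝓐.hCoord p y).PosDef := posDef_metricCoord 𝓐.h p hy.1

lemma RegularOn.posDef_metricCoord : (metricCoord 𝓐.g p y).PosDef := by
  rw [metricCoord_g]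
  have := hN.rCoord_pos hy
  exact (posDef_hCoord hy).smul (by positivity)

lemma RegularOn.contDiffAt_metricCoord (i j : Fin n) :
    ContDiffAt ℝ ∞ (fun z => metricCoord 𝓐.g p z i j) y := by
  simp only [metricCoord_g, Matrix.smul_apply, smul_eq_mul]
  exact (((hN.contDiffAt_rCoord hy).pow 2).inv (pow_ne_zero 2 (hN.rCoord_pos hy).ne')).mul
    (hN.contDiffAt_hCoord hy i j)

lemma RegularOn.eventually_metricCoord_symm :
    ∀ᶠ z in nhds y, ∀ i j, metricCoord 𝓐.g p z i j = metricCoord 𝓐.g p z j i := by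
  filter_upwards [hN.chartDomain_mem_nhds hy] with z hz i j
  have := (hN.posDef_metricCoord hz).1.apply i j
  simpa using this.symm

omit hN hy in
/-- The transition map, its Jacobian and the tensors involved satisfy what the transformation laws
require. -/
lemma RegularOn.transition_data (hN : 𝓐.RegularOn X N) (p q : M) :
    let W : Set (EuclideanSpace ℝ (Fin n)) := chartDomain q (N ∩ (φ p).source)
    IsOpen W ∧ W ⊆ openHalf n ∧ (∀ y ∈ W, transition p q y ∈ chartDomain p N) ∧
      (∀ y ∈ W, ContDiffAt ℝ ∞ (transition p q) y) ∧
      (∀ y ∈ W, IsUnit (jac (transition p q) y)) ∧ W ⊆ chartDomain q N := by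
  intro W
  have hN' : 𝓐.RegularOn X (N ∩ (φ p).source) :=
    hN.mono inter_subset_left (hN.isOpen.inter (isOpen_extChartAt_source p))
  refine ⟨isOpen_chartDomain hN'.isOpen hN'.interior q,
    chartDomain_subset_openHalf hN'.interior q, fun y hy => ?_, fun y hy => ?_, fun y hy => ?_,
    fun y hy => ⟨hy.1, hy.2.1⟩⟩
  · refine ⟨(φ p).map_source hy.2.2, ?_⟩
    rw [mem_preimage, transition, (φ p).left_inv hy.2.2]
    exact hy.2.1
  · exact (contDiffWithinAt_transition p q hy.1 hy.2.2).contDiffAt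
      (openHalf_mem_nhds (hN'.mem_openHalf hy))
  · have h1 := metricCoord_transition (fun x => 𝓐.h.inner x) p q hy.1 hy.2.2
    have h2 := (_root_.posDef_metricCoord 𝓐.h q hy.1).isUnit
    rw [h1, Matrix.isUnit_iff_isUnit_det, Matrix.det_mul] at h2
    rw [Matrix.isUnit_iff_isUnit_det]
    exact isUnit_of_mul_isUnit_right h2

omit hy in
lemma RegularOn.flatCov_transition (p q : M) (hy : y ∈ chartDomain q (N ∩ (φ p).source)) :
    flatCov (metricCoord 𝓐.g q) (formCoord X q) y = pull₂ (jac (transition p q) y)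
      (flatCov (metricCoord 𝓐.g p) (formCoord X p) (transition p q y)) := by
  obtain ⟨hW, hWi, hτ, hτs, hA, hWN⟩ := hN.transition_data p q
  exact flatCov_transform hW hWi (fun y hy => hN.mem_openHalf (hτ y hy)) hτs
    (fun y hy => hN.contDiffAt_metricCoord (hτ y hy))
    (fun y hy => (hN.eventually_metricCoord_symm (hτ y hy)).self_of_nhds)
    (fun y hy => (hN.posDef_metricCoord (hτ y hy)).isUnit) hA
    (fun y hy => metricCoord_transition 𝓐.g p q hy.1 hy.2.2)
    (fun y hy => hN.contDiffAt_formCoord (hτ y hy))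
    (fun y hy => formCoord_transition X p q hy.1 hy.2.2) hy

omit hy in
lemma RegularOn.flatCovTwo_transition (p q : M) (hy : y ∈ chartDomain q (N ∩ (φ p).source)) :
    flatCovTwo (metricCoord 𝓐.g q) (flatCov (metricCoord 𝓐.g q) (formCoord X q)) y
      = pull₃ (jac (transition p q) y) (flatCovTwo (metricCoord 𝓐.g p)
        (flatCov (metricCoord 𝓐.g p) (formCoord X p)) (transition p q y)) := by
  obtain ⟨hW, hWi, hτ, hτs, hA, hWN⟩ := hN.transition_data p q
  exact flatCovTwo_transform hW hWi (fun y hy => hN.mem_openHalf (hτ y hy)) hτs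
    (fun y hy => hN.contDiffAt_metricCoord (hτ y hy))
    (fun y hy => (hN.eventually_metricCoord_symm (hτ y hy)).self_of_nhds)
    (fun y hy => (hN.posDef_metricCoord (hτ y hy)).isUnit) hA
    (fun y hy => metricCoord_transition 𝓐.g p q hy.1 hy.2.2)
    (fun y hy => contDiffAt_flatCov (hN.mem_openHalf (hτ y hy))
      (hN.contDiffAt_metricCoord (hτ y hy)) (hN.posDef_metricCoord (hτ y hy)).isUnit
      (hN.contDiffAt_formCoord (hτ y hy)))
    (fun y hy => hN.flatCov_transition p q hy) hy

omit [IsManifold (𝓡∂ n) ∞ M] hN hy in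
lemma mem_chartDomain_inter_source (hy : y ∈ chartDomain p N) :
    y ∈ chartDomain p (N ∩ (φ ((φ p).symm y)).source) :=
  ⟨hy.1, hy.2, mem_extChartAt_source _⟩

/-- The norm, which is defined in the chart around each point, may be computed in any chart. -/
lemma RegularOn.formNormSq_eq :
    formNormSq 𝓐.g X ((φ p).symm y) = normSq₁ (metricCoord 𝓐.g p y) (formCoord X p y) := by
  have hy' := mem_chartDomain_inter_source hy
  obtain ⟨hW, hWi, hτ, hτs, hA, hWN⟩ := hN.transition_data ((φ p).symm y) p
  rw [metricCoord_transition 𝓐.g ((φ p).symm y) p hy.1 hy'.2.2,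
    formCoord_transition X ((φ p).symm y) p hy.1 hy'.2.2,
    normSq₁_congruence (hN.posDef_metricCoord (hτ y hy')) (hA y hy')]
  rfl

lemma RegularOn.covDerivNormSq_eq :
    covDerivNormSq 𝓐.g X ((φ p).symm y)
      = normSq₂ (metricCoord 𝓐.g p y) (flatCov (metricCoord 𝓐.g p) (formCoord X p) y) := by
  have hy' := mem_chartDomain_inter_source hy
  obtain ⟨hW, hWi, hτ, hτs, hA, hWN⟩ := hN.transition_data ((φ p).symm y) p
  rw [metricCoord_transition 𝓐.g ((φ p).symm y) p hy.1 hy'.2.2,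
    hN.flatCov_transition ((φ p).symm y) p hy',
    normSq₂_congruence (hN.posDef_metricCoord (hτ y hy')) (hA y hy')]
  rfl

lemma RegularOn.killingNormSq_eq :
    killingNormSq 𝓐.g X ((φ p).symm y)
      = normSq₂ (metricCoord 𝓐.g p y) (flatKilling (metricCoord 𝓐.g p) (formCoord X p) y) := by
  have hy' := mem_chartDomain_inter_source hy
  obtain ⟨hW, hWi, hτ, hτs, hA, hWN⟩ := hN.transition_data ((φ p).symm y) p
  have h1 : flatKilling (metricCoord 𝓐.g p) (formCoord X p) y
      = pull₂ (jac (transition ((φ p).symm y) p) y) (flatKilling (metricCoord 𝓐.g ((φ p).symm y))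
        (formCoord X ((φ p).symm y)) (transition ((φ p).symm y) p y)) := by
    funext i j
    rw [flatKilling, hN.flatCov_transition ((φ p).symm y) p hy', pull₂, pull₂, pull₁_comm _ _ _ j i]
    simp only [pull₂, pull₁, flatKilling, Finset.mul_sum, ← Finset.sum_add_distrib]
    exact Finset.sum_congr rfl fun a _ => Finset.sum_congr rfl fun b _ => by ring
  rw [metricCoord_transition 𝓐.g ((φ p).symm y) p hy.1 hy'.2.2, h1,
    normSq₂_congruence (hN.posDef_metricCoord (hτ y hy')) (hA y hy')]
  rfl

lemma RegularOn.opUNormSq_eq :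
    opUNormSq 𝓐.g X ((φ p).symm y)
      = normSq₃ (metricCoord 𝓐.g p y) (flatU (metricCoord 𝓐.g p) (formCoord X p) y) := by
  have hy' := mem_chartDomain_inter_source hy
  obtain ⟨hW, hWi, hτ, hτs, hA, hWN⟩ := hN.transition_data ((φ p).symm y) p
  set x := (φ p).symm y with hx
  set A := jac (transition x p) y with hAd
  have hg := metricCoord_transition 𝓐.g x p hy.1 hy'.2.2
  have h1 : flatU (metricCoord 𝓐.g p) (formCoord X p) y
      = pull₃ A (flatU (metricCoord 𝓐.g x) (formCoord X x) (transition x p y)) := by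
    have h2 : ∀ a b, metricCoord 𝓐.g p y a b
        = pull₂ A (metricCoord 𝓐.g x (transition x p y)) a b := fun a b => by
      rw [hg, transpose_mul_mul_apply]
    have h3 : ∀ b, formCoord X p y b = pull₁ A (formCoord X x (transition x p y)) b := fun b => by
      rw [formCoord_transition X x p hy.1 hy'.2.2]
    funext k j i
    rw [flatU, hN.flatCovTwo_transition x p hy', h2, h2, h3, h3]
    exact (pull₃_sub_outer_add_outer A (flatCovTwo (metricCoord 𝓐.g x)
      (flatCov (metricCoord 𝓐.g x) (formCoord X x)) (transition x p y)) (metricCoord 𝓐.g x (transition x p y))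
      (formCoord X x (transition x p y)) k j i).symm
  rw [hg, h1, normSq₃_congruence (hN.posDef_metricCoord (hτ y hy')) (hA y hy')]
  rfl

variable (𝓐 X) in
/-- The pairing of the differential of `ψ` with the current of `X` (as a vector field, not a
density), at the point with coordinates `y`. -/
def chartPairing (ψ : M → ℝ) (p : M) (y : EuclideanSpace ℝ (Fin n)) : ℝ :=
  flatGrad (ψ ∘ (φ p).symm) y ⬝ᵥ current (𝓐.hCoord p y)⁻¹ (flatGrad (𝓐.rCoord p) y)
    (𝓐.rCoord p y • formCoord X p y) (𝓐.rCoord p y ^ 2 • flatCurl (formCoord X p) y)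
    (𝓐.rCoord p y • formCoord X p y) (𝓐.rCoord p y ^ 2 • flatCurl (formCoord X p) y)

lemma RegularOn.flatCurl_eq :
    flatCurl (formCoord X p) y = Matrix.of fun i j => (1 / 2 : ℝ) *
      (flatCov (metricCoord 𝓐.g p) (formCoord X p) y i j
        - flatCov (metricCoord 𝓐.g p) (formCoord X p) y j i) := by
  have h1 := fun i j => flatCov_eq_curl_add_killing (X := formCoord X p)
    (hN.eventually_metricCoord_symm hy) i j
  ext i j
  have h2 : flatCurl (formCoord X p) y j i = -flatCurl (formCoord X p) y i j :=
    congrFun (congrFun (flatCurl_transpose (formCoord X p) y) i) j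
  rw [Matrix.of_apply, h1 i j, h1 j i, h2]
  simp only [flatKilling]
  ring

/-- The pairing with the current does not depend on the chart. -/
lemma RegularOn.chartPairing_eq {ψ : M → ℝ} (hψ : ContMDiff (𝓡∂ n) 𝓘(ℝ, ℝ) ∞ ψ) :
    chartPairing 𝓐 X ψ p y
      = chartPairing 𝓐 X ψ ((φ p).symm y) (φ ((φ p).symm y) ((φ p).symm y)) := by
  have hy' := mem_chartDomain_inter_source hy
  obtain ⟨hW, hWi, hτ, hτs, hA, hWN⟩ := hN.transition_data ((φ p).symm y) p
  set x := (φ p).symm y with hx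
  have hτx : transition x p y = φ x x := rfl
  rw [← hτx]
  set A := jac (transition x p) y with hAd
  have hAu : IsUnit A.det := (Matrix.isUnit_iff_isUnit_det _).1 (hA y hy')
  have hg := metricCoord_transition (fun x => 𝓐.h.inner x) x p hy.1 hy'.2.2
  have hgrad : ∀ {f : M → ℝ}, ContMDiff (𝓡∂ n) 𝓘(ℝ, ℝ) ∞ f →
      flatGrad (f ∘ (φ p).symm) y = A.transpose.mulVec (flatGrad (f ∘ (φ x).symm)
        (transition x p y)) := fun {f} hf => by
    rw [← formCoord_mfderiv hf p hy.1, ← formCoord_mfderiv hf x (hτ y hy').1]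
    exact formCoord_transition (fun z => mfderiv (𝓡∂ n) 𝓘(ℝ, ℝ) f z) x p hy.1 hy'.2.2
  have hr : 𝓐.rCoord p y = 𝓐.rCoord x (transition x p y) := by
    simp only [rCoord, Function.comp, transition]
    rw [(φ x).left_inv hy'.2.2]
  have hX := formCoord_transition X x p hy.1 hy'.2.2
  have hc : flatCurl (formCoord X p) y
      = A.transpose * flatCurl (formCoord X x) (transition x p y) * A := by
    ext i j
    rw [transpose_mul_mul_apply, hN.flatCurl_eq hy, hN.flatCurl_eq (hτ y hy'),
      hN.flatCov_transition x p hy', Matrix.of_apply, pull₂, pull₂, pull₁_comm _ _ _ j i]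
    simp only [pull₂, pull₁, Matrix.of_apply, Finset.mul_sum, ← Finset.sum_sub_distrib]
    exact Finset.sum_congr rfl fun a _ => Finset.sum_congr rfl fun b _ => by ring
  have hH : A * (𝓐.hCoord p y)⁻¹ * A.transpose = (𝓐.hCoord x (transition x p y))⁻¹ := by
    have hAt : IsUnit A.transpose.det := by rwa [Matrix.det_transpose]
    rw [hCoord, hg, Matrix.mul_inv_rev, Matrix.mul_inv_rev, ← Matrix.mul_assoc,
      ← Matrix.mul_assoc, Matrix.mul_nonsing_inv _ hAu, Matrix.one_mul, Matrix.mul_assoc,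
      Matrix.nonsing_inv_mul _ hAt, Matrix.mul_one]
  have key := dotProduct_current_congruence hH (flatGrad (ψ ∘ (φ x).symm) (transition x p y))
    (flatGrad (𝓐.rCoord x) (transition x p y))
    (𝓐.rCoord x (transition x p y) • formCoord X x (transition x p y))
    (𝓐.rCoord x (transition x p y) ^ 2 • flatCurl (formCoord X x) (transition x p y))
  rw [chartPairing, chartPairing, ← key, hgrad hψ, hgrad 𝓐.smooth, hc, hX, hr,
    Matrix.mulVec_smul, Matrix.mul_smul, Matrix.smul_mul]
  rfl

section Continuity

omit hN hy

omit [NeZero n] in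
lemma continuousAt_normSq₁ {G : EuclideanSpace ℝ (Fin n) → Matrix (Fin n) (Fin n) ℝ}
    {T : EuclideanSpace ℝ (Fin n) → Fin n → ℝ}
    (hG : ∀ i j, ContDiffAt ℝ ∞ (fun z => G z i j) y) (hu : IsUnit (G y))
    (hT : ∀ i, ContDiffAt ℝ ∞ (fun z => T z i) y) :
    ContinuousAt (fun z => normSq₁ (G z) (T z)) y := by
  have h1 : ∀ i j, ContinuousAt (fun z => (G z)⁻¹ i j) y := fun i j =>
    ((contDiffWithinAt_inv_matrix (s := univ) (fun i j => (hG i j).contDiffWithinAt) hu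
      i j).contDiffAt Filter.univ_mem).continuousAt
  have h2 := fun i => (hT i).continuousAt
  simp only [normSq₁]
  fun_prop

omit [NeZero n] in
lemma continuousAt_normSq₂ {G : EuclideanSpace ℝ (Fin n) → Matrix (Fin n) (Fin n) ℝ}
    {T : EuclideanSpace ℝ (Fin n) → Fin n → Fin n → ℝ}
    (hG : ∀ i j, ContDiffAt ℝ ∞ (fun z => G z i j) y) (hu : IsUnit (G y))
    (hT : ∀ i j, ContDiffAt ℝ ∞ (fun z => T z i j) y) :
    ContinuousAt (fun z => normSq₂ (G z) (T z)) y := by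
  have h1 : ∀ i j, ContinuousAt (fun z => (G z)⁻¹ i j) y := fun i j =>
    ((contDiffWithinAt_inv_matrix (s := univ) (fun i j => (hG i j).contDiffWithinAt) hu
      i j).contDiffAt Filter.univ_mem).continuousAt
  have h2 := fun i j => (hT i j).continuousAt
  simp only [normSq₂]
  fun_prop

omit [NeZero n] in
lemma continuousAt_normSq₃ {G : EuclideanSpace ℝ (Fin n) → Matrix (Fin n) (Fin n) ℝ}
    {T : EuclideanSpace ℝ (Fin n) → Fin n → Fin n → Fin n → ℝ}
    (hG : ∀ i j, ContDiffAt ℝ ∞ (fun z => G z i j) y) (hu : IsUnit (G y))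
    (hT : ∀ i j k, ContDiffAt ℝ ∞ (fun z => T z i j k) y) :
    ContinuousAt (fun z => normSq₃ (G z) (T z)) y := by
  have h1 : ∀ i j, ContinuousAt (fun z => (G z)⁻¹ i j) y := fun i j =>
    ((contDiffWithinAt_inv_matrix (s := univ) (fun i j => (hG i j).contDiffWithinAt) hu
      i j).contDiffAt Filter.univ_mem).continuousAt
  have h2 := fun i j k => (hT i j k).continuousAt
  simp only [normSq₃]
  fun_prop

include hN

/-- A function that is continuous in the coordinates is continuous on the manifold. -/
lemma RegularOn.continuousOn_of_chart {F : M → ℝ}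
    {Fc : M → EuclideanSpace ℝ (Fin n) → ℝ}
    (hF : ∀ p, ∀ y ∈ chartDomain p N, F ((φ p).symm y) = Fc p y)
    (hc : ∀ p, ∀ y ∈ chartDomain p N, ContinuousAt (Fc p) y) : ContinuousOn F N := by
  intro x hx
  have hy : φ x x ∈ chartDomain x N := by
    refine ⟨mem_extChartAt_target x, ?_⟩
    rw [mem_preimage, extChartAt_to_inv]
    exact hx
  have h1 : ContinuousAt (Fc x ∘ φ x) x := (hc x _ hy).comp (continuousAt_extChartAt x)
  refine (h1.congr ?_).continuousWithinAt
  filter_upwards [hN.isOpen.mem_nhds hx, extChartAt_source_mem_nhds (I := 𝓡∂ n) x] with z hz hzs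
  have hz' : φ x z ∈ chartDomain x N := by
    refine ⟨(φ x).map_source hzs, ?_⟩
    rw [mem_preimage, (φ x).left_inv hzs]
    exact hz
  rw [Function.comp, ← hF x _ hz', (φ x).left_inv hzs]

lemma RegularOn.continuousOn_formNormSq : ContinuousOn (formNormSq 𝓐.g X) N :=
  hN.continuousOn_of_chart (fun _ _ hy => hN.formNormSq_eq hy) fun _ _ hy =>
    continuousAt_normSq₁ (hN.contDiffAt_metricCoord hy) (hN.posDef_metricCoord hy).isUnit
      (hN.contDiffAt_formCoord hy)

lemma RegularOn.contDiffAt_flatCov (hy : y ∈ chartDomain p N) (i j : Fin n) :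
    ContDiffAt ℝ ∞ (fun z => flatCov (metricCoord 𝓐.g p) (formCoord X p) z i j) y :=
  _root_.contDiffAt_flatCov (hN.mem_openHalf hy) (hN.contDiffAt_metricCoord hy)
    (hN.posDef_metricCoord hy).isUnit (hN.contDiffAt_formCoord hy) i j

lemma RegularOn.continuousOn_covDerivNormSq : ContinuousOn (covDerivNormSq 𝓐.g X) N :=
  hN.continuousOn_of_chart (fun _ _ hy => hN.covDerivNormSq_eq hy) fun _ _ hy =>
    continuousAt_normSq₂ (hN.contDiffAt_metricCoord hy) (hN.posDef_metricCoord hy).isUnit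
      (hN.contDiffAt_flatCov hy)

lemma RegularOn.continuousOn_killingNormSq : ContinuousOn (killingNormSq 𝓐.g X) N :=
  hN.continuousOn_of_chart (fun _ _ hy => hN.killingNormSq_eq hy) fun _ _ hy =>
    continuousAt_normSq₂ (hN.contDiffAt_metricCoord hy) (hN.posDef_metricCoord hy).isUnit
      fun i j => contDiffAt_const.mul ((hN.contDiffAt_flatCov hy i j).add
        (hN.contDiffAt_flatCov hy j i))

lemma RegularOn.continuousOn_opUNormSq : ContinuousOn (opUNormSq 𝓐.g X) N :=
  hN.continuousOn_of_chart (fun _ _ hy => hN.opUNormSq_eq hy) fun _ _ hy =>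
    continuousAt_normSq₃ (hN.contDiffAt_metricCoord hy) (hN.posDef_metricCoord hy).isUnit
      fun k j i => ((contDiffAt_flatCovTwo (hN.mem_openHalf hy) (hN.contDiffAt_metricCoord hy)
        (hN.posDef_metricCoord hy).isUnit (hN.contDiffAt_flatCov hy) k j i).sub
          ((hN.contDiffAt_metricCoord hy j k).mul (hN.contDiffAt_formCoord hy i))).add
          ((hN.contDiffAt_metricCoord hy i k).mul (hN.contDiffAt_formCoord hy j))

lemma RegularOn.contDiffAt_densityCoeff (hy : y ∈ chartDomain p N) (k : Fin n)
    (α β : PairIndex n) :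
    ContDiffAt ℝ ∞ (densityCoeff (𝓐.hCoord p) (𝓐.rCoord p) k α β) y := by
  have hO := isOpen_chartDomain hN.isOpen hN.interior p
  have he : chartDomain p N ∩ range (𝓡∂ n) = chartDomain p N :=
    inter_eq_left.2 ((chartDomain_subset_openHalf hN.interior p).trans interior_subset)
  have h1 := contDiffOn_densityCoeff (h := 𝓐.hCoord p) (r := 𝓐.rCoord p) hO
    (fun i j z hz => (hN.contDiffAt_hCoord (he ▸ hz) i j).contDiffWithinAt)
    (fun z hz => posDef_hCoord (he ▸ hz))
    (fun z hz => (hN.contDiffAt_rCoord (he ▸ hz)).contDiffWithinAt) k α β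
  rw [he] at h1
  exact h1.contDiffAt (hO.mem_nhds hy)

lemma RegularOn.contDiffAt_currentDensity (hy : y ∈ chartDomain p N) (k : Fin n) :
    ContDiffAt ℝ ∞ (fun z => currentDensity (𝓐.hCoord p) (𝓐.rCoord p) (formCoord X p) z k) y :=
  _root_.contDiffAt_currentDensity (hN.mem_openHalf hy) (hN.contDiffAt_rCoord hy)
    (hN.contDiffAt_formCoord hy) (hN.contDiffAt_densityCoeff hy) k

omit hN in
variable (𝓐 X) in
lemma sqrt_det_mul_chartPairing (ψ : M → ℝ) (p : M) (y : EuclideanSpace ℝ (Fin n)) :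
    Real.sqrt (𝓐.hCoord p y).det * chartPairing 𝓐 X ψ p y
      = flatGrad (ψ ∘ (φ p).symm) y
        ⬝ᵥ currentDensity (𝓐.hCoord p) (𝓐.rCoord p) (formCoord X p) y := by
  rw [chartPairing, ← smul_eq_mul, ← dotProduct_smul]
  rfl

/-- The pairing of the differential of a function with the current is continuous. The chart used at
a point varies with the point, so this rests on the independence of the chart. -/
lemma RegularOn.continuousOn_chartPairing {ψ : M → ℝ} (hψ : ContMDiff (𝓡∂ n) 𝓘(ℝ, ℝ) ∞ ψ) :
    ContinuousOn (fun x => chartPairing 𝓐 X ψ x (φ x x)) N := by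
  refine hN.continuousOn_of_chart (Fc := fun p y => (Real.sqrt (𝓐.hCoord p y).det)⁻¹ *
    (flatGrad (ψ ∘ (φ p).symm) y
      ⬝ᵥ currentDensity (𝓐.hCoord p) (𝓐.rCoord p) (formCoord X p) y))
    (fun p y hy => ?_) fun p y hy => ?_
  · have h0 : Real.sqrt (𝓐.hCoord p y).det ≠ 0 := (Real.sqrt_pos.2 (posDef_hCoord hy).det_pos).ne'
    rw [← sqrt_det_mul_chartPairing 𝓐 X ψ p y, inv_mul_cancel_left₀ h0, hN.chartPairing_eq hy hψ]
  · have h0 : Real.sqrt (𝓐.hCoord p y).det ≠ 0 := (Real.sqrt_pos.2 (posDef_hCoord hy).det_pos).ne'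
    have h1 : ContinuousAt (fun z => (𝓐.hCoord p z).det) y :=
      ((contDiffWithinAt_det (s := univ) fun i j =>
        (hN.contDiffAt_hCoord hy i j).contDiffWithinAt).contDiffAt Filter.univ_mem).continuousAt
    have h2 : ∀ k, ContinuousAt (fun z => flatGrad (ψ ∘ (φ p).symm) z k) y := fun k =>
      (contDiffAt_partialDeriv (hN.mem_openHalf hy) k (contDiffAt_of_contDiffOn_target hy.1
        (hN.mem_openHalf hy) (contDiffOn_comp_symm hψ p))).continuousAt
    have h3 := fun k => (hN.contDiffAt_currentDensity hy k).continuousAt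
    refine (h1.sqrt.inv₀ h0).mul ?_
    simp only [dotProduct]
    fun_prop

end Continuity

end AsymptoticallyHyperbolic

end Invariance

end

noncomputable section

/-! ### The Riemannian measure in a chart -/

section RiemannianMeasure

variable {n : ℕ} [NeZero n] {M : Type*} [TopologicalSpace M]
  [ChartedSpace (EuclideanHalfSpace n) M] [MeasurableSpace M] [BorelSpace M]

local notation "φ" => extChartAt (𝓡∂ n)

omit [MeasurableSpace M] [BorelSpace M] in
lemma measurableSet_extChartAt_target (p : M) : MeasurableSet (φ p).target := by
  rw [extChartAt_target]
  exact (((chartAt (EuclideanHalfSpace n) p).open_target.preimage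
    (𝓡∂ n).continuous_symm).measurableSet).inter (𝓡∂ n).isClosed_range.measurableSet

lemma measurableSet_inter_preimage_of_continuousOn {V W : Type*} [TopologicalSpace V]
    [MeasurableSpace V] [OpensMeasurableSpace V] [TopologicalSpace W] [MeasurableSpace W]
    [BorelSpace W] {f : V → W} {s : Set V} (hf : ContinuousOn f s) (hs : MeasurableSet s)
    {t : Set W} (ht : MeasurableSet t) : MeasurableSet (s ∩ f ⁻¹' t) := by
  have h1 : Measurable (s.domRestrict f) := (continuousOn_iff_continuous_domRestrict.1 hf).measurable
  have h2 := hs.subtype_image (h1 ht)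
  convert h2 using 1
  ext x
  exact ⟨fun h => ⟨⟨x, h.1⟩, h.2, rfl⟩, by rintro ⟨z, hz, rfl⟩; exact ⟨z.2, hz⟩⟩

lemma measurableSet_chartDomain (p : M) {B : Set M} (hB : MeasurableSet B) :
    MeasurableSet (chartDomain (n := n) p B) :=
  measurableSet_inter_preimage_of_continuousOn (continuousOn_extChartAt_symm p)
    (measurableSet_extChartAt_target p) hB

/-- The density of the Riemannian measure in a chart. -/
abbrev volumeDensity (g : BilinField n M) (p : M) (y : EuclideanSpace ℝ (Fin n)) : ℝ≥0∞ :=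
  ENNReal.ofReal (Real.sqrt (metricCoord g p y).det)

lemma aemeasurable_extChartAt_symm (g : BilinField n M) (p : M) :
    AEMeasurable (φ p).symm ((volume.restrict (φ p).target).withDensity (volumeDensity g p)) :=
  ((continuousOn_extChartAt_symm p).aemeasurable (measurableSet_extChartAt_target p)).mono_ac
    (withDensity_absolutelyContinuous _ _)

lemma chartVolume_restrict (g : BilinField n M) (p : M) {B : Set M} (hB : MeasurableSet B) :
    (chartVolume g p).restrict B
      = Measure.map (φ p).symm ((volume.restrict (chartDomain p B)).withDensity
        (volumeDensity g p)) := by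
  have h := aemeasurable_extChartAt_symm g p
  rw [chartVolume]
  ext t ht
  rw [Measure.restrict_apply ht, Measure.map_apply_of_aemeasurable h (ht.inter hB),
    Measure.map_apply_of_aemeasurable _ ht, withDensity_apply', withDensity_apply',
    Measure.restrict_restrict', Measure.restrict_restrict' (measurableSet_chartDomain p hB)]
  · congr 2
    ext y
    simp only [chartDomain, mem_inter_iff, mem_preimage]
    tauto
  · exact measurableSet_extChartAt_target p
  · refine AEMeasurable.mono_ac ?_ (withDensity_absolutelyContinuous _ _)
    exact ((continuousOn_extChartAt_symm p).mono inter_subset_left).aemeasurable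
      (measurableSet_chartDomain p hB)

lemma chartVolume_apply (g : BilinField n M) (p : M) {B : Set M} (hB : MeasurableSet B) :
    chartVolume g p B = ∫⁻ y in chartDomain p B, volumeDensity g p y := by
  rw [chartVolume, Measure.map_apply_of_aemeasurable (aemeasurable_extChartAt_symm g p) hB,
    withDensity_apply', Measure.restrict_restrict' (measurableSet_extChartAt_target p)]
  congr 2
  rw [chartDomain, inter_comm]

variable [IsManifold (𝓡∂ n) ∞ M]

lemma det_fderiv_eq_det_jac {τ : EuclideanSpace ℝ (Fin n) → EuclideanSpace ℝ (Fin n)}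
    {y : EuclideanSpace ℝ (Fin n)} (hy : y ∈ openHalf n) (hτ : DifferentiableAt ℝ τ y) :
    (fderiv ℝ τ y).det = (jac τ y).det := by
  rw [ContinuousLinearMap.det, ← LinearMap.det_toMatrix (EuclideanSpace.basisFun (Fin n) ℝ).toBasis]
  congr 1
  ext a i
  rw [LinearMap.toMatrix_apply]
  have := ((EuclideanSpace.proj (𝕜 := ℝ) a).hasFDerivAt.comp y hτ.hasFDerivAt).fderiv
  have h2 : jac τ y a i = fderiv ℝ (fun z => τ z a) y (EuclideanSpace.single i (1 : ℝ)) :=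
    partialDeriv_eq_fderiv hy i _
  have h3 : fderiv ℝ (fun z => τ z a) y = (EuclideanSpace.proj a).comp (fderiv ℝ τ y) := this
  rw [h2, h3]
  simp

/-- The measures of two charts agree on the interior points of the overlap. -/
lemma chartVolume_eq_chartVolume (g : BilinField n M) (p q : M) {B : Set M} (hB : MeasurableSet B)
    (hBi : B ⊆ (𝓡∂ n).interior M) (hp : B ⊆ (φ p).source) (hq : B ⊆ (φ q).source) :
    chartVolume g q B = chartVolume g p B := by
  have hsub := chartDomain_subset_openHalf hBi q
  have hτ : ∀ y ∈ chartDomain (n := n) q B, ContDiffAt ℝ ∞ (transition p q) y := fun y hy =>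
    (contDiffWithinAt_transition p q hy.1 (hp hy.2)).contDiffAt (openHalf_mem_nhds (hsub hy))
  have hinj : InjOn (transition p q) (chartDomain (n := n) q B) := by
    intro y hy z hz h
    have h1 : (φ q).symm y = (φ q).symm z := (φ p).injOn (hp hy.2) (hp hz.2) h
    exact (φ q).symm.injOn hy.1 hz.1 h1
  have himg : transition p q '' chartDomain (n := n) q B = chartDomain (n := n) p B := by
    ext z
    constructor
    · rintro ⟨y, hy, rfl⟩
      refine ⟨(φ p).map_source (hp hy.2), ?_⟩
      rw [mem_preimage, transition, (φ p).left_inv (hp hy.2)]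
      exact hy.2
    · intro hz
      refine ⟨φ q ((φ p).symm z), ⟨(φ q).map_source (hq hz.2), ?_⟩, ?_⟩
      · rw [mem_preimage, (φ q).left_inv (hq hz.2)]
        exact hz.2
      · rw [transition, (φ q).left_inv (hq hz.2), (φ p).right_inv hz.1]
  rw [chartVolume_apply g q hB, chartVolume_apply g p hB, ← himg,
    lintegral_image_eq_lintegral_abs_det_fderiv_mul volume (measurableSet_chartDomain q hB)
      (fun y hy => ((hτ y hy).differentiableAt (by simp)).hasFDerivAt.hasFDerivWithinAt) hinj]
  refine setLIntegral_congr_fun (measurableSet_chartDomain q hB) fun y hy => ?_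
  simp only [volumeDensity]
  rw [det_fderiv_eq_det_jac (hsub hy) ((hτ y hy).differentiableAt (by simp)),
    ← ENNReal.ofReal_mul (abs_nonneg _), metricCoord_transition g p q hy.1 (hp hy.2)]
  congr 1
  rw [Matrix.det_mul, Matrix.det_mul, Matrix.det_transpose, mul_right_comm,
    Real.sqrt_mul (mul_self_nonneg _), Real.sqrt_mul_self_eq_abs]

/-- The Riemannian measure is given by the density of a chart, on the interior points of the
chart. -/
lemma riemannianMeasure_restrict (g : BilinField n M) (p : M) {A : Set M} (hA : MeasurableSet A)
    (hAi : A ⊆ (𝓡∂ n).interior M) (hp : A ⊆ (φ p).source) :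
    (riemannianMeasure g).restrict A = (chartVolume g p).restrict A := by
  have hle : riemannianMeasure g
      ≤ (chartVolume g p).restrict A + (riemannianMeasure g).restrict Aᶜ := by
    refine iSup_le fun q => Measure.le_iff.2 fun B hB => ?_
    rw [Measure.add_apply, Measure.restrict_apply hB, Measure.restrict_apply hB,
      ← measure_inter_add_sdiff B hA, sdiff_eq]
    refine add_le_add ?_ (Measure.le_iff'.1 (le_iSup (fun q => chartVolume g q) q) _)
    have hs : MeasurableSet (φ q).source := (isOpen_extChartAt_source q).measurableSet
    have h1 : chartVolume g q (B ∩ A) = chartVolume g q (B ∩ A ∩ (φ q).source) := by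
      rw [chartVolume_apply g q (hB.inter hA), chartVolume_apply g q ((hB.inter hA).inter hs)]
      congr 2
      ext y
      simp only [chartDomain, mem_inter_iff, mem_preimage]
      exact ⟨fun h => ⟨h.1, h.2, (φ q).map_target h.1⟩, fun h => ⟨h.1, h.2.1⟩⟩
    rw [h1, chartVolume_eq_chartVolume g p q ((hB.inter hA).inter hs)
      (fun x hx => hAi hx.1.2) (fun x hx => hp hx.1.2) inter_subset_right]
    exact measure_mono inter_subset_left
  refine le_antisymm ?_ (Measure.restrict_mono le_rfl (le_iSup (fun q => chartVolume g q) p))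
  refine (Measure.restrict_mono le_rfl hle).trans ?_
  rw [Measure.restrict_add, Measure.restrict_restrict hA, Measure.restrict_restrict hA, inter_self,
    inter_compl_self, Measure.restrict_empty, add_zero]

lemma riemannianMeasure_apply (g : BilinField n M) (p : M) {A : Set M} (hA : MeasurableSet A)
    (hAi : A ⊆ (𝓡∂ n).interior M) (hp : A ⊆ (φ p).source) :
    riemannianMeasure g A = ∫⁻ y in chartDomain p A, volumeDensity g p y := by
  rw [← chartVolume_apply g p hA, ← Measure.restrict_apply_self, riemannianMeasure_restrict g p hA
    hAi hp, Measure.restrict_apply_self]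

/-- The integral of a function supported in the interior points of a chart. -/
lemma integral_riemannianMeasure_eq (g : BilinField n M) (p : M) {K : Set M} (hK : MeasurableSet K)
    (hKi : K ⊆ (𝓡∂ n).interior M) (hp : K ⊆ (φ p).source) {f : M → ℝ} (hf : ContinuousOn f K)
    (hf0 : ∀ x ∉ K, f x = 0)
    (hg : ContinuousOn (fun y => Real.sqrt (metricCoord g p y).det) (chartDomain p K)) :
    ∫ x, f x ∂(riemannianMeasure g)
      = ∫ y in chartDomain p K, Real.sqrt (metricCoord g p y).det * f ((φ p).symm y) := by
  have hKm := measurableSet_chartDomain (n := n) p hK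
  rw [← setIntegral_eq_integral_of_forall_compl_eq_zero hf0,
    riemannianMeasure_restrict g p hK hKi hp]
  have hfm : AEStronglyMeasurable f ((chartVolume g p).restrict K) :=
    hf.aestronglyMeasurable hK
  rw [chartVolume_restrict g p hK] at hfm ⊢
  have hsm : AEMeasurable (φ p).symm
      ((volume.restrict (chartDomain p K)).withDensity (volumeDensity g p)) :=
    AEMeasurable.mono_ac (((continuousOn_extChartAt_symm p).mono inter_subset_left).aemeasurable
      hKm) (withDensity_absolutelyContinuous _ _)
  rw [integral_map hsm hfm, integral_withDensity_eq_integral_toReal_smul₀]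
  · refine setIntegral_congr_fun hKm fun y _ => ?_
    simp only [volumeDensity, ENNReal.toReal_ofReal (Real.sqrt_nonneg _), smul_eq_mul]
  · exact (hg.aemeasurable hKm).ennreal_ofReal
  · exact Filter.Eventually.of_forall fun _ => ENNReal.ofReal_lt_top

/-- Compact sets of interior points have finite measure, if the metric is continuous. -/
lemma riemannianMeasure_lt_top (g : BilinField n M) {N K : Set M} (hN : IsOpen N)
    (hNi : N ⊆ (𝓡∂ n).interior M)
    (hg : ∀ p, ContinuousOn (fun y => Real.sqrt (metricCoord g p y).det) (chartDomain p N))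
    (hK : IsCompact K) (hKN : K ⊆ N) : riemannianMeasure g K < ⊤ := by
  refine hK.measure_lt_top_of_nhdsWithin fun x hx => ?_
  have hy : φ x x ∈ chartDomain x N := by
    refine ⟨mem_extChartAt_target x, ?_⟩
    rw [mem_preimage, extChartAt_to_inv]
    exact hKN hx
  obtain ⟨δ, hδ, hball⟩ := Metric.nhds_basis_closedBall.mem_iff.1
    ((isOpen_chartDomain hN hNi x).mem_nhds hy)
  have hAo : IsOpen ((φ x).source ∩ φ x ⁻¹' Metric.ball (φ x x) δ) :=
    (continuousOn_extChartAt x).isOpen_inter_preimage (isOpen_extChartAt_source x)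
      Metric.isOpen_ball
  set A := (φ x).source ∩ φ x ⁻¹' Metric.ball (φ x x) δ with hA
  have hdom : chartDomain x A ⊆ Metric.closedBall (φ x x) δ := by
    intro y hy
    have := hy.2.2
    rw [mem_preimage, (φ x).right_inv hy.1] at this
    exact Metric.ball_subset_closedBall this
  have hAi : A ⊆ (𝓡∂ n).interior M := by
    intro z hz
    have h1 := hball (Metric.ball_subset_closedBall hz.2)
    have h2 := h1.2
    rw [mem_preimage, (φ x).left_inv hz.1] at h2
    exact hNi h2
  refine ⟨A, mem_nhdsWithin_of_mem_nhds (hAo.mem_nhds ⟨mem_extChartAt_source x, by simpa⟩), ?_⟩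
  rw [riemannianMeasure_apply g x hAo.measurableSet hAi inter_subset_left]
  refine (lintegral_mono_set hdom).trans_lt ?_
  have h1 := ((hg x).mono hball).integrableOn_compact (μ := volume)
    (isCompact_closedBall (φ x x) δ)
  exact h1.lintegral_lt_top

end RiemannianMeasure

/-! ### Level sets are null sets -/

section LevelSets

open scoped Pointwise

/-- A level set without critical points is a null set. -/
lemma volume_level_set_eq_zero {V : Type*} [NormedAddCommGroup V] [NormedSpace ℝ V]
    [MeasurableSpace V] [BorelSpace V] [FiniteDimensional ℝ V] (μ : Measure V)
    [μ.IsAddHaarMeasure] {U : Set V} (hU : Convex ℝ U) (hUo : IsOpen U) {f : V → ℝ}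
    (hf : ∀ y ∈ U, DifferentiableAt ℝ f y) {v : V} (hv : ∀ y ∈ U, fderiv ℝ f y v ≠ 0) (c : ℝ) :
    μ (U ∩ f ⁻¹' {c}) = 0 := by
  -- distinct translates in the direction `v` are disjoint, by Rolle's theorem
  have hm : MeasurableSet (U ∩ f ⁻¹' {c}) := measurableSet_inter_preimage_of_continuousOn
    (fun y hy => (hf y hy).continuousAt.continuousWithinAt) hUo.measurableSet
    (measurableSet_singleton c)
  refine Measure.addHaar_eq_zero_of_disjoint_translates μ (fun k : ℕ => (1 / ((k : ℝ) + 1)) • v)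
    ?_ ?_ hm
  · refine (Metric.isBounded_closedBall (x := (0 : V)) (r := ‖v‖)).subset ?_
    rintro _ ⟨k, rfl⟩
    rw [mem_closedBall_zero_iff, norm_smul]
    have : ‖1 / ((k : ℝ) + 1)‖ ≤ 1 := by
      rw [Real.norm_of_nonneg (by positivity), div_le_one (by positivity)]
      linarith [(Nat.cast_nonneg k : (0 : ℝ) ≤ k)]
    nlinarith [norm_nonneg v]
  · intro i j hij
    rw [Function.onFun, Set.disjoint_left]
    rintro z ⟨_, rfl, a, ⟨haU, ha⟩, hza⟩ ⟨_, rfl, b, ⟨hbU, hb⟩, hzb⟩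
    simp only at hza hzb
    rw [mem_preimage, mem_singleton_iff] at ha hb
    set t : ℝ := 1 / ((i : ℝ) + 1) - 1 / ((j : ℝ) + 1) with ht
    have ht0 : t ≠ 0 := by
      intro h0
      apply hij
      rw [ht, sub_eq_zero, one_div, one_div, inv_inj] at h0
      exact_mod_cast add_right_cancel h0
    have hab : b - a = t • v := by
      rw [ht, sub_smul, sub_eq_sub_iff_add_eq_add, add_comm b]
      exact hzb.trans hza.symm
    have hseg : ∀ s ∈ Icc (0 : ℝ) 1, a + s • (b - a) ∈ U := fun s hs =>
      hU.add_smul_sub_mem haU hbU hs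
    have hd : ∀ s ∈ Icc (0 : ℝ) 1, HasDerivAt (fun s : ℝ => f (a + s • (b - a)))
        (fderiv ℝ f (a + s • (b - a)) (b - a)) s := by
      intro s hs
      have h1 : HasDerivAt (fun s : ℝ => a + s • (b - a)) (b - a) s := by
        simpa using ((hasDerivAt_id s).smul_const (b - a)).const_add a
      exact (hf _ (hseg s hs)).hasFDerivAt.comp_hasDerivAt s h1
    obtain ⟨s, hs, hs0⟩ := exists_hasDerivAt_eq_zero (f := fun s : ℝ => f (a + s • (b - a)))
      (f' := fun s => fderiv ℝ f (a + s • (b - a)) (b - a)) zero_lt_one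
      (fun s hs => (hd s hs).continuousAt.continuousWithinAt) (by simp [ha, hb])
      fun s hs => hd s (Ioo_subset_Icc_self hs)
    rw [hab, map_smul, smul_eq_mul] at hs0
    have := hseg s (Ioo_subset_Icc_self hs)
    rw [hab] at this
    exact hv _ this ((mul_eq_zero.1 hs0).resolve_left ht0)

variable {n : ℕ} [NeZero n] {M : Type*} [TopologicalSpace M]
  [ChartedSpace (EuclideanHalfSpace n) M] [MeasurableSpace M] [BorelSpace M]
  [IsManifold (𝓡∂ n) ∞ M]

local notation "φ" => extChartAt (𝓡∂ n)

/-- A compact level set of interior points without critical points is a null set of the Riemannian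
measure. -/
lemma riemannianMeasure_level_set_eq_zero (g : BilinField n M) {f : M → ℝ}
    (hf : ContMDiff (𝓡∂ n) 𝓘(ℝ, ℝ) ∞ f) {c : ℝ} (hc : IsCompact (f ⁻¹' {c}))
    (hi : f ⁻¹' {c} ⊆ (𝓡∂ n).interior M)
    (hd : ∀ x ∈ f ⁻¹' {c}, ∃ p, x ∈ (φ p).source ∧ flatGrad (f ∘ (φ p).symm) (φ p x) ≠ 0) :
    riemannianMeasure g (f ⁻¹' {c}) = 0 := by
  refine hc.measure_zero_of_nhdsWithin fun x hx => ?_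
  obtain ⟨p, hxp, hne⟩ := hd x hx
  obtain ⟨k, hk⟩ := Function.ne_iff.1 hne
  have hNo : IsOpen ((𝓡∂ n).interior M) := (𝓡∂ n).isOpen_interior (n := ∞) (by simp)
  have hDo := isOpen_chartDomain hNo subset_rfl p
  have hy : φ p x ∈ chartDomain p ((𝓡∂ n).interior M) := by
    refine ⟨(φ p).map_source hxp, ?_⟩
    rw [mem_preimage, (φ p).left_inv hxp]
    exact hi hx
  have hsm : ∀ y ∈ chartDomain p ((𝓡∂ n).interior M), ContDiffAt ℝ ∞ (f ∘ (φ p).symm) y :=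
    fun y hy => ((contDiffOn_comp_symm hf p).mono inter_subset_left).contDiffAt (hDo.mem_nhds hy)
  have hcont : ContinuousAt (fun z => partialDeriv k (f ∘ (φ p).symm) z) (φ p x) :=
    (contDiffAt_partialDeriv (chartDomain_subset_openHalf subset_rfl p hy) k
      (hsm _ hy)).continuousAt
  obtain ⟨δ, hδ, hball⟩ := Metric.mem_nhds_iff.1 (Filter.inter_mem (hDo.mem_nhds hy)
    (hcont.eventually_ne hk))
  have hnull := volume_level_set_eq_zero (volume : Measure (EuclideanSpace ℝ (Fin n)))
    (convex_ball (φ p x) δ) Metric.isOpen_ball (f := f ∘ (φ p).symm)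
    (v := EuclideanSpace.single k (1 : ℝ))
    (fun y hy => (hsm y (hball hy).1).differentiableAt (by simp))
    (fun y hy => by
      rw [← partialDeriv_eq_fderiv (chartDomain_subset_openHalf subset_rfl p (hball hy).1)]
      exact (hball hy).2) c
  have hAo : IsOpen ((φ p).source ∩ φ p ⁻¹' Metric.ball (φ p x) δ) :=
    (continuousOn_extChartAt p).isOpen_inter_preimage (isOpen_extChartAt_source p)
      Metric.isOpen_ball
  set A := (φ p).source ∩ φ p ⁻¹' Metric.ball (φ p x) δ with hA
  have hLm : MeasurableSet (f ⁻¹' {c}) :=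
    hf.continuous.measurable (measurableSet_singleton c)
  refine ⟨A ∩ f ⁻¹' {c}, Filter.inter_mem (mem_nhdsWithin_of_mem_nhds
    (hAo.mem_nhds ⟨hxp, by simpa⟩)) self_mem_nhdsWithin, ?_⟩
  rw [riemannianMeasure_apply g p (hAo.measurableSet.inter hLm) (fun z hz => hi hz.2)
    fun z hz => hz.1.1]
  refine setLIntegral_measure_zero _ _ (measure_mono_null ?_ hnull)
  intro y hy
  have h1 := hy.2.1.2
  rw [mem_preimage, (φ p).right_inv hy.1] at h1
  exact ⟨h1, hy.2.2⟩

end LevelSets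

end

noncomputable section

/-! ### The divergence theorem in a chart -/

section FlatDivergence

variable {n : ℕ} [NeZero n]

lemma integral_fderiv_eq_zero {V : Type*} [NormedAddCommGroup V] [NormedSpace ℝ V]
    [MeasurableSpace V] [BorelSpace V] [FiniteDimensional ℝ V] (μ : Measure V)
    [μ.IsAddHaarMeasure] {B : V → ℝ} (hB : ContDiff ℝ 1 B) (hc : HasCompactSupport B) (v : V) :
    Integrable (fun y => fderiv ℝ B y v) μ ∧ ∫ y, fderiv ℝ B y v ∂μ = 0 := by
  have hi : Integrable (fun y => fderiv ℝ B y v) μ :=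
    ((hB.continuous_fderiv (by simp)).clm_apply continuous_const).integrable_of_hasCompactSupport
      (hc.fderiv_apply ℝ v)
  have hd : Differentiable ℝ B := hB.differentiable (by simp)
  have h := integral_mul_fderiv_eq_neg_fderiv_mul_of_integrable (μ := μ) (f := fun _ : V => (1 : ℝ))
    (g := B) (v := v) (by simp) (by simpa using hi)
    (by simpa using hB.continuous.integrable_of_hasCompactSupport hc)
    (fun _ _ => differentiableAt_const _) fun y _ => hd y
  exact ⟨hi, by simpa using h⟩

/-- The partial derivatives of a function with compact support `K` in the open half space have
integral zero; the function matters only near `K`. -/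
lemma setIntegral_partialDeriv_eq_zero {W K : Set (EuclideanSpace ℝ (Fin n))} (hW : IsOpen W)
    (hWi : W ⊆ openHalf n) (hK : IsCompact K) (hKW : K ⊆ W) {B : EuclideanSpace ℝ (Fin n) → ℝ}
    (hB : ∀ y ∈ W, ContDiffAt ℝ ∞ B y) (hB0 : ∀ y ∈ W, y ∉ K → B y = 0) (k : Fin n) :
    IntegrableOn (partialDeriv k B) K ∧ ∫ y in K, partialDeriv k B y = 0 := by
  have hnear : ∀ y ∈ W, W.indicator B =ᶠ[nhds y] B := fun y hy => by
    filter_upwards [hW.mem_nhds hy] with z hz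
    exact indicator_of_mem hz B
  have hfar : ∀ y ∉ K, W.indicator B =ᶠ[nhds y] fun _ => 0 := fun y hy => by
    filter_upwards [hK.isClosed.isOpen_compl.mem_nhds hy] with z hz
    by_cases hzW : z ∈ W
    · rw [indicator_of_mem hzW, hB0 z hzW hz]
    · exact indicator_of_notMem hzW B
  have hC : ContDiff ℝ 1 (W.indicator B) := contDiff_iff_contDiffAt.2 fun y => by
    by_cases hy : y ∈ W
    · exact ((hB y hy).of_le (by simp)).congr_of_eventuallyEq (hnear y hy)
    · exact contDiffAt_const.congr_of_eventuallyEq (hfar y fun h => hy (hKW h))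
  have hcs : HasCompactSupport (W.indicator B) :=
    HasCompactSupport.intro hK fun y hy => (hfar y hy).self_of_nhds
  obtain ⟨hi, h0⟩ := integral_fderiv_eq_zero (volume : Measure (EuclideanSpace ℝ (Fin n))) hC hcs
    (EuclideanSpace.single k (1 : ℝ))
  have hon : EqOn (fun y => fderiv ℝ (W.indicator B) y (EuclideanSpace.single k (1 : ℝ)))
      (partialDeriv k B) K := fun y hy => by
    rw [partialDeriv_eq_fderiv (hWi (hKW hy))]
    exact congrArg (fun L : EuclideanSpace ℝ (Fin n) →L[ℝ] ℝ =>
      L (EuclideanSpace.single k (1 : ℝ))) (hnear y (hKW hy)).fderiv_eq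
  have hoff : ∀ y ∉ K, fderiv ℝ (W.indicator B) y (EuclideanSpace.single k (1 : ℝ)) = 0 :=
    fun y hy => by rw [(hfar y hy).fderiv_eq]; simp
  refine ⟨(hi.integrableOn (s := K)).congr_fun hon hK.measurableSet, ?_⟩
  rw [← setIntegral_congr_fun hK.measurableSet hon, setIntegral_eq_integral_of_forall_compl_eq_zero
    hoff, h0]

end FlatDivergence

/-! ### The divergence estimate in a chart of the manifold -/

namespace AsymptoticallyHyperbolic

variable {n : ℕ} [NeZero n] {M : Type*} [TopologicalSpace M]
  [ChartedSpace (EuclideanHalfSpace n) M] [IsManifold (𝓡∂ n) ∞ M]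

local notation "φ" => extChartAt (𝓡∂ n)

section ChartEstimate

variable (𝓐 : AsymptoticallyHyperbolic n M)

/-- The condition `|dρ| = 1` on the boundary at infinity, in an arbitrary chart. -/
lemma normSq₁_flatGrad_rCoord (p : M) {y : EuclideanSpace ℝ (Fin n)} (hy : y ∈ (φ p).target)
    (h0 : 𝓐.rCoord p y = 0) : normSq₁ (𝓐.hCoord p y) (flatGrad (𝓐.rCoord p) y) = 1 := by
  set x := (φ p).symm y with hx
  have hxs : x ∈ (φ x).source := mem_extChartAt_source x
  have hg := metricCoord_transition (fun x => 𝓐.h.inner x) x p hy hxs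
  have hA : IsUnit (jac (transition x p) y) := by
    have h2 := (_root_.posDef_metricCoord 𝓐.h p hy).isUnit
    rw [hg, Matrix.isUnit_iff_isUnit_det, Matrix.det_mul] at h2
    rw [Matrix.isUnit_iff_isUnit_det]
    exact isUnit_of_mul_isUnit_right h2
  rw [← formCoord_mfderiv 𝓐.smooth p hy, hCoord, hg,
    formCoord_transition (fun z => mfderiv (𝓡∂ n) 𝓘(ℝ, ℝ) 𝓐.ρ z) x p hy hxs]
  exact (normSq₁_congruence (_root_.posDef_metricCoord 𝓐.h x ((φ x).map_source hxs)) hA _).trans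
    (𝓐.normSq_dρ x h0)

omit [IsManifold (𝓡∂ n) ∞ M] in
lemma isCompact_image_extChartAt {p : M} {T : Set M} (hT : IsCompact T)
    (hTp : T ⊆ (φ p).source) : IsCompact (φ p '' T) :=
  hT.image_of_continuousOn ((continuousOn_extChartAt p).mono hTp)

omit [IsManifold (𝓡∂ n) ∞ M] in
/-- The target of a chart is relatively open in the half space. -/
lemma exists_isOpen_inter_range_eq_target (p : M) :
    ∃ O : Set (EuclideanSpace ℝ (Fin n)), IsOpen O ∧ O ∩ range (𝓡∂ n) = (φ p).target :=
  ⟨_, (chartAt (EuclideanHalfSpace n) p).open_target.preimage (𝓡∂ n).continuous_symm,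
    (extChartAt_target (I := 𝓡∂ n) p).symm⟩

/-- The gradient of the defining function does not vanish near infinity. -/
lemma exists_flatGrad_rCoord_ne_zero {p : M} {T : Set M} (hT : IsCompact T)
    (hTp : T ⊆ (φ p).source) :
    ∃ ε : ℝ, 0 < ε ∧ ∀ x ∈ T, 𝓐.ρ x ≤ ε → flatGrad (𝓐.rCoord p) (φ p x) ≠ 0 := by
  obtain ⟨O, hO, hOt⟩ := exists_isOpen_inter_range_eq_target (n := n) p
  have hK := isCompact_image_extChartAt hT hTp
  have hKt : φ p '' T ⊆ (φ p).target := image_subset_iff.2 fun x hx => (φ p).map_source (hTp hx)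
  have hr : ContDiffOn ℝ ∞ (𝓐.rCoord p) (O ∩ range (𝓡∂ n)) := by
    rw [hOt]
    exact contDiffOn_comp_symm 𝓐.smooth p
  have hcr : ∀ i, ContinuousOn (fun y => flatGrad (𝓐.rCoord p) y i) (φ p '' T) := fun i =>
    (contDiffOn_partialDeriv hO hr i).continuousOn.mono (by rw [hOt]; exact hKt)
  have hcH : ∀ i j, ContinuousOn (fun y => (𝓐.hCoord p y)⁻¹ i j) (φ p '' T) := fun i j =>
    (contDiffOn_inv_matrix (O := O) (h := 𝓐.hCoord p)
      (fun i j => by rw [hOt]; exact contDiffOn_metricCoord 𝓐.h p i j)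
      (fun y hy => _root_.posDef_metricCoord 𝓐.h p (hOt ▸ hy)) i j).continuousOn.mono
      (by rw [hOt]; exact hKt)
  obtain ⟨ε, hε, h⟩ := exists_abs_sub_one_le_of_isCompact hK
    (F := fun y => normSq₁ (𝓐.hCoord p y) (flatGrad (𝓐.rCoord p) y)) (r := 𝓐.rCoord p) (by
      simp only [normSq₁]
      exact continuousOn_finsetSum _ fun i _ => continuousOn_finsetSum _ fun j _ =>
        ((hcH i j).fun_mul (hcr i)).fun_mul (hcr j))
    (hr.continuousOn.mono (by rw [hOt]; exact hKt))
    (fun y hy h0 => 𝓐.normSq₁_flatGrad_rCoord p (hKt hy) h0) (half_pos one_pos)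
  refine ⟨ε, hε, fun x hx hxε hz => ?_⟩
  have h1 := h (φ p x) (mem_image_of_mem _ hx) (by
    rw [rCoord, Function.comp, (φ p).left_inv (hTp hx), abs_of_nonneg (𝓐.nonneg x)]
    exact hxε)
  simp only [hz, normSq₁, Pi.zero_apply, mul_zero, Finset.sum_const_zero, zero_sub, abs_neg,
    abs_one] at h1
  norm_num at h1

/-- The divergence estimate for the current in a chart, uniformly for all 1-forms. -/
lemma exists_chart_estimate {s : ℝ} (hs : s < 2) (hn : 3 ≤ n) : ∃ c : ℝ, 0 < c ∧
    ∀ (p : M) (T : Set M), IsCompact T → T ⊆ (φ p).source → ∃ ε C : ℝ, 0 < ε ∧ 0 ≤ C ∧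
      ∀ (X : OneForm n M) (N : Set M), 𝓐.RegularOn X N → ∀ y ∈ chartDomain p N,
        (φ p).symm y ∈ T → 𝓐.rCoord p y ≤ ε →
        Real.sqrt (𝓐.hCoord p y).det *
          (c * (formNormSq 𝓐.g X ((φ p).symm y) + covDerivNormSq 𝓐.g X ((φ p).symm y))
            - C * (killingNormSq 𝓐.g X ((φ p).symm y) + opUNormSq 𝓐.g X ((φ p).symm y)))
          ≤ ∑ k, 𝓐.rCoord p y * partialDeriv k
              (fun z => currentDensity (𝓐.hCoord p) (𝓐.rCoord p) (formCoord X p) z k) y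
            + (1 + 2 * s - n) * (flatGrad (𝓐.rCoord p) y
              ⬝ᵥ currentDensity (𝓐.hCoord p) (𝓐.rCoord p) (formCoord X p) y) := by
  obtain ⟨c, hc, H⟩ := exists_local_estimate (n := n) hs hn
  refine ⟨c, hc, fun p T hT hTp => ?_⟩
  obtain ⟨O, hO, hOt⟩ := exists_isOpen_inter_range_eq_target (n := n) p
  have hKt : φ p '' T ⊆ (φ p).target := image_subset_iff.2 fun x hx => (φ p).map_source (hTp hx)
  obtain ⟨ε, C, hε, hC, h⟩ := H O (φ p '' T) (𝓐.hCoord p) (𝓐.rCoord p) hO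
    (isCompact_image_extChartAt hT hTp) (by rw [hOt]; exact hKt)
    (fun i j => by rw [hOt]; exact contDiffOn_metricCoord 𝓐.h p i j)
    (fun y hy => _root_.posDef_metricCoord 𝓐.h p (hOt ▸ hy))
    (by rw [hOt]; exact contDiffOn_comp_symm 𝓐.smooth p)
    fun y hy h0 => 𝓐.normSq₁_flatGrad_rCoord p (hKt hy) h0
  refine ⟨ε, C, hε, hC, fun X N hN y hy hyT hyε => ?_⟩
  have hyK : y ∈ φ p '' T := ⟨_, hyT, (φ p).right_inv hy.1⟩
  rw [hN.formNormSq_eq hy, hN.covDerivNormSq_eq hy, hN.killingNormSq_eq hy, hN.opUNormSq_eq hy]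
  exact h y hyK (hN.mem_openHalf hy) (hN.rCoord_pos hy) hyε (metricCoord 𝓐.g p) (formCoord X p)
    (Filter.Eventually.of_forall fun z => 𝓐.metricCoord_g p z) (hN.contDiffAt_formCoord hy)

end ChartEstimate

end AsymptoticallyHyperbolic

end

noncomputable section

/-! ### The weighted divergence inequality on the manifold -/

namespace AsymptoticallyHyperbolic

variable {n : ℕ} [NeZero n] {M : Type*} [TopologicalSpace M]
  [ChartedSpace (EuclideanHalfSpace n) M] [IsManifold (𝓡∂ n) ∞ M]
  {𝓐 : AsymptoticallyHyperbolic n M} {X : OneForm n M} {N : Set M}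

local notation "φ" => extChartAt (𝓡∂ n)

open Matrix

section Pointwise

variable (hN : 𝓐.RegularOn X N) {p : M} {y : EuclideanSpace ℝ (Fin n)} (hy : y ∈ chartDomain p N)

include hN hy

omit hN in
/-- The flux of the current through the level sets of the defining function has a sign. -/
lemma flatGrad_dotProduct_currentDensity_nonpos :
    flatGrad (𝓐.rCoord p) y ⬝ᵥ currentDensity (𝓐.hCoord p) (𝓐.rCoord p) (formCoord X p) y ≤ 0 := by
  obtain ⟨B, -, hB⟩ := exists_frame (posDef_hCoord (𝓐 := 𝓐) hy)
  have h1 := dotProduct_current_nonpos (ν := flatGrad (𝓐.rCoord p) y)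
    (x := 𝓐.rCoord p y • formCoord X p y) (f := 𝓐.rCoord p y ^ 2 • flatCurl (formCoord X p) y) hB
    (by rw [transpose_smul, flatCurl_transpose, smul_neg])
  have h2 := sqrt_det_mul_chartPairing 𝓐 X 𝓐.ρ p y
  rw [← h2]
  exact mul_nonpos_of_nonneg_of_nonpos (Real.sqrt_nonneg _) h1

lemma RegularOn.sqrt_det_metricCoord : Real.sqrt (metricCoord 𝓐.g p y).det
    = (𝓐.rCoord p y ^ n)⁻¹ * Real.sqrt (𝓐.hCoord p y).det := by
  have hr := hN.rCoord_pos hy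
  rw [metricCoord_g, det_smul, Fintype.card_fin, Real.sqrt_mul (by positivity), ← inv_pow,
    ← pow_mul, mul_comm 2 n, pow_mul, Real.sqrt_sq (by positivity), inv_pow]

lemma RegularOn.contDiffAt_comp_symm {ψ : M → ℝ} (hψ : ContMDiff (𝓡∂ n) 𝓘(ℝ, ℝ) ∞ ψ) :
    ContDiffAt ℝ ∞ (ψ ∘ (φ p).symm) y :=
  contDiffAt_of_contDiffOn_target hy.1 (hN.mem_openHalf hy) (contDiffOn_comp_symm hψ p)

variable {ψ : M → ℝ} (hψ : ContMDiff (𝓡∂ n) 𝓘(ℝ, ℝ) ∞ ψ) {w : ℝ → ℝ}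
  (hw : ∀ t, 0 < t → ContDiffAt ℝ ∞ w t)

include hψ hw

/-- The divergence of the current, weighted with a function of the defining function and with a
cutoff function. -/
lemma RegularOn.sum_partialDeriv_weighted :
    ∑ k, partialDeriv k (fun z => (ψ ∘ (φ p).symm) z * w (𝓐.rCoord p z)
        * currentDensity (𝓐.hCoord p) (𝓐.rCoord p) (formCoord X p) z k) y
      = w (𝓐.rCoord p y) * (flatGrad (ψ ∘ (φ p).symm) y
          ⬝ᵥ currentDensity (𝓐.hCoord p) (𝓐.rCoord p) (formCoord X p) y)
        + (ψ ∘ (φ p).symm) y * (deriv w (𝓐.rCoord p y) * (flatGrad (𝓐.rCoord p) y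
            ⬝ᵥ currentDensity (𝓐.hCoord p) (𝓐.rCoord p) (formCoord X p) y)
          + w (𝓐.rCoord p y) * ∑ k, partialDeriv k
              (fun z => currentDensity (𝓐.hCoord p) (𝓐.rCoord p) (formCoord X p) z k) y) := by
  have hyo := hN.mem_openHalf hy
  have hr := (hN.contDiffAt_rCoord hy).differentiableAt (by simp)
  have hwd := (hw _ (hN.rCoord_pos hy)).differentiableAt (by simp)
  have hψd := (hN.contDiffAt_comp_symm hy hψ).differentiableAt (by simp)
  have hwr : DifferentiableAt ℝ (fun z => w (𝓐.rCoord p z)) y := hwd.comp y hr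
  have hJ := fun k => (hN.contDiffAt_currentDensity hy k).differentiableAt (by simp)
  have hchain : ∀ k, partialDeriv k (fun z => w (𝓐.rCoord p z)) y
      = deriv w (𝓐.rCoord p y) * flatGrad (𝓐.rCoord p) y k := fun k => by
    rw [flatGrad, partialDeriv_eq_fderiv hyo, partialDeriv_eq_fderiv hyo]
    have := (hwd.hasDerivAt.comp_hasFDerivAt y hr.hasFDerivAt).fderiv
    exact congrArg (fun L : EuclideanSpace ℝ (Fin n) →L[ℝ] ℝ =>
      L (EuclideanSpace.single k (1 : ℝ))) this
  simp only [dotProduct, Finset.mul_sum, mul_add, ← Finset.sum_add_distrib]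
  refine Finset.sum_congr rfl fun k _ => ?_
  rw [partialDeriv_mul hyo k (hψd.fun_mul hwr) (hJ k), partialDeriv_mul hyo k hψd hwr, hchain]
  simp only [flatGrad]
  ring

/-- The integrand of the weighted inequality is dominated by a divergence, if the weight decays
at least as fast as the power for which the divergence estimate holds. -/
lemma RegularOn.weighted_le_divergence (hψ0 : ∀ x, 0 ≤ ψ x) {β c C : ℝ}
    (hw0 : ∀ t, 0 < t → 0 ≤ w t) (hw' : ∀ t, 0 < t → t * deriv w t ≤ β * w t)
    (hest : (φ p).symm y ∈ tsupport ψ → Real.sqrt (𝓐.hCoord p y).det *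
        (c * (formNormSq 𝓐.g X ((φ p).symm y) + covDerivNormSq 𝓐.g X ((φ p).symm y))
          - C * (killingNormSq 𝓐.g X ((φ p).symm y) + opUNormSq 𝓐.g X ((φ p).symm y)))
      ≤ ∑ k, 𝓐.rCoord p y * partialDeriv k
          (fun z => currentDensity (𝓐.hCoord p) (𝓐.rCoord p) (formCoord X p) z k) y
        + β * (flatGrad (𝓐.rCoord p) y
          ⬝ᵥ currentDensity (𝓐.hCoord p) (𝓐.rCoord p) (formCoord X p) y)) :
    Real.sqrt (metricCoord 𝓐.g p y).det *
      (ψ ((φ p).symm y) * (w (𝓐.rCoord p y) * 𝓐.rCoord p y ^ (n - 1) *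
          (c * (formNormSq 𝓐.g X ((φ p).symm y) + covDerivNormSq 𝓐.g X ((φ p).symm y))
            - C * (killingNormSq 𝓐.g X ((φ p).symm y) + opUNormSq 𝓐.g X ((φ p).symm y))))
        + w (𝓐.rCoord p y) * 𝓐.rCoord p y ^ n *
          chartPairing 𝓐 X ψ ((φ p).symm y) (φ ((φ p).symm y) ((φ p).symm y)))
      ≤ ∑ k, partialDeriv k (fun z => (ψ ∘ (φ p).symm) z * w (𝓐.rCoord p z)
        * currentDensity (𝓐.hCoord p) (𝓐.rCoord p) (formCoord X p) z k) y := by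
  rw [hN.sum_partialDeriv_weighted hy hψ hw, hN.sqrt_det_metricCoord hy,
    ← hN.chartPairing_eq hy hψ, ← sqrt_det_mul_chartPairing 𝓐 X ψ p y]
  rw [← Finset.mul_sum] at hest
  have hflux := flatGrad_dotProduct_currentDensity_nonpos (𝓐 := 𝓐) (X := X) hy
  have hr := hN.rCoord_pos hy
  have hw0r := hw0 _ hr
  have hw'r := hw' _ hr
  have hn1 : 𝓐.rCoord p y ^ n = 𝓐.rCoord p y ^ (n - 1) * 𝓐.rCoord p y :=
    (pow_sub_one_mul (NeZero.ne n) _).symm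
  have hψy : (ψ ∘ (φ p).symm) y = ψ ((φ p).symm y) := rfl
  rw [hn1, hψy]
  have hψ00 := hψ0 ((φ p).symm y)
  have hψs : (φ p).symm y ∉ tsupport ψ → ψ ((φ p).symm y) = 0 := fun h =>
    image_eq_zero_of_notMem_tsupport h
  generalize 𝓐.rCoord p y = r at *
  generalize flatGrad (𝓐.rCoord p) y
    ⬝ᵥ currentDensity (𝓐.hCoord p) (𝓐.rCoord p) (formCoord X p) y = j at *
  generalize ∑ k, partialDeriv k
    (fun z => currentDensity (𝓐.hCoord p) (𝓐.rCoord p) (formCoord X p) z k) y = D at *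
  generalize c * (formNormSq 𝓐.g X ((φ p).symm y) + covDerivNormSq 𝓐.g X ((φ p).symm y))
    - C * (killingNormSq 𝓐.g X ((φ p).symm y) + opUNormSq 𝓐.g X ((φ p).symm y)) = E at *
  generalize chartPairing 𝓐 X ψ p y = P at *
  generalize Real.sqrt (𝓐.hCoord p y).det = S at *
  have hrn : r ^ (n - 1) ≠ 0 := (pow_pos hr _).ne'
  have key : ψ ((φ p).symm y) * (w r * (r⁻¹ * (S * E)))
      ≤ ψ ((φ p).symm y) * (deriv w r * j + w r * D) := by
    by_cases h : (φ p).symm y ∈ tsupport ψ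
    · refine mul_le_mul_of_nonneg_left ?_ hψ00
      rw [← mul_le_mul_iff_right₀ hr]
      have h1 : r * (w r * (r⁻¹ * (S * E))) = w r * (S * E) := by field_simp
      rw [h1]
      have h2 := mul_le_mul_of_nonneg_left (hest h) hw0r
      have h3 := mul_le_mul_of_nonpos_right hw'r hflux
      linarith
    · rw [hψs h, zero_mul, zero_mul]
  have h4 : (r ^ (n - 1) * r)⁻¹ * S * (ψ ((φ p).symm y) * (w r * r ^ (n - 1) * E)
        + w r * (r ^ (n - 1) * r) * P)
      = ψ ((φ p).symm y) * (w r * (r⁻¹ * (S * E))) + w r * (S * P) := by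
    field_simp
  rw [h4]
  linarith

end Pointwise

section Integration

variable [T2Space M] [MeasurableSpace M] [BorelSpace M] (hN : 𝓐.RegularOn X N)

include hN

omit [T2Space M] [MeasurableSpace M] [BorelSpace M] in
lemma RegularOn.continuousOn_sqrt_det (p : M) :
    ContinuousOn (fun y => Real.sqrt (metricCoord 𝓐.g p y).det) (chartDomain p N) := fun y hy => by
  have h1 : ContinuousAt (fun z => (metricCoord 𝓐.g p z).det) y :=
    ((contDiffWithinAt_det (s := univ) fun i j =>
      (hN.contDiffAt_metricCoord hy i j).contDiffWithinAt).contDiffAt Filter.univ_mem).continuousAt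
  exact h1.sqrt.continuousWithinAt

omit [T2Space M] in
lemma RegularOn.riemannianMeasure_lt_top {K : Set M} (hK : IsCompact K) (hKN : K ⊆ N) :
    riemannianMeasure 𝓐.g K < ⊤ :=
  _root_.riemannianMeasure_lt_top 𝓐.g hN.isOpen hN.interior hN.continuousOn_sqrt_det hK hKN

lemma RegularOn.integrableOn {K : Set M} (hK : IsCompact K) (hKN : K ⊆ N) {F : M → ℝ}
    (hF : ContinuousOn F N) : IntegrableOn F K (riemannianMeasure 𝓐.g) := by
  obtain ⟨C, hC⟩ := hK.exists_bound_of_continuousOn (hF.mono hKN)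
  exact IntegrableOn.of_bound (hN.riemannianMeasure_lt_top hK hKN)
    ((hF.mono hKN).aestronglyMeasurable hK.measurableSet) C
    (ae_restrict_of_forall_mem hK.measurableSet hC)

omit [T2Space M] [MeasurableSpace M] [BorelSpace M] in
lemma RegularOn.continuousOn_weight {w : ℝ → ℝ} (hw : ∀ t, 0 < t → ContDiffAt ℝ ∞ w t) :
    ContinuousOn (fun x => w (𝓐.ρ x)) N := fun x hx =>
  ((hw _ (hN.pos x hx)).continuousAt.comp 𝓐.smooth.continuous.continuousAt).continuousWithinAt

omit [T2Space M] [MeasurableSpace M] [BorelSpace M] in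
lemma RegularOn.currentDensity_eq_zero {p : M} {y : EuclideanSpace ℝ (Fin n)}
    (hy : y ∈ chartDomain p N) (h0 : ∀ᶠ z in nhds ((φ p).symm y), X z = 0) (k : Fin n) :
    currentDensity (𝓐.hCoord p) (𝓐.rCoord p) (formCoord X p) y k = 0 := by
  have hc : ContinuousAt (φ p).symm y :=
    ((continuousOn_extChartAt_symm p).mono inter_subset_left).continuousAt
      (hN.chartDomain_mem_nhds hy)
  have h1 : ∀ᶠ z in nhds y, ∀ i, formCoord X p z i = 0 := by
    filter_upwards [hc.eventually h0] with z hz i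
    rw [formCoord, hz]
    rfl
  have h2 : formCoord X p y = 0 := funext h1.self_of_nhds
  have h3 : flatCurl (formCoord X p) y = 0 := by
    ext i j
    have h4 : ∀ i j, partialDeriv i (fun z => formCoord X p z j) y = 0 := fun i j => by
      rw [partialDeriv_congr (f' := fun _ => (0 : ℝ)) i (h1.mono fun z hz => hz j),
        partialDeriv_eq_fderiv (hN.mem_openHalf hy)]
      simp
    rw [flatCurl, Matrix.of_apply, h4, h4]
    simp
  simp [currentDensity, h2, h3, current, currentScalar, contr]

variable {ψ : M → ℝ} (hψ : ContMDiff (𝓡∂ n) 𝓘(ℝ, ℝ) ∞ ψ) (hψ0 : ∀ x, 0 ≤ ψ x)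
  {w : ℝ → ℝ} (hw : ∀ t, 0 < t → ContDiffAt ℝ ∞ w t) {K : Set M} (hK : IsCompact K) (hKN : K ⊆ N)
  (hKX : ∀ x ∈ N, x ∉ K → w (𝓐.ρ x) = 0 ∨ ∀ᶠ z in nhds x, X z = 0) (c C : ℝ)

variable (𝓐 X ψ w) in
/-- The integrand of the weighted inequality, localized with the cutoff function `ψ`. The last term,
with the differential of `ψ`, disappears in the sum over a partition of unity. -/
def localizedIntegrand (x : M) : ℝ :=
  ψ x * (w (𝓐.ρ x) * 𝓐.ρ x ^ (n - 1) *
      (c * (formNormSq 𝓐.g X x + covDerivNormSq 𝓐.g X x)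
        - C * (killingNormSq 𝓐.g X x + opUNormSq 𝓐.g X x)))
    + w (𝓐.ρ x) * 𝓐.ρ x ^ n * chartPairing 𝓐 X ψ x (φ x x)

include hψ hw

omit [T2Space M] [MeasurableSpace M] [BorelSpace M] in
lemma RegularOn.continuousOn_localizedIntegrand :
    ContinuousOn (localizedIntegrand 𝓐 X ψ w c C) N := by
  have h1 := hN.continuousOn_weight hw
  have h2 : ContinuousOn 𝓐.ρ N := 𝓐.smooth.continuous.continuousOn
  have h3 : ContinuousOn ψ N := hψ.continuous.continuousOn
  have h4 := hN.continuousOn_formNormSq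
  have h5 := hN.continuousOn_covDerivNormSq
  have h6 := hN.continuousOn_killingNormSq
  have h7 := hN.continuousOn_opUNormSq
  have h8 := hN.continuousOn_chartPairing hψ
  exact (h3.fun_mul ((h1.fun_mul (h2.fun_pow _)).fun_mul
    ((continuousOn_const.fun_mul (h4.fun_add h5)).fun_sub
      (continuousOn_const.fun_mul (h6.fun_add h7))))).fun_add ((h1.fun_mul (h2.fun_pow _)).fun_mul h8)

include hψ0 hK hKN hKX in
/-- The integral of the localized integrand is nonpositive, because the integrand is dominated by the
divergence of a vector field with compact support in the chart. -/
lemma RegularOn.setIntegral_localizedIntegrand_nonpos {p : M} (hψp : tsupport ψ ⊆ (φ p).source)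
    {β : ℝ} (hw0 : ∀ t, 0 < t → 0 ≤ w t) (hw' : ∀ t, 0 < t → t * deriv w t ≤ β * w t)
    (hest : ∀ y ∈ chartDomain p N, (φ p).symm y ∈ tsupport ψ → Real.sqrt (𝓐.hCoord p y).det *
        (c * (formNormSq 𝓐.g X ((φ p).symm y) + covDerivNormSq 𝓐.g X ((φ p).symm y))
          - C * (killingNormSq 𝓐.g X ((φ p).symm y) + opUNormSq 𝓐.g X ((φ p).symm y)))
      ≤ ∑ k, 𝓐.rCoord p y * partialDeriv k
          (fun z => currentDensity (𝓐.hCoord p) (𝓐.rCoord p) (formCoord X p) z k) y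
        + β * (flatGrad (𝓐.rCoord p) y
          ⬝ᵥ currentDensity (𝓐.hCoord p) (𝓐.rCoord p) (formCoord X p) y)) :
    ∫ x in K, localizedIntegrand 𝓐 X ψ w c C x ∂(riemannianMeasure 𝓐.g) ≤ 0 := by
  set F := localizedIntegrand 𝓐 X ψ w c C with hF
  have hFc : ContinuousOn F N := hN.continuousOn_localizedIntegrand hψ hw c C
  set K' := K ∩ tsupport ψ with hK'
  have hK'c : IsCompact K' := hK.inter_right (isClosed_tsupport ψ)
  have hK'm : MeasurableSet K' := hK'c.measurableSet
  have hK'N : K' ⊆ N := inter_subset_left.trans hKN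
  have hK'p : K' ⊆ (φ p).source := inter_subset_right.trans hψp
  -- off the support of `ψ` the integrand vanishes
  have hF0 : ∀ x ∈ K \ K', F x = 0 := by
    rintro x ⟨hxK, hxK'⟩
    have hx : x ∉ tsupport ψ := fun h => hxK' ⟨hxK, h⟩
    have hx0 : ∀ᶠ z in nhds x, ψ z = 0 := by
      filter_upwards [(isClosed_tsupport ψ).isOpen_compl.mem_nhds hx] with z hz
      exact image_eq_zero_of_notMem_tsupport hz
    have hxd : φ x x ∈ chartDomain x N := by
      refine ⟨mem_extChartAt_target x, ?_⟩
      rw [mem_preimage, extChartAt_to_inv]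
      exact hKN hxK
    have hc : ContinuousAt (φ x).symm (φ x x) :=
      ((continuousOn_extChartAt_symm x).mono inter_subset_left).continuousAt
        (hN.chartDomain_mem_nhds hxd)
    have hg : flatGrad (ψ ∘ (φ x).symm) (φ x x) = 0 := by
      funext k
      have h1 : (ψ ∘ (φ x).symm) =ᶠ[nhds (φ x x)] fun _ => 0 := by
        refine hc.eventually (p := fun z => ψ z = 0) ?_
        rwa [extChartAt_to_inv]
      rw [flatGrad, partialDeriv_congr k h1, partialDeriv_eq_fderiv (hN.mem_openHalf hxd)]
      simp
    simp only [hF, localizedIntegrand, chartPairing]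
    rw [hx0.self_of_nhds, hg, zero_dotProduct, zero_mul, mul_zero, add_zero]
  rw [setIntegral_eq_of_subset_of_forall_sdiff_eq_zero hK.measurableSet inter_subset_left hF0,
    ← integral_indicator hK'm, integral_riemannianMeasure_eq 𝓐.g p hK'm (hK'N.trans hN.interior)
      hK'p ((continuousOn_congr fun x hx => indicator_of_mem hx F).2 (hFc.mono hK'N))
      (fun x hx => indicator_of_notMem hx F) ((hN.continuousOn_sqrt_det p).mono
        fun y hy => ⟨hy.1, hK'N hy.2⟩)]
  have hD : chartDomain (n := n) p K' = φ p '' K' := by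
    ext y
    constructor
    · exact fun hy => ⟨_, hy.2, (φ p).right_inv hy.1⟩
    · rintro ⟨x, hx, rfl⟩
      refine ⟨(φ p).map_source (hK'p hx), ?_⟩
      rwa [mem_preimage, (φ p).left_inv (hK'p hx)]
  have hDc : IsCompact (chartDomain (n := n) p K') := by
    rw [hD]
    exact isCompact_image_extChartAt hK'c hK'p
  have hDN : chartDomain (n := n) p K' ⊆ chartDomain p N := fun y hy => ⟨hy.1, hK'N hy.2⟩
  have hDm := hDc.measurableSet
  -- the vector field whose divergence bounds the integrand
  have hB : ∀ k : Fin n, ∀ y ∈ chartDomain p N, ContDiffAt ℝ ∞ (fun z => (ψ ∘ (φ p).symm) z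
      * w (𝓐.rCoord p z) * currentDensity (𝓐.hCoord p) (𝓐.rCoord p) (formCoord X p) z k) y :=
    fun k y hy => ((hN.contDiffAt_comp_symm hy hψ).mul
      ((hw _ (hN.rCoord_pos hy)).comp y (hN.contDiffAt_rCoord hy))).mul
        (hN.contDiffAt_currentDensity hy k)
  have hdiv := fun k => setIntegral_partialDeriv_eq_zero
    (isOpen_chartDomain hN.isOpen hN.interior p) (chartDomain_subset_openHalf hN.interior p) hDc
    hDN (hB k) (fun y hy hyK => by
      by_cases hs : (φ p).symm y ∈ tsupport ψ
      · rcases hKX _ hy.2 fun h => hyK ⟨hy.1, h, hs⟩ with h | h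
        · have : w (𝓐.rCoord p y) = 0 := h
          rw [this, mul_zero, zero_mul]
        · rw [hN.currentDensity_eq_zero hy h, mul_zero]
      · rw [Function.comp, image_eq_zero_of_notMem_tsupport hs, zero_mul, zero_mul]) k
  have hsum : ∫ y in chartDomain p K', ∑ k, partialDeriv k (fun z => (ψ ∘ (φ p).symm) z
      * w (𝓐.rCoord p z) * currentDensity (𝓐.hCoord p) (𝓐.rCoord p) (formCoord X p) z k) y = 0 := by
    rw [integral_finsetSum _ fun k _ => (hdiv k).1]
    exact Finset.sum_eq_zero fun k _ => (hdiv k).2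
  rw [← hsum]
  have hFi : EqOn (fun y => Real.sqrt (metricCoord 𝓐.g p y).det * F ((φ p).symm y))
      (fun y => Real.sqrt (metricCoord 𝓐.g p y).det * K'.indicator F ((φ p).symm y))
      (chartDomain p K') := fun y hy => by
    simp only [indicator_of_mem (show (φ p).symm y ∈ K' from hy.2)]
  rw [← setIntegral_congr_fun hDm hFi]
  refine setIntegral_mono_on ?_ (integrable_finsetSum _ fun k _ => (hdiv k).1) hDm fun y hy => ?_
  · refine ContinuousOn.integrableOn_compact hDc ?_
    refine ((hN.continuousOn_sqrt_det p).mono hDN).mul ?_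
    exact hFc.comp ((continuousOn_extChartAt_symm p).mono inter_subset_left) fun y hy => hK'N hy.2
  · exact hN.weighted_le_divergence (hDN hy) hψ hw hψ0 hw0 hw' (hest y (hDN hy))

end Integration

end AsymptoticallyHyperbolic

end

noncomputable section

/-! ### The weighted inequality near infinity -/

section Partition

variable {n : ℕ} [NeZero n] (M : Type*) [TopologicalSpace M] [T2Space M] [CompactSpace M]
  [ChartedSpace (EuclideanHalfSpace n) M] [IsManifold (𝓡∂ n) ∞ M]

/-- A finite smooth partition of unity on a compact manifold, subordinate to the charts. -/
lemma exists_finite_smooth_partition : ∃ (I : Finset M) (ψ : M → M → ℝ),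
    (∀ p, ContMDiff (𝓡∂ n) 𝓘(ℝ, ℝ) ∞ (ψ p)) ∧ (∀ p x, 0 ≤ ψ p x) ∧
      (∀ p, tsupport (ψ p) ⊆ (extChartAt (𝓡∂ n) p).source) ∧ ∀ x, ∑ p ∈ I, ψ p x = 1 := by
  obtain ⟨f, hf⟩ := SmoothPartitionOfUnity.exists_isSubordinate_chartAt_source (𝓡∂ n) M
  have hfin := f.locallyFinite.finite_nonempty_of_compact
  refine ⟨hfin.toFinset, fun p => f p, fun p => (f p).contMDiff, fun p x => f.nonneg p x,
    fun p => by rw [extChartAt_source]; exact hf p, fun x => ?_⟩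
  rw [← f.sum_eq_one (mem_univ x)]
  refine (finsum_eq_sum_of_support_subset _ fun p hp => ?_).symm
  rw [Finite.coe_toFinset]
  exact ⟨x, hp⟩

end Partition

namespace AsymptoticallyHyperbolic

variable {n : ℕ} [NeZero n] {M : Type*} [TopologicalSpace M]
  [ChartedSpace (EuclideanHalfSpace n) M] [IsManifold (𝓡∂ n) ∞ M]
  {𝓐 : AsymptoticallyHyperbolic n M} {X : OneForm n M} {N : Set M}

local notation "φ" => extChartAt (𝓡∂ n)

section Pointwise

omit [IsManifold (𝓡∂ n) ∞ M] in
lemma mem_chartDomain_self {x : M} (hx : x ∈ N) : φ x x ∈ chartDomain x N := by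
  refine ⟨mem_extChartAt_target x, ?_⟩
  rw [mem_preimage, extChartAt_to_inv]
  exact hx

variable (hN : 𝓐.RegularOn X N) {x : M} (hx : x ∈ N)

include hN hx

lemma RegularOn.formNormSq_nonneg : 0 ≤ formNormSq 𝓐.g X x :=
  normSq₁_nonneg (hN.posDef_metricCoord (mem_chartDomain_self hx)) _

lemma RegularOn.covDerivNormSq_nonneg : 0 ≤ covDerivNormSq 𝓐.g X x :=
  normSq₂_nonneg (hN.posDef_metricCoord (mem_chartDomain_self hx)) _

lemma RegularOn.killingNormSq_nonneg : 0 ≤ killingNormSq 𝓐.g X x :=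
  normSq₂_nonneg (hN.posDef_metricCoord (mem_chartDomain_self hx)) _

lemma RegularOn.opUNormSq_nonneg : 0 ≤ opUNormSq 𝓐.g X x :=
  normSq₃_nonneg (hN.posDef_metricCoord (mem_chartDomain_self hx)) _

/-- The differentials of a partition of unity add up to zero. -/
lemma RegularOn.sum_chartPairing_eq_zero {I : Finset M} {ψ : M → M → ℝ}
    (hψ : ∀ p, ContMDiff (𝓡∂ n) 𝓘(ℝ, ℝ) ∞ (ψ p)) (hψ1 : ∀ x, ∑ p ∈ I, ψ p x = 1) :
    ∑ p ∈ I, chartPairing 𝓐 X (ψ p) x (φ x x) = 0 := by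
  have hy := mem_chartDomain_self (n := n) hx
  have h1 : ∑ p ∈ I, flatGrad (ψ p ∘ (φ x).symm) (φ x x) = 0 := by
    funext k
    rw [Finset.sum_apply]
    simp only [flatGrad]
    rw [← partialDeriv_sum (hN.mem_openHalf hy) I k
      fun p _ => (hN.contDiffAt_comp_symm hy (hψ p)).differentiableAt (by simp)]
    have h2 : (fun z => ∑ p ∈ I, (ψ p ∘ (φ x).symm) z) = fun _ => 1 := funext fun z => hψ1 _
    rw [h2, partialDeriv_eq_fderiv (hN.mem_openHalf hy)]
    simp
  simp only [chartPairing]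
  rw [← sum_dotProduct, h1, zero_dotProduct]

omit hN hx in
lemma formNormSq_eq_zero (h0 : ∀ᶠ z in nhds x, X z = 0) : formNormSq 𝓐.g X x = 0 := by
  have h : formCoord X x (φ x x) = 0 := by
    funext i
    have h1 : X ((φ x).symm (φ x x)) = 0 := by
      rw [extChartAt_to_inv]
      exact h0.self_of_nhds
    rw [formCoord, h1]
    rfl
  rw [formNormSq, h]
  simp [normSq₁]

lemma RegularOn.covDerivNormSq_eq_zero (h0 : ∀ᶠ z in nhds x, X z = 0) :
    covDerivNormSq 𝓐.g X x = 0 := by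
  have hy := mem_chartDomain_self (n := n) hx
  have hc : ContinuousAt (φ x).symm (φ x x) :=
    ((continuousOn_extChartAt_symm x).mono inter_subset_left).continuousAt
      (hN.chartDomain_mem_nhds hy)
  have h1 : ∀ᶠ z in nhds (φ x x), ∀ i, formCoord X x z i = 0 := by
    have h2 := hc.eventually (p := fun z => X z = 0) (by rwa [extChartAt_to_inv])
    filter_upwards [h2] with z hz i
    rw [formCoord, hz]
    rfl
  have h : covDeriv 𝓐.g X x (φ x x) = 0 := by
    funext i j
    rw [covDeriv, partialDeriv_congr (f' := fun _ => (0 : ℝ)) i (h1.mono fun z hz => hz j),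
      partialDeriv_eq_fderiv (hN.mem_openHalf hy)]
    simp only [h1.self_of_nhds, mul_zero, Finset.sum_const_zero, sub_zero]
    simp
  rw [covDerivNormSq, h]
  simp [normSq₂]

end Pointwise

variable [T2Space M] [CompactSpace M] [MeasurableSpace M] [BorelSpace M]

/-- The weighted inequality near infinity, for a weight `w` that decays at least as fast as
`t ^ (1 + 2 * s - n)`, and such that `w (ρ) X` has compact support `K` in the region `N`. -/
lemma exists_weighted_inequality (𝓐 : AsymptoticallyHyperbolic n M) {s : ℝ} (hs : s < 2)
    (hn : 3 ≤ n) : ∃ ε c C : ℝ, 0 < ε ∧ 0 < c ∧ 0 ≤ C ∧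
      ∀ (X : OneForm n M) (N : Set M), 𝓐.RegularOn X N → (∀ x ∈ N, 𝓐.ρ x ≤ ε) →
      ∀ w : ℝ → ℝ, (∀ t, 0 < t → ContDiffAt ℝ ∞ w t) → (∀ t, 0 < t → 0 ≤ w t) →
      (∀ t, 0 < t → t * deriv w t ≤ (1 + 2 * s - n) * w t) →
      ∀ K : Set M, IsCompact K → K ⊆ N →
      (∀ x ∈ N, x ∉ K → w (𝓐.ρ x) = 0 ∨ ∀ᶠ z in nhds x, X z = 0) →
      c * ∫ x in K, w (𝓐.ρ x) * 𝓐.ρ x ^ (n - 1) * (formNormSq 𝓐.g X x + covDerivNormSq 𝓐.g X x)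
          ∂(riemannianMeasure 𝓐.g)
        ≤ C * ∫ x in K, w (𝓐.ρ x) * 𝓐.ρ x ^ (n - 1) *
          (killingNormSq 𝓐.g X x + opUNormSq 𝓐.g X x) ∂(riemannianMeasure 𝓐.g) := by
  obtain ⟨I, ψ, hψ, hψ0, hψp, hψ1⟩ := exists_finite_smooth_partition (n := n) M
  obtain ⟨c, hc, H⟩ := 𝓐.exists_chart_estimate hs hn
  choose ε C hε hC hest using fun p => H p (tsupport (ψ p))
    (isClosed_tsupport (ψ p)).isCompact (hψp p)
  obtain ⟨ε₀, hε₀, hε₀I⟩ : ∃ ε₀ : ℝ, 0 < ε₀ ∧ ∀ p ∈ I, ε₀ ≤ ε p := by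
    have h1 : ∀ᶠ t in nhdsWithin (0 : ℝ) (Ioi 0), ∀ p ∈ I, t ≤ ε p :=
      (Finset.eventually_all I).2 fun p _ =>
        nhdsWithin_le_nhds ((eventually_lt_nhds (hε p)).mono fun _ => le_of_lt)
    obtain ⟨t, ht, ht0⟩ := (h1.and self_mem_nhdsWithin).exists
    exact ⟨t, ht0, ht⟩
  refine ⟨ε₀, c, ∑ p ∈ I, C p, hε₀, hc, Finset.sum_nonneg fun p _ => hC p, ?_⟩
  intro X N hN hNε w hw hw0 hw' K hK hKN hKX
  set C₀ := ∑ p ∈ I, C p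
  have hloc : ∀ p ∈ I, ∫ x in K, localizedIntegrand 𝓐 X (ψ p) w c C₀ x
      ∂(riemannianMeasure 𝓐.g) ≤ 0 := fun p hp => by
    refine hN.setIntegral_localizedIntegrand_nonpos (hψ p) (hψ0 p) hw hK hKN hKX c C₀ (hψp p) hw0
      hw' fun y hy hyT => ?_
    refine le_trans ?_ (hest p X N hN y hy hyT ((hNε _ hy.2).trans (hε₀I p hp)))
    have hCp : C p ≤ C₀ := Finset.single_le_sum (fun q _ => hC q) hp
    have hd := add_nonneg (hN.killingNormSq_nonneg hy.2) (hN.opUNormSq_nonneg hy.2)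
    have := mul_le_mul_of_nonneg_right hCp hd
    exact mul_le_mul_of_nonneg_left (by linarith) (Real.sqrt_nonneg _)
  have hsum : ∫ x in K, ∑ p ∈ I, localizedIntegrand 𝓐 X (ψ p) w c C₀ x
      ∂(riemannianMeasure 𝓐.g) ≤ 0 := by
    rw [integral_finsetSum _ fun p _ => hN.integrableOn hK hKN
      (hN.continuousOn_localizedIntegrand (hψ p) hw c C₀)]
    exact Finset.sum_nonpos hloc
  have hcW : ContinuousOn (fun x => w (𝓐.ρ x) * 𝓐.ρ x ^ (n - 1)) N :=
    (hN.continuousOn_weight hw).fun_mul (𝓐.smooth.continuous.continuousOn.fun_pow _)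
  have hie := hN.integrableOn hK hKN (hcW.fun_mul
    (hN.continuousOn_formNormSq.fun_add hN.continuousOn_covDerivNormSq))
  have hid := hN.integrableOn hK hKN (hcW.fun_mul
    (hN.continuousOn_killingNormSq.fun_add hN.continuousOn_opUNormSq))
  rw [← sub_nonpos, ← integral_const_mul, ← integral_const_mul,
    ← integral_sub (hie.const_mul c) (hid.const_mul C₀)]
  refine le_of_eq_of_le (setIntegral_congr_fun hK.measurableSet fun x hx => ?_) hsum
  simp only [localizedIntegrand, Finset.sum_add_distrib, ← Finset.sum_mul, ← Finset.mul_sum]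
  rw [hψ1, hN.sum_chartPairing_eq_zero (hKN hx) hψ hψ1]
  ring

end AsymptoticallyHyperbolic

end

noncomputable section

/-! ### Decreasing cutoff functions and the inequality on the end -/

section CutoffWeight

/-- The power `t ^ β`, cut off between `a` and `b`: it is unchanged for `t ≤ a` and vanishes for
`b ≤ t`. -/
def cutoffWeight (a b β t : ℝ) : ℝ := Real.smoothTransition ((b - t) / (b - a)) * t ^ β

variable {a b β t : ℝ}

lemma contDiffAt_cutoffWeight (ht : 0 < t) : ContDiffAt ℝ ∞ (cutoffWeight a b β) t :=
  ((Real.smoothTransition.contDiff (n := (⊤ : ℕ∞))).contDiffAt.comp t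
    ((contDiffAt_const.sub contDiffAt_id).div_const _)).mul
    (Real.contDiffAt_rpow_const_of_ne ht.ne')

lemma cutoffWeight_nonneg (ht : 0 < t) : 0 ≤ cutoffWeight a b β t :=
  mul_nonneg (Real.smoothTransition.nonneg _) (Real.rpow_nonneg ht.le _)

lemma cutoffWeight_le (ht : 0 < t) : cutoffWeight a b β t ≤ t ^ β :=
  mul_le_of_le_one_left (Real.rpow_nonneg ht.le _) (Real.smoothTransition.le_one _)

lemma cutoffWeight_of_le (hab : a < b) (ht : t ≤ a) : cutoffWeight a b β t = t ^ β := by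
  rw [cutoffWeight, Real.smoothTransition.one_of_one_le, one_mul]
  rw [le_div_iff₀ (sub_pos.2 hab)]
  linarith

lemma cutoffWeight_of_ge (hab : a < b) (ht : b ≤ t) : cutoffWeight a b β t = 0 := by
  rw [cutoffWeight, Real.smoothTransition.zero_of_nonpos, zero_mul]
  exact div_nonpos_of_nonpos_of_nonneg (by linarith) (by linarith)

/-- The cutoff only increases the rate of decay, since the cutoff function is decreasing. -/
lemma mul_deriv_cutoffWeight_le (hab : a < b) (ht : 0 < t) :
    t * deriv (cutoffWeight a b β) t ≤ β * cutoffWeight a b β t := by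
  have hχ : DifferentiableAt ℝ (fun t => Real.smoothTransition ((b - t) / (b - a))) t :=
    ((Real.smoothTransition.contDiff (n := (⊤ : ℕ∞))).contDiffAt.comp t
      ((contDiffAt_const.sub contDiffAt_id).div_const _)).differentiableAt (by simp)
  have hanti : Antitone fun t => Real.smoothTransition ((b - t) / (b - a)) := fun u v huv =>
    Real.smoothTransition.monotone
      (div_le_div_of_nonneg_right (by linarith) (by linarith))
  have hχ' : deriv (fun t => Real.smoothTransition ((b - t) / (b - a))) t ≤ 0 := hanti.deriv_nonpos
  have h := (hχ.hasDerivAt.mul (Real.hasDerivAt_rpow_const (p := β) (Or.inl ht.ne'))).deriv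
  have h' : deriv (cutoffWeight a b β) t = _ := h
  have hp : t * t ^ (β - 1) = t ^ β := by
    rw [Real.rpow_sub_one ht.ne']
    field_simp
  rw [h', cutoffWeight, ← hp]
  have h2 := mul_nonneg ht.le (mul_nonneg ht.le (Real.rpow_nonneg ht.le (β - 1)))
  nlinarith [mul_nonneg (neg_nonneg.2 hχ') h2]

end CutoffWeight

namespace AsymptoticallyHyperbolic

variable {n : ℕ} [NeZero n] {M : Type*} [TopologicalSpace M]
  [ChartedSpace (EuclideanHalfSpace n) M] [IsManifold (𝓡∂ n) ∞ M]

local notation "φ" => extChartAt (𝓡∂ n)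

variable [CompactSpace M] (𝓐 : AsymptoticallyHyperbolic n M)

/-- Points near infinity are interior points of the manifold with boundary. -/
lemma exists_subset_interior :
    ∃ ε : ℝ, 0 < ε ∧ {x | 0 < 𝓐.ρ x ∧ 𝓐.ρ x ≤ ε} ⊆ (𝓡∂ n).interior M := by
  obtain ⟨m, hm, hmb⟩ := exists_pos_le_of_isCompact 𝓐.isClosed_inner.isCompact (F := 𝓐.ρ)
    𝓐.smooth.continuous.continuousOn fun x hx => hx.2
  refine ⟨m / 2, by linarith, fun x hx => ?_⟩
  by_contra h
  have hb : x ∈ (𝓡∂ n).boundary M := by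
    rw [← ModelWithCorners.compl_interior]
    exact h
  have h1 := hmb x ⟨hb, hx.1⟩
  have h2 : 𝓐.ρ x ≤ m / 2 := hx.2
  linarith

variable [T2Space M] [MeasurableSpace M] [BorelSpace M]

/-- The level sets of the defining function near infinity are null sets. -/
lemma exists_level_set_null : ∃ ε : ℝ, 0 < ε ∧ ∀ τ, 0 < τ → τ ≤ ε →
    riemannianMeasure 𝓐.g (𝓐.ρ ⁻¹' {τ}) = 0 := by
  obtain ⟨ε₁, hε₁, hint⟩ := 𝓐.exists_subset_interior
  obtain ⟨I, ψ, hψ, hψ0, hψp, hψ1⟩ := exists_finite_smooth_partition (n := n) M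
  choose ε hε hne using fun p => 𝓐.exists_flatGrad_rCoord_ne_zero
    (isClosed_tsupport (ψ p)).isCompact (hψp p)
  have h1 : ∀ᶠ t in nhdsWithin (0 : ℝ) (Ioi 0), ∀ p ∈ I, t ≤ ε p :=
    (Finset.eventually_all I).2 fun p _ =>
      nhdsWithin_le_nhds ((eventually_lt_nhds (hε p)).mono fun _ => le_of_lt)
  obtain ⟨ε₀, hε₀I, hε₀⟩ := (h1.and self_mem_nhdsWithin).exists
  refine ⟨min ε₁ ε₀, lt_min hε₁ hε₀, fun τ hτ hτε => ?_⟩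
  refine riemannianMeasure_level_set_eq_zero 𝓐.g 𝓐.smooth
    (isClosed_singleton.preimage 𝓐.smooth.continuous).isCompact (fun x hx => hint ?_) fun x hx => ?_
  · rw [mem_preimage, mem_singleton_iff] at hx
    exact ⟨by rwa [hx], by rw [hx]; exact hτε.trans (min_le_left _ _)⟩
  · rw [mem_preimage, mem_singleton_iff] at hx
    obtain ⟨p, hp, hpx⟩ : ∃ p ∈ I, ψ p x ≠ 0 :=
      Finset.exists_ne_zero_of_sum_ne_zero (by rw [hψ1 x]; exact one_ne_zero)
    have hxT : x ∈ tsupport (ψ p) := subset_tsupport _ hpx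
    refine ⟨p, hψp p hxT, hne p x hxT ?_⟩
    rw [hx]
    exact hτε.trans ((min_le_right _ _).trans (hε₀I p hp))

/-- The squared form of the estimate, on the part of the end below a level set. -/
lemma exists_lintegral_le {s : ℝ} (hs : s < 2) (hn : 3 ≤ n) : ∃ (ε : ℝ) (κ : ℝ≥0), 0 < ε ∧
    ∀ (R : ℝ) (X : OneForm n M), 𝓐.IsTestForm R X → Real.exp (-2 * R) ≤ ε →
      𝓐.RegularOn X {x | 0 < 𝓐.ρ x ∧ 𝓐.ρ x < Real.exp (-2 * R)} ∧
      ∀ a, 0 < a → a < Real.exp (-2 * R) →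
        ∫⁻ x in {x | 0 < 𝓐.ρ x ∧ 𝓐.ρ x ≤ a}, ENNReal.ofReal
            ((formNormSq 𝓐.g X x + covDerivNormSq 𝓐.g X x) * 𝓐.ρ x ^ (2 * s))
            ∂(riemannianMeasure 𝓐.g)
          ≤ κ * ∫⁻ x in {x | 0 < 𝓐.ρ x ∧ 𝓐.ρ x < Real.exp (-2 * R)}, ENNReal.ofReal
            ((killingNormSq 𝓐.g X x + opUNormSq 𝓐.g X x) * 𝓐.ρ x ^ (2 * s))
            ∂(riemannianMeasure 𝓐.g) := by
  obtain ⟨ε₁, hε₁, hint⟩ := 𝓐.exists_subset_interior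
  obtain ⟨ε₂, c, C, hε₂, hc, hC, H⟩ := 𝓐.exists_weighted_inequality hs hn
  refine ⟨min ε₁ ε₂, (C / c).toNNReal, lt_min hε₁ hε₂, fun R X hX hRε => ?_⟩
  set τ := Real.exp (-2 * R)
  set N : Set M := {x | 0 < 𝓐.ρ x ∧ 𝓐.ρ x < τ} with hNdef
  have hρc := 𝓐.smooth.continuous
  have hNE : N ⊆ 𝓐.endSet R := fun x hx => ⟨hx.1, hx.2.le⟩
  have hN : 𝓐.RegularOn X N :=
    { isOpen := (isOpen_lt continuous_const hρc).inter (isOpen_lt hρc continuous_const)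
      interior := fun x hx => hint ⟨hx.1, hx.2.le.trans (hRε.trans (min_le_left _ _))⟩
      pos := fun x hx => hx.1
      smooth := hX.1.mono hNE }
  refine ⟨hN, fun a ha haτ => ?_⟩
  obtain ⟨KX, hKX, hKXE, hX0⟩ := hX.2
  -- the cutoff takes place between `a` and `b`
  obtain ⟨b, hab, hbτ⟩ := exists_between haτ
  set K : Set M := KX ∩ {x | 𝓐.ρ x ≤ b} with hKdef
  have hK : IsCompact K := hKX.inter_right (isClosed_le hρc continuous_const)
  have hKN : K ⊆ N := fun x hx => ⟨(hKXE hx.1).1, hx.2.trans_lt hbτ⟩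
  have hfar : ∀ x ∈ N, x ∉ KX → ∀ᶠ z in nhds x, X z = 0 := fun x hx hxK => by
    filter_upwards [hN.isOpen.mem_nhds hx, hKX.isClosed.isOpen_compl.mem_nhds hxK] with z hz hzK
    exact hX0 z ⟨hNE hz, hzK⟩
  set w := cutoffWeight a b (1 + 2 * s - n) with hw
  have hpow : ∀ t : ℝ, 0 < t → t ^ (1 + 2 * s - n) * t ^ (n - 1) = t ^ (2 * s) := fun t ht => by
    have hn1 : ((n - 1 : ℕ) : ℝ) = (n : ℝ) - 1 := by
      rw [Nat.cast_sub (by omega), Nat.cast_one]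
    rw [← Real.rpow_add_natCast ht.ne', hn1]
    congr 1
    ring
  have key := H X N hN (fun x hx => hx.2.le.trans (hRε.trans (min_le_right _ _))) w
    (fun t ht => contDiffAt_cutoffWeight ht) (fun t ht => cutoffWeight_nonneg ht)
    (fun t ht => mul_deriv_cutoffWeight_le hab ht) K hK hKN fun x hx hxK => by
      by_cases h : x ∈ KX
      · left
        have hb : ¬ 𝓐.ρ x ≤ b := fun h' => hxK ⟨h, h'⟩
        exact cutoffWeight_of_ge hab (not_le.1 hb).le
      · exact Or.inr (hfar x hx h)
  have hw0 : ∀ x ∈ N, 0 ≤ w (𝓐.ρ x) * 𝓐.ρ x ^ (n - 1) := fun x hx =>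
    mul_nonneg (cutoffWeight_nonneg hx.1) (pow_nonneg hx.1.le _)
  have he0 : ∀ x ∈ N, 0 ≤ formNormSq 𝓐.g X x + covDerivNormSq 𝓐.g X x := fun x hx =>
    add_nonneg (hN.formNormSq_nonneg hx) (hN.covDerivNormSq_nonneg hx)
  have hd0 : ∀ x ∈ N, 0 ≤ killingNormSq 𝓐.g X x + opUNormSq 𝓐.g X x := fun x hx =>
    add_nonneg (hN.killingNormSq_nonneg hx) (hN.opUNormSq_nonneg hx)
  have hcW : ContinuousOn (fun x => w (𝓐.ρ x) * 𝓐.ρ x ^ (n - 1)) N :=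
    (hN.continuousOn_weight fun t ht => contDiffAt_cutoffWeight ht).fun_mul
      (hρc.continuousOn.fun_pow _)
  have hie := hN.integrableOn hK hKN (hcW.fun_mul
    (hN.continuousOn_formNormSq.fun_add hN.continuousOn_covDerivNormSq))
  have hid := hN.integrableOn hK hKN (hcW.fun_mul
    (hN.continuousOn_killingNormSq.fun_add hN.continuousOn_opUNormSq))
  have hm : MeasurableSet {x | 0 < 𝓐.ρ x ∧ 𝓐.ρ x ≤ a} :=
    ((isOpen_lt continuous_const hρc).measurableSet).inter
      (isClosed_le hρc continuous_const).measurableSet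
  calc ∫⁻ x in {x | 0 < 𝓐.ρ x ∧ 𝓐.ρ x ≤ a}, ENNReal.ofReal
          ((formNormSq 𝓐.g X x + covDerivNormSq 𝓐.g X x) * 𝓐.ρ x ^ (2 * s))
          ∂(riemannianMeasure 𝓐.g)
      ≤ ∫⁻ x in {x | 0 < 𝓐.ρ x ∧ 𝓐.ρ x ≤ a}, K.indicator (fun x => ENNReal.ofReal
          (w (𝓐.ρ x) * 𝓐.ρ x ^ (n - 1) * (formNormSq 𝓐.g X x + covDerivNormSq 𝓐.g X x))) x
          ∂(riemannianMeasure 𝓐.g) := by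
        refine setLIntegral_mono' hm fun x hx => ?_
        have hxN : x ∈ N := ⟨hx.1, hx.2.trans_lt haτ⟩
        by_cases hxK : x ∈ K
        · rw [indicator_of_mem hxK, hw, cutoffWeight_of_le hab hx.2, hpow _ hx.1, mul_comm]
        · have hxX : x ∉ KX := fun h => hxK ⟨h, hx.2.trans hab.le⟩
          have h0 := hfar x hxN hxX
          rw [formNormSq_eq_zero h0, hN.covDerivNormSq_eq_zero hxN h0, add_zero, zero_mul,
            ENNReal.ofReal_zero]
          exact zero_le
    _ ≤ ∫⁻ x in K, ENNReal.ofReal (w (𝓐.ρ x) * 𝓐.ρ x ^ (n - 1) *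
          (formNormSq 𝓐.g X x + covDerivNormSq 𝓐.g X x)) ∂(riemannianMeasure 𝓐.g) := by
        rw [← lintegral_indicator hK.measurableSet]
        exact setLIntegral_le_lintegral _ _
    _ = ENNReal.ofReal (∫ x in K, w (𝓐.ρ x) * 𝓐.ρ x ^ (n - 1) *
          (formNormSq 𝓐.g X x + covDerivNormSq 𝓐.g X x) ∂(riemannianMeasure 𝓐.g)) :=
        (ofReal_integral_eq_lintegral_ofReal hie (ae_restrict_of_forall_mem hK.measurableSet
          fun x hx => mul_nonneg (hw0 x (hKN hx)) (he0 x (hKN hx)))).symm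
    _ ≤ ENNReal.ofReal (C / c * ∫ x in K, w (𝓐.ρ x) * 𝓐.ρ x ^ (n - 1) *
          (killingNormSq 𝓐.g X x + opUNormSq 𝓐.g X x) ∂(riemannianMeasure 𝓐.g)) := by
        refine ENNReal.ofReal_le_ofReal ?_
        rw [div_mul_eq_mul_div, le_div_iff₀' hc]
        exact key
    _ = ((C / c).toNNReal : ℝ≥0∞) * ∫⁻ x in K, ENNReal.ofReal (w (𝓐.ρ x) * 𝓐.ρ x ^ (n - 1) *
          (killingNormSq 𝓐.g X x + opUNormSq 𝓐.g X x)) ∂(riemannianMeasure 𝓐.g) := by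
        rw [ENNReal.ofReal_mul (div_nonneg hC hc.le), ofReal_integral_eq_lintegral_ofReal hid
          (ae_restrict_of_forall_mem hK.measurableSet
            fun x hx => mul_nonneg (hw0 x (hKN hx)) (hd0 x (hKN hx)))]
        rfl
    _ ≤ _ := by
        refine mul_le_mul_right ?_ _
        refine (setLIntegral_mono' hK.measurableSet fun x hx => ?_).trans (lintegral_mono_set hKN)
        have hxN := hKN hx
        refine ENNReal.ofReal_le_ofReal ?_
        rw [mul_comm, ← hpow _ hxN.1]
        exact mul_le_mul_of_nonneg_left (mul_le_mul_of_nonneg_right (cutoffWeight_le hxN.1)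
          (pow_nonneg hxN.1.le _)) (hd0 x hxN)

end AsymptoticallyHyperbolic

end

noncomputable section

/-! ### The limit at the level set -/

namespace AsymptoticallyHyperbolic

variable {n : ℕ} [NeZero n] {M : Type*} [TopologicalSpace M]
  [ChartedSpace (EuclideanHalfSpace n) M] [IsManifold (𝓡∂ n) ∞ M]
  [CompactSpace M] [T2Space M] [MeasurableSpace M] [BorelSpace M]

omit [CompactSpace M] [T2Space M] [BorelSpace M] in
/-- The open end carries the whole measure of the closed end, if the level set is a null set. -/
lemma lintegral_endSet_eq (𝓐 : AsymptoticallyHyperbolic n M) {R : ℝ}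
    (h0 : riemannianMeasure 𝓐.g (𝓐.ρ ⁻¹' {Real.exp (-2 * R)}) = 0) (f : M → ℝ≥0∞) :
    ∫⁻ x in 𝓐.endSet R, f x ∂(riemannianMeasure 𝓐.g)
      = ∫⁻ x in {x | 0 < 𝓐.ρ x ∧ 𝓐.ρ x < Real.exp (-2 * R)}, f x ∂(riemannianMeasure 𝓐.g) := by
  refine setLIntegral_congr (Filter.EventuallyLE.antisymm ?_ ?_)
  · refine ae_le_set.2 (measure_mono_null ?_ h0)
    rintro x ⟨⟨hx0, hx1⟩, hx2⟩
    exact le_antisymm hx1 (not_lt.1 fun h => hx2 ⟨hx0, h⟩)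
  · exact Filter.Eventually.of_forall fun x hx => ⟨hx.1, hx.2.le⟩

omit [CompactSpace M] [T2Space M] [BorelSpace M] in
/-- Bounds on the sets `{0 < ρ ≤ a}` for `a < τ` pass to `{0 < ρ < τ}` by monotone convergence. -/
lemma lintegral_openEnd_le (𝓐 : AsymptoticallyHyperbolic n M) {τ : ℝ} (hτ : 0 < τ)
    {f : M → ℝ≥0∞} {B : ℝ≥0∞} (h : ∀ a, 0 < a → a < τ →
      ∫⁻ x in {x | 0 < 𝓐.ρ x ∧ 𝓐.ρ x ≤ a}, f x ∂(riemannianMeasure 𝓐.g) ≤ B) :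
    ∫⁻ x in {x | 0 < 𝓐.ρ x ∧ 𝓐.ρ x < τ}, f x ∂(riemannianMeasure 𝓐.g) ≤ B := by
  obtain ⟨a, ha, haτ, hlim⟩ := exists_seq_strictMono_tendsto' hτ
  have hU : {x | 0 < 𝓐.ρ x ∧ 𝓐.ρ x < τ} = ⋃ k, {x | 0 < 𝓐.ρ x ∧ 𝓐.ρ x ≤ a k} := by
    ext x
    simp only [mem_ofPred_eq, mem_iUnion]
    constructor
    · rintro ⟨h1, h2⟩
      obtain ⟨k, hk⟩ := (hlim.eventually (eventually_gt_nhds h2)).exists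
      exact ⟨k, h1, hk.le⟩
    · rintro ⟨k, h1, h2⟩
      exact ⟨h1, h2.trans_lt (haτ k).2⟩
  rw [hU, setLIntegral_iUnion_of_directed]
  · exact iSup_le fun k => h _ (haτ k).1 (haτ k).2
  · exact Monotone.directed_le fun i j hij x hx => ⟨hx.1, hx.2.trans (ha.monotone hij)⟩

end AsymptoticallyHyperbolic

theorem mainTheorem4 {n : ℕ} [NeZero n] (hn : 3 ≤ n)
    {Mbar : Type*} [TopologicalSpace Mbar] [T2Space Mbar] [CompactSpace Mbar]
    [ChartedSpace (EuclideanHalfSpace n) Mbar] [IsManifold (𝓡∂ n) ∞ Mbar]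
    [MeasurableSpace Mbar] [BorelSpace Mbar]
    (𝓐 : AsymptoticallyHyperbolic n Mbar) (δ : ℝ) (hδ : δ ∈ Set.Ioo (-2 : ℝ) (-1)) :
    ∃ R₀ : ℝ, 0 < R₀ ∧ ∃ c : ℝ≥0, 0 < c ∧ ∀ R : ℝ, R₀ < R →
      ∀ X : OneForm n Mbar, 𝓐.IsTestForm R X →
        𝓐.weightedW12 (-δ) (𝓐.endSet R) X ≤
          c * (𝓐.weightedL2 (-δ) (𝓐.endSet R) (opUNormSq 𝓐.g X)
            + 𝓐.weightedL2 (-δ) (𝓐.endSet R) (killingNormSq 𝓐.g X)) := by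
  have hs : -δ < 2 := by linarith [hδ.1]
  obtain ⟨ε₁, κ, hε₁, H⟩ := 𝓐.exists_lintegral_le hs hn
  obtain ⟨ε₂, hε₂, hnull⟩ := 𝓐.exists_level_set_null
  refine ⟨max 1 (-Real.log (min ε₁ ε₂) / 2), lt_max_of_lt_left one_pos,
    2 * (κ + 1) ^ (1 / 2 : ℝ), by positivity, fun R hR X hX => ?_⟩
  have hRε : Real.exp (-2 * R) ≤ min ε₁ ε₂ := by
    rw [← Real.le_log_iff_exp_le (lt_min hε₁ hε₂)]
    have := (le_max_right _ _).trans_lt hR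
    linarith
  have hτ := Real.exp_pos (-2 * R)
  obtain ⟨hN, hle⟩ := H R X hX (hRε.trans (min_le_left _ _))
  have hmain := 𝓐.lintegral_openEnd_le hτ hle
  have h0 := hnull _ hτ (hRε.trans (min_le_right _ _))
  simp only [AsymptoticallyHyperbolic.weightedW12, AsymptoticallyHyperbolic.weightedL2,
    𝓐.lintegral_endSet_eq h0]
  set N : Set Mbar := {x | 0 < 𝓐.ρ x ∧ 𝓐.ρ x < Real.exp (-2 * R)} with hNdef
  set μ := riemannianMeasure 𝓐.g
  have hNm := hN.isOpen.measurableSet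
  have hw : ∀ x ∈ N, 0 ≤ 𝓐.ρ x ^ (2 * -δ) := fun x hx => Real.rpow_nonneg hx.1.le _
  set Q := ∫⁻ x in N, ENNReal.ofReal
    ((formNormSq 𝓐.g X x + covDerivNormSq 𝓐.g X x) * 𝓐.ρ x ^ (2 * -δ)) ∂μ
  set A := ∫⁻ x in N, ENNReal.ofReal (opUNormSq 𝓐.g X x * 𝓐.ρ x ^ (2 * -δ)) ∂μ
  set B := ∫⁻ x in N, ENNReal.ofReal (killingNormSq 𝓐.g X x * 𝓐.ρ x ^ (2 * -δ)) ∂μ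
  have h1 : ∫⁻ x in N, ENNReal.ofReal (formNormSq 𝓐.g X x * 𝓐.ρ x ^ (2 * -δ)) ∂μ ≤ Q :=
    setLIntegral_mono' hNm fun x hx => ENNReal.ofReal_le_ofReal (mul_le_mul_of_nonneg_right
      (le_add_of_nonneg_right (hN.covDerivNormSq_nonneg hx)) (hw x hx))
  have h2 : ∫⁻ x in N, ENNReal.ofReal (covDerivNormSq 𝓐.g X x * 𝓐.ρ x ^ (2 * -δ)) ∂μ ≤ Q :=
    setLIntegral_mono' hNm fun x hx => ENNReal.ofReal_le_ofReal (mul_le_mul_of_nonneg_right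
      (le_add_of_nonneg_left (hN.formNormSq_nonneg hx)) (hw x hx))
  have h3 : ∫⁻ x in N, ENNReal.ofReal
      ((killingNormSq 𝓐.g X x + opUNormSq 𝓐.g X x) * 𝓐.ρ x ^ (2 * -δ)) ∂μ = A + B := by
    have hm : AEMeasurable (fun x => ENNReal.ofReal (opUNormSq 𝓐.g X x * 𝓐.ρ x ^ (2 * -δ)))
        (μ.restrict N) := by
      refine ((ContinuousOn.mul hN.continuousOn_opUNormSq fun x hx => ?_).aemeasurable
        hNm).ennreal_ofReal
      exact (𝓐.smooth.continuous.continuousAt.rpow_const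
        (Or.inl (hN.pos x hx).ne')).continuousWithinAt
    rw [← lintegral_add_left' hm]
    refine setLIntegral_congr_fun hNm fun x hx => ?_
    rw [← ENNReal.ofReal_add (mul_nonneg (hN.opUNormSq_nonneg hx) (hw x hx))
      (mul_nonneg (hN.killingNormSq_nonneg hx) (hw x hx))]
    congr 1
    ring
  rw [h3] at hmain
  have hhalf : (0 : ℝ) ≤ 1 / 2 := by norm_num
  have h4 : Q ^ (1 / 2 : ℝ) ≤ ((κ + 1 : ℝ≥0) : ℝ≥0∞) ^ (1 / 2 : ℝ)
      * (A ^ (1 / 2 : ℝ) + B ^ (1 / 2 : ℝ)) := by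
    have h5 : Q ≤ ((κ + 1 : ℝ≥0) : ℝ≥0∞) * (A + B) :=
      hmain.trans (mul_le_mul_left (ENNReal.coe_le_coe.2 le_self_add) _)
    refine (ENNReal.rpow_le_rpow h5 hhalf).trans ?_
    rw [ENNReal.mul_rpow_of_nonneg _ _ hhalf]
    exact mul_le_mul_right (ENNReal.rpow_add_le_add_rpow _ _ hhalf (by norm_num)) _
  calc _ ≤ Q ^ (1 / 2 : ℝ) + Q ^ (1 / 2 : ℝ) :=
        add_le_add (ENNReal.rpow_le_rpow h1 hhalf) (ENNReal.rpow_le_rpow h2 hhalf)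
    _ = 2 * Q ^ (1 / 2 : ℝ) := (two_mul _).symm
    _ ≤ 2 * (((κ + 1 : ℝ≥0) : ℝ≥0∞) ^ (1 / 2 : ℝ) * (A ^ (1 / 2 : ℝ) + B ^ (1 / 2 : ℝ))) :=
        mul_le_mul_right h4 _
    _ = _ := by
        rw [ENNReal.coe_mul, ENNReal.coe_rpow_of_nonneg _ hhalf, mul_assoc]
        rfl

end
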